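/- Throughout, $k$ denotes an algebraically closed field of characteristic zero, and polynomial rings $k[x_1,\dots,x_q]$ come with fixed degrees $|x_i|\in\mathbb{Q}_{>0}$ of their variables. **Potentials.** A *potential* is a polynomial $f\in k[x_1,\dots,x_q]$ that is quasi-homogeneous (homogeneous of some degree in $\mathbb{Q}$ for the given degrees of the variables) and whose Jacobian ring $k[x_1,\dots,x_q]/(\partial_{x_1}f,\dots,\partial_{x_q}f)$ is a nonzero finite-dimensional $k$-vector space. The degrees of the variables are part of the potential. **Matrix factorizations.** Let $f\in k[x_1,\dots,x_q]$ and $g\in k[y_1,\dots,y_n]$ be potentials and $T=k[x_1,\dots,x_q,y_1,\dots,y_n]$, graded by the degrees of all the variables. A *matrix factorization of $f-g$* is a free module $Q=Q_+\oplus Q_-$ with $Q_\pm$ finite direct sums of shifted modules $T(a)$, $a\in\mathbb{Q}$, where $T(a)_m=T_{a+m}$, together with a $T$-linear map $d_Q:Q\to Q$ that is odd ($d_Q(Q_\pm)\subseteq Q_\mp$) and quasi-homogeneous of some degree in $\mathbb{Q}$, such that $d_Q^2=(f-g)\cdot\mathrm{Id}_Q$. In the given homogeneous basis, $d_Q$ is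 a matrix over $T$; $\partial Q$ denotes its entrywise partial derivative, and $\mathrm{str}$ is the supertrace (trace on $Q_+$ minus trace on $Q_-$). **Quantum dimensions.** Let $A$ be a commutative ring and let $F_1,\dots,F_q,h\in A[x_1,\dots,x_q]$ be such that each $x_i$ has a power in $(F_1,\dots,F_q)$. Choose a matrix $M$ over $A[x_1,\dots,x_q]$ and integers $d_i\ge 1$ with $\sum_j M_{ij}F_j=x_i^{d_i}$ for all $i$; the residue $\mathrm{res}\left(\frac{h\,dx_1\wedge\cdots\wedge dx_q}{F_1,\dots,F_q}\right)\in A$ is the coefficient of $x_1^{d_1-1}\cdots x_q^{d_q-1}$ in $h\det M$ (it does not depend on the choice). The left quantum dimension of $Q$ is $$\mathrm{qdim}_f Q=\mathrm{res}\left(\frac{\mathrm{str}(\partial_{x_1}Q\cdots\partial_{x_q}Q\,\partial_{y_1}Q\cdots\partial_{y_n}Q)\,dx_1\wedge\cdots\wedge dx_q}{\partial_{x_1}f,\dots,\partial_{x_q}f}\right)$$ (with $A=k[y_1,\dots,y_n]$). The right quantum dimension $\mathrm{qdim}_g Q$ is the residue of the same supertrace in the variables $y_1,\dots,y_n$ with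 respect to $\partial_{y_1}g,\dots,\partial_{y_n}g$ (with $A=k[x_1,\dots,x_q]$). The potentials $f$ and $g$ are *orbifold equivalent* if there is a matrix factorization of $f-g$ whose left and right quantum dimensions are both nonzero. **Algorithms.** An *algorithm* is a finite deterministic program (an algebraic random access machine, written with assignments, conditionals and while loops) whose memory consists of arrays of natural numbers and arrays of elements of $k$. It can do arithmetic on, and compare, natural numbers, use them as array indices, perform the four field operations in $k$, and test two elements of $k$ for equality. It uses no constants of $k$ except $0$ and $1$. A potential is given to it by the number of variables, the degrees of the variables (numerators and denominators), and any finite list of pairs (exponent vector, coefficient in $k$) whose terms sum to the polynomial. **Proposition.** There is an algorithm, independent of $k$, $q$ and $n$, which, given any two potentials $f\in k[x_1,\dots,x_q]$ and $g\in k[y_1,\dots,y_n]$ over an algebraically closed field $k$ of characteristic zero, terminates if and only if $f$ and $g$ are orbifold equivalent. -/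

import Mathlib

open MvPolynomial

universe u

namespace OrbEq

/-! ## Programs over a field

Deterministic `while` programs that work on natural numbers and on elements of a field `k`, with
arrays of both sorts (the algebraic random access machine, in structured form). A program has no
constants from `k` except `0` and `1`; it is a finite syntactic object that does not depend on
`k`. -/

/-- The memory: countably many arrays of natural numbers and countably many arrays of elements
of `k`, each with cells numbered by the natural numbers. `s.nat a i` is cell `i` of array `a`. -/
structure Store (k : Type u) where
  nat : ℕ → ℕ → ℕ
  fld : ℕ → ℕ → k

/-- Arithmetic expressions. `get a i` reads cell `i` of array `a` of natural numbers. -/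
inductive NatExpr : Type
  | lit (n : ℕ)
  | get (a : ℕ) (i : NatExpr)
  | add (x y : NatExpr)
  | sub (x y : NatExpr)
  | mul (x y : NatExpr)
  | div (x y : NatExpr)

/-- Field expressions. `get a i` reads cell `i` of array `a` of field elements. -/
inductive FldExpr : Type
  | zero
  | one
  | get (a : ℕ) (i : NatExpr)
  | add (x y : FldExpr)
  | sub (x y : FldExpr)
  | mul (x y : FldExpr)
  | div (x y : FldExpr)

/-- Tests: comparison of natural numbers, equality of field elements, boolean combinations. -/
inductive BoolExpr : Type
  | natLe (x y : NatExpr)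
  | fldEq (x y : FldExpr)
  | not (b : BoolExpr)
  | and (b c : BoolExpr)

/-- Programs. `setNat a i x` and `setFld a i x` store the value of `x` in cell `i` of array `a`;
`loop b p` is `while b do p`. -/
inductive Program : Type
  | skip
  | setNat (a : ℕ) (i x : NatExpr)
  | setFld (a : ℕ) (i : NatExpr) (x : FldExpr)
  | seq (p p' : Program)
  | cond (b : BoolExpr) (p p' : Program)
  | loop (b : BoolExpr) (p : Program)

section Semantics

variable {k : Type u}

/-- Subtraction is truncated, division is rounded down, and `x / 0 = 0`. -/
def NatExpr.eval (s : Store k) : NatExpr → ℕ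
  | .lit n => n
  | .get a i => s.nat a (i.eval s)
  | .add x y => x.eval s + y.eval s
  | .sub x y => x.eval s - y.eval s
  | .mul x y => x.eval s * y.eval s
  | .div x y => x.eval s / y.eval s

/-- Division by zero returns `0`; a program can test for it beforehand. -/
def FldExpr.eval [Field k] (s : Store k) : FldExpr → k
  | .zero => 0
  | .one => 1
  | .get a i => s.fld a (i.eval s)
  | .add x y => x.eval s + y.eval s
  | .sub x y => x.eval s - y.eval s
  | .mul x y => x.eval s * y.eval s
  | .div x y => x.eval s / y.eval s

def BoolExpr.Holds [Field k] (s : Store k) : BoolExpr → Prop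
  | .natLe x y => x.eval s ≤ y.eval s
  | .fldEq x y => x.eval s = y.eval s
  | .not b => ¬ b.Holds s
  | .and b c => b.Holds s ∧ c.Holds s

def Store.setNat (s : Store k) (a i v : ℕ) : Store k :=
  { s with nat := Function.update s.nat a (Function.update (s.nat a) i v) }

def Store.setFld (s : Store k) (a i : ℕ) (v : k) : Store k :=
  { s with fld := Function.update s.fld a (Function.update (s.fld a) i v) }

/-- `Runs p s t`: the program `p`, started in memory `s`, terminates with memory `t`. -/
inductive Runs [Field k] : Program → Store k → Store k → Prop
  | skip (s) : Runs .skip s s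
  | setNat (a i x s) : Runs (.setNat a i x) s (s.setNat a (i.eval s) (x.eval s))
  | setFld (a i x s) : Runs (.setFld a i x) s (s.setFld a (i.eval s) (x.eval s))
  | seq {p p' s t r} : Runs p s t → Runs p' t r → Runs (.seq p p') s r
  | cond_true {b p p' s t} : b.Holds s → Runs p s t → Runs (.cond b p p') s t
  | cond_false {b p p' s t} : ¬ b.Holds s → Runs p' s t → Runs (.cond b p p') s t
  | loop_stop {b p s} : ¬ b.Holds s → Runs (.loop b p) s s
  | loop_step {b p s t r} : b.Holds s → Runs p s t → Runs (.loop b p) t r →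
      Runs (.loop b p) s r

/-- The program `p`, started in memory `s`, terminates. -/
def Terminates [Field k] (p : Program) (s : Store k) : Prop :=
  ∃ t, Runs p s t

end Semantics

/-! ## Potentials -/

/-- A potential in `k[x_1, …, x_q]`, where the variables carry fixed degrees in `ℚ_{> 0}`: a
quasi-homogeneous polynomial whose Jacobian ring is nonzero and finite-dimensional. -/
structure Potential (k : Type u) [Field k] (q : ℕ) where
  weight : Fin q → ℚ
  weight_pos : ∀ i, 0 < weight i
  poly : MvPolynomial (Fin q) k
  quasiHomogeneous : ∃ e : ℚ, IsWeightedHomogeneous weight poly e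
  jac_nontrivial :
    Nontrivial (MvPolynomial (Fin q) k ⧸ Ideal.span (Set.range fun i => pderiv i poly))
  jac_finite :
    Module.Finite k (MvPolynomial (Fin q) k ⧸ Ideal.span (Set.range fun i => pderiv i poly))

/-! ## Residues -/

section Residue

variable {A : Type u} [CommRing A] {q : ℕ}

/-- A square matrix `M` and exponents `d_i ≥ 1` with `∑_j M_{ij} F_j = x_i ^ d_i` for all `i`. -/
structure MonomialReduction (F : Fin q → MvPolynomial (Fin q) A) where
  M : Matrix (Fin q) (Fin q) (MvPolynomial (Fin q) A)
  d : Fin q → ℕ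
  d_pos : ∀ i, 1 ≤ d i
  mulVec_eq : ∀ i, M.mulVec F i = X i ^ d i

/-- The coefficient of `x_1^{d_1 - 1} ⋯ x_q^{d_q - 1}` in `h * det M`. -/
noncomputable def MonomialReduction.value {F : Fin q → MvPolynomial (Fin q) A}
    (m : MonomialReduction F) (h : MvPolynomial (Fin q) A) : A :=
  coeff (Finsupp.equivFunOnFinite.symm fun i => m.d i - 1) (h * m.M.det)

open Classical in
/-- The multivariate residue symbol `res (h dx_1 ∧ ⋯ ∧ dx_q / F_1, …, F_q)`, relative to the
coefficient ring `A`, for `F_1, …, F_q` such that every `x_i` is nilpotent modulo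
`(F_1, …, F_q)`: by the transformation rule it is the value of an arbitrary monomial reduction,
and it does not depend on which one, see `residue_eq_value`. -/
noncomputable def residue (F : Fin q → MvPolynomial (Fin q) A) (h : MvPolynomial (Fin q) A) : A :=
  if H : Nonempty (MonomialReduction F) then H.some.value h else 0

theorem coeff_sum_mul_X_pow_eq_zero (d : Fin q → ℕ) (i : Fin q)
    (c : Fin q → MvPolynomial (Fin q) A) (hc : c i = 0) (m : Fin q →₀ ℕ)
    (hm : ∀ l, l ≠ i → m l < d l) :
    coeff m (∑ l, c l * X l ^ d l) = 0 := by
  rw [coeff_sum]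
  refine Finset.sum_eq_zero fun l _ => ?_
  by_cases hl : l = i
  · subst hl; simp [hc]
  · rw [X_pow_eq_monomial, coeff_mul_monomial']
    have : ¬ Finsupp.single l (d l) ≤ m := by
      rw [Finsupp.single_le_iff]; exact not_le.mpr (hm l hl)
    simp [this]

theorem coeff_updateRow_eq (F : Fin q → MvPolynomial (Fin q) A) (d : Fin q → ℕ)
    (hd : ∀ i, 1 ≤ d i) (N : Matrix (Fin q) (Fin q) (MvPolynomial (Fin q) A))
    (hN : ∀ i, N.mulVec F i = X i ^ d i) (i : Fin q) (v : Fin q → MvPolynomial (Fin q) A)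
    (hv : v ⬝ᵥ F = X i ^ d i) (h : MvPolynomial (Fin q) A) :
    coeff (Finsupp.equivFunOnFinite.symm fun i => d i - 1) (h * (N.updateRow i v).det) =
      coeff (Finsupp.equivFunOnFinite.symm fun i => d i - 1) (h * N.det) := by
  set P := N.updateRow i (v - N i) with hP
  have hdet : (N.updateRow i v).det = N.det + P.det := by
    have := Matrix.det_updateRow_add N i (N i) (v - N i)
    rw [add_sub_cancel, Matrix.updateRow_eq_self] at this
    exact this
  have hPF : ∀ l, P.mulVec F l = if l = i then 0 else X l ^ d l := by
    intro l
    by_cases hl : l = i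
    · subst hl
      have h1 : N l ⬝ᵥ F = X l ^ d l := hN l
      have h2 : P.mulVec F l = (v - N l) ⬝ᵥ F := by
        rw [hP]
        exact congrArg (· ⬝ᵥ F) Matrix.updateRow_self
      rw [h2, sub_dotProduct, hv, h1, sub_self, if_pos rfl]
    · have := hN l
      simp only [Matrix.mulVec] at this
      simp [hP, Matrix.mulVec, this, hl]
  have key : P.adjugate.mulVec (P.mulVec F) = P.det • F := by
    rw [Matrix.mulVec_mulVec, Matrix.adjugate_mul, Matrix.smul_mulVec, Matrix.one_mulVec]
  have hx : h * P.det * X i ^ d i =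
      ∑ l, (if l = i then 0 else ∑ j, h * v j * P.adjugate j l) * X l ^ d l := by
    rw [← hv]
    have : ∀ j, P.det * F j = ∑ l, P.adjugate j l * (if l = i then 0 else X l ^ d l) := by
      intro j
      have := congrFun key j
      simp only [Pi.smul_apply, smul_eq_mul] at this
      rw [← this]
      simp [Matrix.mulVec, dotProduct, ← hPF]
    calc h * P.det * (v ⬝ᵥ F) = ∑ j, h * v j * (P.det * F j) := by
          simp only [dotProduct, Finset.mul_sum]
          exact Finset.sum_congr rfl fun j _ => by ring
      _ = ∑ j, ∑ l, h * v j * (P.adjugate j l * (if l = i then 0 else X l ^ d l)) := by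
          simp only [this, Finset.mul_sum]
      _ = _ := by
          rw [Finset.sum_comm]
          refine Finset.sum_congr rfl fun l _ => ?_
          by_cases hl : l = i
          · simp [hl]
          · simp only [hl, if_false, Finset.sum_mul]
            exact Finset.sum_congr rfl fun j _ => by ring
  have hzero : coeff (Finsupp.equivFunOnFinite.symm fun i => d i - 1) (h * P.det) = 0 := by
    have h1 := coeff_mul_monomial (Finsupp.equivFunOnFinite.symm fun i => d i - 1)
      (Finsupp.single i (d i)) (1 : A) (h * P.det)
    rw [mul_one, ← X_pow_eq_monomial, hx] at h1
    rw [← h1]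
    refine coeff_sum_mul_X_pow_eq_zero d i _ (by simp) _ fun l hl => ?_
    have := hd l
    simp [Ne.symm hl]
    omega
  rw [hdet, mul_add, coeff_add, hzero, add_zero]

theorem MonomialReduction.value_eq_of_d_eq {F : Fin q → MvPolynomial (Fin q) A}
    (m m' : MonomialReduction F) (hd : m.d = m'.d) (h : MvPolynomial (Fin q) A) :
    m.value h = m'.value h := by
  classical
  have key : ∀ s : Finset (Fin q), ∀ N : Matrix (Fin q) (Fin q) (MvPolynomial (Fin q) A),
      (N = fun i => if i ∈ s then m'.M i else m.M i) →
      coeff (Finsupp.equivFunOnFinite.symm fun i => m.d i - 1) (h * N.det) = m.value h := by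
    intro s
    induction s using Finset.induction_on with
    | empty =>
      intro N hN
      have : N = m.M := by rw [hN]; ext i j; simp
      rw [this]; rfl
    | insert a s ha ih =>
      intro N hN
      set N' : Matrix (Fin q) (Fin q) (MvPolynomial (Fin q) A) :=
        fun i => if i ∈ s then m'.M i else m.M i with hN'
      have h1 : N = N'.updateRow a (m'.M a) := by
        rw [hN, hN']
        funext i
        by_cases hi : i = a
        · subst hi
          exact (if_pos (Finset.mem_insert_self _ _)).trans Matrix.updateRow_self.symm
        · refine Eq.trans ?_ (Matrix.updateRow_ne hi).symm
          simp [hi]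
      rw [← ih N' hN', h1]
      refine coeff_updateRow_eq F m.d m.d_pos N' (fun i => ?_) a _ ?_ h
      · by_cases hi : i ∈ s
        · have := m'.mulVec_eq i
          simp only [Matrix.mulVec] at this ⊢
          simp [hN', hi, hd, this]
        · have := m.mulVec_eq i
          simp only [Matrix.mulVec] at this ⊢
          simp [hN', hi, this]
      · rw [hd]; exact m'.mulVec_eq a
  have := key Finset.univ m'.M (by funext i; simp)
  rw [← this, MonomialReduction.value, hd]

/-- Multiplication of the rows of a monomial reduction by monomials. -/
noncomputable def MonomialReduction.shift {F : Fin q → MvPolynomial (Fin q) A}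
    (m : MonomialReduction F) (e : Fin q → ℕ) : MonomialReduction F where
  M := Matrix.diagonal (fun i => X i ^ e i) * m.M
  d := fun i => m.d i + e i
  d_pos := fun i => le_add_right (m.d_pos i)
  mulVec_eq := fun i => by
    rw [← Matrix.mulVec_mulVec, Matrix.mulVec_diagonal, m.mulVec_eq, ← pow_add, add_comm]

theorem MonomialReduction.value_shift {F : Fin q → MvPolynomial (Fin q) A}
    (m : MonomialReduction F) (e : Fin q → ℕ) (h : MvPolynomial (Fin q) A) :
    (m.shift e).value h = m.value h := by
  have hprod : (∏ i, X i ^ e i : MvPolynomial (Fin q) A) =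
      monomial (Finsupp.equivFunOnFinite.symm e) 1 := by
    rw [monomial_eq]
    simp [Finsupp.prod_fintype]
  have hexp : (Finsupp.equivFunOnFinite.symm fun i => m.d i + e i - 1) =
      (Finsupp.equivFunOnFinite.symm fun i => m.d i - 1) + Finsupp.equivFunOnFinite.symm e := by
    ext i
    have := m.d_pos i
    simp
    omega
  simp only [MonomialReduction.value, MonomialReduction.shift]
  rw [Matrix.det_mul, Matrix.det_diagonal, hprod, hexp, mul_comm (monomial _ _), ← mul_assoc,
    coeff_mul_monomial, mul_one]

theorem MonomialReduction.value_eq {F : Fin q → MvPolynomial (Fin q) A}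
    (m m' : MonomialReduction F) (h : MvPolynomial (Fin q) A) : m.value h = m'.value h := by
  rw [← m.value_shift m'.d, ← m'.value_shift m.d]
  exact value_eq_of_d_eq _ _ (funext fun i => add_comm _ _) h

/-- The residue is the value of any monomial reduction. -/
theorem residue_eq_value {F : Fin q → MvPolynomial (Fin q) A} (m : MonomialReduction F)
    (h : MvPolynomial (Fin q) A) : residue F h = m.value h := by
  rw [residue, dif_pos ⟨m⟩]
  exact MonomialReduction.value_eq _ _ h

end Residue

/-! ## Matrix factorizations and orbifold equivalence -/

section MatrixFactorization

variable {k : Type u} [Field k]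

/-- A matrix factorization of `W` over `T = k[σ]`, where the variables have degrees `w`: the
supergraded free graded module `X = ⨁_i T(n_i)` with `n_i = shift i`, where the indices in the left
summand are even and those in the right summand are odd, and an odd quasi-homogeneous map `d`, given
by its matrix, with `d² = W`. As `Hom(T(n), T(m))_ℓ = T_{m - n + ℓ}`, the map `d` is
quasi-homogeneous of degree `ℓ` if its entries `d i j` have degree `n_i - n_j + ℓ`. -/
structure MatrixFactorization {σ : Type} (w : σ → ℚ) (W : MvPolynomial σ k) where
  evenRank : ℕ
  oddRank : ℕ
  shift : Fin evenRank ⊕ Fin oddRank → ℚ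
  degree : ℚ
  d : Matrix (Fin evenRank ⊕ Fin oddRank) (Fin evenRank ⊕ Fin oddRank) (MvPolynomial σ k)
  even_even : d.toBlocks₁₁ = 0
  odd_odd : d.toBlocks₂₂ = 0
  homogeneous : ∀ i j, IsWeightedHomogeneous w (d i j) (shift i - shift j + degree)
  d_mul_d : d * d = W • 1

/-- The supertrace. -/
def supertrace {R : Type*} [CommRing R] {r s : ℕ}
    (B : Matrix (Fin r ⊕ Fin s) (Fin r ⊕ Fin s) R) : R :=
  B.toBlocks₁₁.trace - B.toBlocks₂₂.trace

variable {q n : ℕ}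

/-- Matrix factorizations of `f ⊗ 1 - 1 ⊗ g` over
`k[x_1, …, x_q] ⊗ k[y_1, …, y_n] = k[x_1, …, x_q, y_1, …, y_n]`. The variable `x_i` is indexed by
`Sum.inl i` and `y_j` by `Sum.inr j`. -/
abbrev MFDiff (f : Potential k q) (g : Potential k n) : Type u :=
  MatrixFactorization (Sum.elim f.weight g.weight)
    (rename Sum.inl f.poly - rename Sum.inr g.poly : MvPolynomial (Fin q ⊕ Fin n) k)

/-- `str (∂_{x_1} Q ⋯ ∂_{x_q} Q ∂_{y_1} Q ⋯ ∂_{y_n} Q)`. -/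
noncomputable def strDeriv {f : Potential k q} {g : Potential k n} (Q : MFDiff f g) :
    MvPolynomial (Fin q ⊕ Fin n) k :=
  supertrace ((List.ofFn fun i : Fin q => Q.d.map (pderiv (Sum.inl i))).prod *
    (List.ofFn fun j : Fin n => Q.d.map (pderiv (Sum.inr j))).prod)

/-- The quantum dimension with respect to `f`: the residue in the variables `x`, over the
coefficient ring `k[y_1, …, y_n]`. -/
noncomputable def leftQdim {f : Potential k q} {g : Potential k n} (Q : MFDiff f g) :
    MvPolynomial (Fin n) k :=
  residue (fun i => map (C : k →+* MvPolynomial (Fin n) k) (pderiv i f.poly))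
    (sumAlgEquiv k (Fin q) (Fin n) (strDeriv Q))

/-- The quantum dimension with respect to `g`: the residue in the variables `y`, over the
coefficient ring `k[x_1, …, x_q]`. -/
noncomputable def rightQdim {f : Potential k q} {g : Potential k n} (Q : MFDiff f g) :
    MvPolynomial (Fin q) k :=
  residue (fun j => map (C : k →+* MvPolynomial (Fin q) k) (pderiv j g.poly))
    (sumAlgEquiv k (Fin n) (Fin q) (rename Sum.swap (strDeriv Q)))

/-- There is a matrix factorization of `f - g` with nonzero left and right quantum dimensions. -/
def OrbifoldEquivalent (f : Potential k q) (g : Potential k n) : Prop :=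
  ∃ Q : MFDiff f g, leftQdim Q ≠ 0 ∧ rightQdim Q ≠ 0

end MatrixFactorization

/-! ## Input -/

section Input

variable {k : Type u} {q n : ℕ}

/-- The polynomial `∑ c * x^e`, summed over the pairs `(e, c)` of a list of terms. -/
noncomputable def polyOfTerms [Field k] (l : List ((Fin q → ℕ) × k)) : MvPolynomial (Fin q) k :=
  (l.map fun t => monomial (Finsupp.equivFunOnFinite.symm t.1) t.2).sum

/-- The discrete part of a polynomial in weighted variables, given by a list of terms: the number of
variables, the numerators and denominators of their degrees, the number of terms, and the exponents
of the terms. -/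
def discreteData (w : Fin q → ℚ) (l : List ((Fin q → ℕ) × k)) : List ℕ :=
  q :: (List.ofFn fun i => (w i).num.toNat) ++ (List.ofFn fun i => (w i).den) ++
    l.length :: l.flatMap fun t => List.ofFn t.1

/-- The memory that holds the polynomial given by the terms `l` in array `0` and the polynomial
given by the terms `l'` in array `1` (discrete data in the arrays of natural numbers, coefficients
in the arrays of field elements), and zeros everywhere else. -/
def inputStore [Field k] (w : Fin q → ℚ) (l : List ((Fin q → ℕ) × k))
    (w' : Fin n → ℚ) (l' : List ((Fin n → ℕ) × k)) : Store k where
  nat a i := if a = 0 then (discreteData w l).getD i 0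
    else if a = 1 then (discreteData w' l').getD i 0 else 0
  fld a i := if a = 0 then (l.map Prod.snd).getD i 0
    else if a = 1 then (l'.map Prod.snd).getD i 0 else 0

end Input

end OrbEq

/-! Orbifold equivalence is rewritten as the existence of a natural number `N` for which finitely
many equalities in `k`, computable from `N` and the input, hold. The program tries `N = 0, 1, 2, …`
and stops at the first success (`terminates_searchProgram`).

Nonvanishing of a residue is an existential condition, because the residue does not depend on the
monomial reduction. It means that there are a matrix `M` and an exponent `ε` such that the rows of
`M` combine the derivatives to the powers `x_i ^ (ε_i + 1)` and `ε` has a nonzero coefficient in the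
supertrace times `det M` (`residue_ne_zero_iff`). "Nonzero" becomes an equation with an inverse as a
further unknown. Degrees become integers after multiplication by a common denominator
(`orbifoldEquivalent_iff`). So `f` and `g` are orbifold equivalent if and only if, for some discrete
data `N` and some array `z` of coefficients in `k`, a system of identities holds for all points `x`
(`holdsAll_all_iff`, `exists_holdsAll`).

The size of the system depends on `N`, so it is written in a language of terms with bounded sums and
products that can be compiled into programs. Terms in `FT Empty` have no divisions: they are
integral polynomials in the entries of their arrays, so they commute with ring homomorphisms
(`FT.map_eval`) and have a computable degree bound (`FT.deg`). Terms in `FT Unit` use the division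
of the field.

Two quantifiers over `k` have to be removed. For "all `x`", a polynomial of degree less than `b` in
each of `v` variables vanishes if it vanishes on the grid `{0, …, b - 1}^v` (`forall_gridTerm_iff`).
For "some `z`", let `K` be the field generated by the input coefficients. The polynomials over `K`
that vanish at `z` lie in a maximal ideal, whose residue field is finite over `K` by Zariski's lemma
and is generated by one element, with minimal polynomial `m`. Hence there are univariate polynomials
`p` over `K` with `m ∣ F(p)` for every equation `F` (`exists_polynomial_solution`). Conversely, for
any `m` of positive degree, irreducible or not, such `p` give a solution at a root of `m`, and `k`
contains a root.

The elements of `K` are quotients of sums of products of input coefficients and `-1`, so they are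
enumerated by natural numbers (`exists_fieldElt_eq`). Divisibility is certified by a quotient `h`,
and `F(p) = m h` is tested at more integers than the degree of either side. All of this is part of
the number that is searched for. -/

namespace OrbEq

/-! ## Terms with bounded sums and products

Terms of two sorts, natural numbers and elements of a commutative ring, with variables for natural
numbers (de Bruijn indices) and arrays as oracles. -/

/-- Terms for natural numbers. `inp a i` reads cell `i` of array `a`; `sum b t` is
`∑ i < b, t i`, `prod b t` is `∏ i < b, t i`, and `bind a t` is `t a`, where variable `0` of `t` is
bound. -/
inductive NT : Type
  | lit (n : ℕ)
  | var (i : ℕ)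
  | inp (a : ℕ) (i : NT)
  | add (x y : NT)
  | sub (x y : NT)
  | mul (x y : NT)
  | div (x y : NT)
  | sum (b t : NT)
  | prod (b t : NT)
  | bind (a t : NT)

/-- Terms for ring elements, with divisions labelled by elements of `D`. -/
inductive FT (D : Type) : Type
  | one
  | get (a : ℕ) (i : NT)
  | add (x y : FT D)
  | sub (x y : FT D)
  | mul (x y : FT D)
  | div (d : D) (x y : FT D)
  | sum (b : NT) (t : FT D)
  | prod (b : NT) (t : FT D)
  | bind (a : NT) (t : FT D)

/-- The environment in which variable `0` has the value `i`, and the others are shifted. -/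
def cons (i : ℕ) (e : ℕ → ℕ) : ℕ → ℕ
  | 0 => i
  | n + 1 => e n

@[simp] theorem cons_zero (i : ℕ) (e : ℕ → ℕ) : cons i e 0 = i := rfl
@[simp] theorem cons_succ (i : ℕ) (e : ℕ → ℕ) (n : ℕ) : cons i e (n + 1) = e n := rfl

/-- The renaming under a binder. -/
def liftRen (r : ℕ → ℕ) : ℕ → ℕ
  | 0 => 0
  | n + 1 => r n + 1

theorem cons_comp_liftRen (i : ℕ) (e r : ℕ → ℕ) : cons i e ∘ liftRen r = cons i (e ∘ r) := by
  funext n; cases n <;> rfl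

namespace NT

@[simp] def eval (I : ℕ → ℕ → ℕ) : NT → (ℕ → ℕ) → ℕ
  | lit n, _ => n
  | var i, e => e i
  | inp a i, e => I a (i.eval I e)
  | add x y, e => x.eval I e + y.eval I e
  | sub x y, e => x.eval I e - y.eval I e
  | mul x y, e => x.eval I e * y.eval I e
  | div x y, e => x.eval I e / y.eval I e
  | sum b t, e => ∑ i ∈ Finset.range (b.eval I e), t.eval I (cons i e)
  | prod b t, e => ∏ i ∈ Finset.range (b.eval I e), t.eval I (cons i e)
  | bind a t, e => t.eval I (cons (a.eval I e) e)

def ren : (ℕ → ℕ) → NT → NT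
  | _, lit n => lit n
  | r, var i => var (r i)
  | r, inp a i => inp a (ren r i)
  | r, add x y => add (ren r x) (ren r y)
  | r, sub x y => sub (ren r x) (ren r y)
  | r, mul x y => mul (ren r x) (ren r y)
  | r, div x y => div (ren r x) (ren r y)
  | r, sum b t => sum (ren r b) (ren (liftRen r) t)
  | r, prod b t => prod (ren r b) (ren (liftRen r) t)
  | r, bind a t => bind (ren r a) (ren (liftRen r) t)

theorem eval_ren (I : ℕ → ℕ → ℕ) (t : NT) (r e : ℕ → ℕ) :
    (t.ren r).eval I e = t.eval I (e ∘ r) := by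
  induction t generalizing r e <;> simp [ren, cons_comp_liftRen, *]

/-- Weakening. -/
def up (t : NT) : NT := t.ren Nat.succ

@[simp] theorem eval_up (I : ℕ → ℕ → ℕ) (t : NT) (i : ℕ) (e : ℕ → ℕ) :
    t.up.eval I (cons i e) = t.eval I e := eval_ren ..

end NT

namespace FT

variable {D : Type} {R : Type*} [CommRing R]

@[simp] def eval (dv : D → R → R → R) (I : ℕ → ℕ → ℕ) (ρ : ℕ → ℕ → R) : FT D → (ℕ → ℕ) → R
  | one, _ => 1
  | get a i, e => ρ a (i.eval I e)
  | add x y, e => x.eval dv I ρ e + y.eval dv I ρ e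
  | sub x y, e => x.eval dv I ρ e - y.eval dv I ρ e
  | mul x y, e => x.eval dv I ρ e * y.eval dv I ρ e
  | div d x y, e => dv d (x.eval dv I ρ e) (y.eval dv I ρ e)
  | sum b t, e => ∑ i ∈ Finset.range (b.eval I e), t.eval dv I ρ (cons i e)
  | prod b t, e => ∏ i ∈ Finset.range (b.eval I e), t.eval dv I ρ (cons i e)
  | bind a t, e => t.eval dv I ρ (cons (a.eval I e) e)

def ren : (ℕ → ℕ) → FT D → FT D
  | _, one => one
  | r, get a i => get a (i.ren r)
  | r, add x y => add (ren r x) (ren r y)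
  | r, sub x y => sub (ren r x) (ren r y)
  | r, mul x y => mul (ren r x) (ren r y)
  | r, div d x y => div d (ren r x) (ren r y)
  | r, sum b t => sum (b.ren r) (ren (liftRen r) t)
  | r, prod b t => prod (b.ren r) (ren (liftRen r) t)
  | r, bind a t => bind (a.ren r) (ren (liftRen r) t)

theorem eval_ren (dv : D → R → R → R) (I : ℕ → ℕ → ℕ) (ρ : ℕ → ℕ → R) (t : FT D)
    (r e : ℕ → ℕ) : (t.ren r).eval dv I ρ e = t.eval dv I ρ (e ∘ r) := by
  induction t generalizing r e <;> simp [ren, cons_comp_liftRen, NT.eval_ren, *]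

/-- Weakening. -/
def up (t : FT D) : FT D := t.ren Nat.succ

@[simp] theorem eval_up (dv : D → R → R → R) (I : ℕ → ℕ → ℕ) (ρ : ℕ → ℕ → R) (t : FT D)
    (i : ℕ) (e : ℕ → ℕ) : t.up.eval dv I ρ (cons i e) = t.eval dv I ρ e := eval_ren ..

/-- The image of a natural number in the ring. -/
def cast (n : NT) : FT D := sum n one

@[simp] theorem eval_cast (dv : D → R → R → R) (I : ℕ → ℕ → ℕ) (ρ : ℕ → ℕ → R) (n : NT)
    (e : ℕ → ℕ) : (cast n : FT D).eval dv I ρ e = (n.eval I e : R) := by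
  simp [cast]

end FT

/-! ## Compilation into programs

The value of variable `i` at binding depth `D` is in cell `D - 1 - i` of array `2` of natural
numbers. Array `3` of natural numbers and array `2` of field elements are stacks for intermediate
results. -/

section Compile

/-- Cell `i` of the stack of natural numbers. -/
def stk (i : ℕ) : NatExpr := .get 3 (.lit i)

/-- Cell `i` of the environment. -/
def reg (i : ℕ) : NatExpr := .get 2 (.lit i)

/-- Cell `i` of the stack of field elements. -/
def fstk (i : ℕ) : FldExpr := .get 2 (.lit i)

def setStk (i : ℕ) (x : NatExpr) : Program := .setNat 3 (.lit i) x

def setReg (i : ℕ) (x : NatExpr) : Program := .setNat 2 (.lit i) x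

def setFstk (i : ℕ) (x : FldExpr) : Program := .setFld 2 (.lit i) x

/-- Run `p` while cell `D` of the environment runs from `0` up to the value in cell `m` of the
stack. -/
def forLoop (D m : ℕ) (p : Program) : Program :=
  .seq (setReg D (.lit 0))
    (.loop (.not (.natLe (stk m) (reg D))) (.seq p (setReg D (.add (reg D) (.lit 1)))))

/-- The program that computes `t` at binding depth `D` into cell `m` of the stack. -/
def NT.compile : NT → ℕ → ℕ → Program
  | .lit n, _, m => setStk m (.lit n)
  -- A variable that is not bound at depth `D` reads as `0`, in accordance with `Holds.env_zero`.
  | .var i, D, m => setStk m (if i < D then reg (D - 1 - i) else .lit 0)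
  | .inp a i, D, m => .seq (i.compile D m)
      -- Arrays from `2` on are working memory; as inputs they count as zero.
      (setStk m (if a < 2 then .get a (stk m) else .lit 0))
  | .add x y, D, m => .seq (x.compile D m) (.seq (y.compile D (m + 1))
      (setStk m (.add (stk m) (stk (m + 1)))))
  | .sub x y, D, m => .seq (x.compile D m) (.seq (y.compile D (m + 1))
      (setStk m (.sub (stk m) (stk (m + 1)))))
  | .mul x y, D, m => .seq (x.compile D m) (.seq (y.compile D (m + 1))
      (setStk m (.mul (stk m) (stk (m + 1)))))
  | .div x y, D, m => .seq (x.compile D m) (.seq (y.compile D (m + 1))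
      (setStk m (.div (stk m) (stk (m + 1)))))
  -- Cell `m` keeps the bound and cell `m + 1` the accumulator, hence the body works from `m + 2`
  -- on. For field elements the bound and the accumulator are on different stacks, and `m + 1`
  -- suffices.
  | .sum b t, D, m => .seq (b.compile D m) (.seq (setStk (m + 1) (.lit 0)) (.seq
      (forLoop D m (.seq (t.compile (D + 1) (m + 2))
        (setStk (m + 1) (.add (stk (m + 1)) (stk (m + 2))))))
      (setStk m (stk (m + 1)))))
  | .prod b t, D, m => .seq (b.compile D m) (.seq (setStk (m + 1) (.lit 1)) (.seq
      (forLoop D m (.seq (t.compile (D + 1) (m + 2))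
        (setStk (m + 1) (.mul (stk (m + 1)) (stk (m + 2))))))
      (setStk m (stk (m + 1)))))
  | .bind a t, D, m => .seq (a.compile D m) (.seq (setReg D (stk m)) (t.compile (D + 1) m))

/-- The program that computes `t` at binding depth `D` into cell `m` of the stack. -/
def FT.compile : FT Unit → ℕ → ℕ → Program
  | .one, _, m => setFstk m .one
  | .get a i, D, m => .seq (i.compile D m)
      (setFstk m (if a < 2 then .get a (stk m) else .zero))
  | .add x y, D, m => .seq (x.compile D m) (.seq (y.compile D (m + 1))
      (setFstk m (.add (fstk m) (fstk (m + 1)))))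
  | .sub x y, D, m => .seq (x.compile D m) (.seq (y.compile D (m + 1))
      (setFstk m (.sub (fstk m) (fstk (m + 1)))))
  | .mul x y, D, m => .seq (x.compile D m) (.seq (y.compile D (m + 1))
      (setFstk m (.mul (fstk m) (fstk (m + 1)))))
  | .div _ x y, D, m => .seq (x.compile D m) (.seq (y.compile D (m + 1))
      (setFstk m (.div (fstk m) (fstk (m + 1)))))
  | .sum b t, D, m => .seq (b.compile D m) (.seq (setFstk m .zero)
      (forLoop D m (.seq (t.compile (D + 1) (m + 1))
        (setFstk m (.add (fstk m) (fstk (m + 1)))))))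
  | .prod b t, D, m => .seq (b.compile D m) (.seq (setFstk m .one)
      (forLoop D m (.seq (t.compile (D + 1) (m + 1))
        (setFstk m (.mul (fstk m) (fstk (m + 1)))))))
  | .bind a t, D, m => .seq (a.compile D m) (.seq (setReg D (stk m)) (t.compile (D + 1) m))

variable {k : Type u}

/-- The memory `s` holds the inputs `I` and `ρ` and the environment `e` at binding depth `D`. -/
structure Holds [Zero k] (D : ℕ) (I : ℕ → ℕ → ℕ) (ρ : ℕ → ℕ → k) (e : ℕ → ℕ)
    (s : Store k) : Prop where
  nat : ∀ a < 2, s.nat a = I a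
  nat_zero : ∀ a, 2 ≤ a → I a = 0
  fld : ∀ a < 2, s.fld a = ρ a
  fld_zero : ∀ a, 2 ≤ a → ρ a = 0
  env : ∀ i < D, s.nat 2 (D - 1 - i) = e i
  env_zero : ∀ i, D ≤ i → e i = 0

/-- Nothing changes below `D` in the environment and below `m` on the stacks. -/
structure Frame (D m : ℕ) (s t : Store k) : Prop where
  nat : ∀ a < 2, t.nat a = s.nat a
  fld : ∀ a < 2, t.fld a = s.fld a
  env : ∀ i < D, t.nat 2 i = s.nat 2 i
  stack : ∀ i < m, t.nat 3 i = s.nat 3 i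
  fstack : ∀ i < m, t.fld 2 i = s.fld 2 i

theorem Frame.trans {D m : ℕ} {s t r : Store k} (h : Frame D m s t) (h' : Frame D m t r) :
    Frame D m s r where
  nat a ha := (h'.nat a ha).trans (h.nat a ha)
  fld a ha := (h'.fld a ha).trans (h.fld a ha)
  env a ha := (h'.env a ha).trans (h.env a ha)
  stack a ha := (h'.stack a ha).trans (h.stack a ha)
  fstack a ha := (h'.fstack a ha).trans (h.fstack a ha)

theorem Frame.mono {D m D' m' : ℕ} {s t : Store k} (h : Frame D m s t) (hD : D' ≤ D)
    (hm : m' ≤ m) : Frame D' m' s t where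
  nat := h.nat
  fld := h.fld
  env a ha := h.env a (ha.trans_le hD)
  stack a ha := h.stack a (ha.trans_le hm)
  fstack a ha := h.fstack a (ha.trans_le hm)

theorem Holds.of_frame [Zero k] {D m : ℕ} {I : ℕ → ℕ → ℕ} {ρ : ℕ → ℕ → k}
    {e : ℕ → ℕ} {s t : Store k}
    (h : Holds D I ρ e s) (hf : Frame D m s t) : Holds D I ρ e t where
  nat a ha := (hf.nat a ha).trans (h.nat a ha)
  nat_zero := h.nat_zero
  fld a ha := (hf.fld a ha).trans (h.fld a ha)
  fld_zero := h.fld_zero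
  env i hi := (hf.env _ (by omega)).trans (h.env i hi)
  env_zero := h.env_zero

/-- Variables are stored by level: since variable `i` at depth `D` is in cell `D - 1 - i`, a new
binder only fills cell `D`, and the older variables keep their cells. -/
theorem Holds.cons [Zero k] {D : ℕ} {I : ℕ → ℕ → ℕ} {ρ : ℕ → ℕ → k} {e : ℕ → ℕ} {s : Store k}
    (h : Holds D I ρ e s) {i : ℕ} (hi : s.nat 2 D = i) : Holds (D + 1) I ρ (cons i e) s where
  nat := h.nat
  nat_zero := h.nat_zero
  fld := h.fld
  fld_zero := h.fld_zero
  env j hj := by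
    cases j with
    | zero => simpa using hi
    | succ j => simpa [Nat.sub_sub, add_comm] using h.env j (by omega)
  env_zero j hj := by
    cases j with
    | zero => omega
    | succ j => exact h.env_zero j (by omega)

@[simp] theorem Store.nat_setNat (s : Store k) (a i v b j : ℕ) :
    (s.setNat a i v).nat b j = if b = a ∧ j = i then v else s.nat b j := by
  by_cases h : b = a
  · subst h; by_cases h' : j = i <;> simp [Store.setNat, h']
  · simp [Store.setNat, h]

@[simp] theorem Store.fld_setNat (s : Store k) (a i v : ℕ) : (s.setNat a i v).fld = s.fld := rfl

@[simp] theorem Store.nat_setFld (s : Store k) (a i : ℕ) (v : k) : (s.setFld a i v).nat = s.nat :=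
  rfl

@[simp] theorem Store.fld_setFld (s : Store k) (a i : ℕ) (v : k) (b j : ℕ) :
    (s.setFld a i v).fld b j = if b = a ∧ j = i then v else s.fld b j := by
  by_cases h : b = a
  · subst h; by_cases h' : j = i <;> simp [Store.setFld, h']
  · simp [Store.setFld, h]

theorem Frame.setStack {D m : ℕ} (s : Store k) {i : ℕ} (hi : m ≤ i) (v : ℕ) :
    Frame D m s (s.setNat 3 i v) := by
  constructor <;> intros <;> (try funext) <;> simp <;> omega

theorem Frame.setEnv {D m : ℕ} (s : Store k) {i : ℕ} (hi : D ≤ i) (v : ℕ) :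
    Frame D m s (s.setNat 2 i v) := by
  constructor <;> intros <;> (try funext) <;> simp <;> omega

theorem Frame.setFStack {D m : ℕ} (s : Store k) {i : ℕ} (hi : m ≤ i) (v : k) :
    Frame D m s (s.setFld 2 i v) := by
  constructor <;> intros <;> (try funext) <;> simp <;> omega

@[simp] theorem eval_stk (s : Store k) (i : ℕ) : (stk i).eval s = s.nat 3 i := rfl
@[simp] theorem eval_reg (s : Store k) (i : ℕ) : (reg i).eval s = s.nat 2 i := rfl
@[simp] theorem eval_fstk [Field k] (s : Store k) (i : ℕ) : (fstk i).eval s = s.fld 2 i := rfl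

section

variable [Field k]

theorem runs_loop_of_not_holds {b : BoolExpr} {p : Program} {s : Store k} (h : ¬ b.Holds s) :
    Runs (.loop b p) s s := by
  constructor
  exact h

theorem runs_setStk (s : Store k) (i : ℕ) (x : NatExpr) :
    Runs (setStk i x) s (s.setNat 3 i (x.eval s)) := Runs.setNat ..

theorem runs_setReg (s : Store k) (i : ℕ) (x : NatExpr) :
    Runs (setReg i x) s (s.setNat 2 i (x.eval s)) := Runs.setNat ..

theorem runs_setFstk (s : Store k) (i : ℕ) (x : FldExpr) :
    Runs (setFstk i x) s (s.setFld 2 i (x.eval s)) := Runs.setFld ..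

/-- A `for` loop with the invariant `P`. The body may change the environment from depth `D + 1` on,
and the stacks from cell `m'` on, and the bound is in a cell below `m'`, or kept by the
invariant. -/
theorem runs_forLoop {D m b : ℕ} {p : Program} (P : ℕ → Store k → Prop)
    (hm : ∀ i s, P i s → s.nat 3 m = b) (hD : ∀ i v s, P i s → P i (s.setNat 2 D v))
    (hp : ∀ i s, i < b → s.nat 2 D = i → P i s →
      ∃ t, Runs p s t ∧ t.nat 2 D = i ∧ P (i + 1) t)
    {s : Store k} (hs : P 0 s) : ∃ t, Runs (forLoop D m p) s t ∧ P b t := by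
  have key : ∀ n i s, i + n = b → s.nat 2 D = i → P i s →
      ∃ t, Runs (.loop (.not (.natLe (stk m) (reg D)))
        (.seq p (setReg D (.add (reg D) (.lit 1))))) s t ∧ P b t := by
    intro n
    induction n with
    | zero =>
      intro i s hi hDi hP
      refine ⟨s, runs_loop_of_not_holds ?_, by simpa [← hi] using hP⟩
      simp [BoolExpr.Holds, hm i s hP, hDi]; omega
    | succ n ih =>
      intro i s hi hDi hP
      obtain ⟨t, h1, h2, h3⟩ := hp i s (by omega) hDi hP
      obtain ⟨r, h4, h5⟩ := ih (i + 1) (t.setNat 2 D (i + 1)) (by omega) (by simp)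
        (hD _ _ _ h3)
      refine ⟨r, .loop_step ?_ (.seq h1 ?_) h4, h5⟩
      · simp [BoolExpr.Holds, hm i s hP, hDi]; omega
      · have := runs_setReg t D (.add (reg D) (.lit 1))
        simpa [NatExpr.eval, h2] using this
  obtain ⟨t, h1, h2⟩ := key b 0 (s.setNat 2 D 0) (by omega) (by simp) (hD _ _ _ hs)
  exact ⟨t, .seq (runs_setReg s D (.lit 0)) h1, h2⟩

/-- The program `p` computes the natural number `v` into cell `m` of the stack. -/
def ComputesNat (D m : ℕ) (p : Program) (s : Store k) (v : ℕ) : Prop :=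
  ∃ t, Runs p s t ∧ t.nat 3 m = v ∧ Frame D m s t

/-- The program `p` computes the field element `v` into cell `m` of the stack. -/
def ComputesFld (D m : ℕ) (p : Program) (s : Store k) (v : k) : Prop :=
  ∃ t, Runs p s t ∧ t.fld 2 m = v ∧ Frame D m s t

/-- The first result survives in cell `m` because the second program works from cell `m + 1` on. -/
theorem ComputesNat.binop {D m : ℕ} {p p' : Program} {s : Store k} {v v' w : ℕ}
    (h : ComputesNat D m p s v)
    (h' : ∀ t, Frame D m s t → ComputesNat D (m + 1) p' t v') (x : NatExpr)
    (hx : ∀ t : Store k, t.nat 3 m = v → t.nat 3 (m + 1) = v' → x.eval t = w) :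
    ComputesNat D m (.seq p (.seq p' (setStk m x))) s w := by
  obtain ⟨t, h1, h2, h3⟩ := h
  obtain ⟨t', h1', h2', h3'⟩ := h' t h3
  refine ⟨_, .seq h1 (.seq h1' (runs_setStk t' m x)), ?_, (h3.trans
    (h3'.mono le_rfl m.le_succ)).trans (Frame.setStack _ le_rfl _)⟩
  simpa using hx t' ((h3'.stack m (by omega)).trans h2) h2'

theorem ComputesFld.binop {D m : ℕ} {p p' : Program} {s : Store k} {v v' w : k}
    (h : ComputesFld D m p s v)
    (h' : ∀ t, Frame D m s t → ComputesFld D (m + 1) p' t v') (x : FldExpr)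
    (hx : ∀ t : Store k, t.fld 2 m = v → t.fld 2 (m + 1) = v' → x.eval t = w) :
    ComputesFld D m (.seq p (.seq p' (setFstk m x))) s w := by
  obtain ⟨t, h1, h2, h3⟩ := h
  obtain ⟨t', h1', h2', h3'⟩ := h' t h3
  refine ⟨_, .seq h1 (.seq h1' (runs_setFstk t' m x)), ?_, (h3.trans
    (h3'.mono le_rfl m.le_succ)).trans (Frame.setFStack _ le_rfl _)⟩
  simpa using hx t' ((h3'.fstack m (by omega)).trans h2) h2'

/-- Accumulation over a bounded range of natural numbers. -/
theorem ComputesNat.accumulate {D m b : ℕ} {p q : Program} {s : Store k} (A : ℕ → ℕ)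
    (v : ℕ → ℕ) (hb : ComputesNat D m q s b)
    (hp : ∀ i t, Frame D m s t → t.nat 2 D = i → ComputesNat (D + 1) (m + 2) p t (v i))
    (x : NatExpr) (hx : ∀ i (t : Store k), t.nat 3 (m + 1) = A i → t.nat 3 (m + 2) = v i →
      x.eval t = A (i + 1)) :
    ComputesNat D m (.seq q (.seq (setStk (m + 1) (.lit (A 0))) (.seq
      (forLoop D m (.seq p (setStk (m + 1) x))) (setStk m (stk (m + 1)))))) s (A b) := by
  obtain ⟨t, h1, h2, h3⟩ := hb
  obtain ⟨r, h4, h5, h6, h7⟩ := runs_forLoop (D := D) (m := m) (b := b)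
    (p := .seq p (setStk (m + 1) x))
    (fun i r => r.nat 3 m = b ∧ r.nat 3 (m + 1) = A i ∧ Frame D m s r)
    (fun i r h => h.1) (fun i v r h => ⟨by simpa using h.1, by simpa using h.2.1,
      h.2.2.trans (Frame.setEnv _ le_rfl _)⟩)
    (by
      rintro i r hi hD ⟨h4, h5, h6⟩
      obtain ⟨r', h7, h8, h9⟩ := hp i r h6 hD
      refine ⟨_, .seq h7 (runs_setStk r' (m + 1) x), ?_, ?_, ?_, ?_⟩
      · simpa using (h9.env D (by omega)).trans hD
      · simpa using (h9.stack m (by omega)).trans h4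
      · simpa using hx i r' ((h9.stack (m + 1) (by omega)).trans h5) h8
      · exact (h6.trans (h9.mono (by omega) (by omega))).trans (Frame.setStack _ (by omega) _))
    (s := t.setNat 3 (m + 1) (A 0))
    ⟨by simpa using h2, by simp, h3.trans (Frame.setStack _ (by omega) _)⟩
  exact ⟨_, .seq h1 (.seq (runs_setStk t (m + 1) (.lit (A 0))) (.seq h4 (runs_setStk r m _))),
    by simpa using h6, h7.trans (Frame.setStack _ le_rfl _)⟩

/-- Accumulation over a bounded range of field elements. -/
theorem ComputesFld.accumulate {D m b : ℕ} {p q : Program} {s : Store k} (A : ℕ → k)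
    (v : ℕ → k) (hb : ComputesNat D m q s b)
    (hp : ∀ i t, Frame D m s t → t.nat 2 D = i → ComputesFld (D + 1) (m + 1) p t (v i))
    (x y : FldExpr) (hy : ∀ t : Store k, y.eval t = A 0)
    (hx : ∀ i (t : Store k), t.fld 2 m = A i → t.fld 2 (m + 1) = v i → x.eval t = A (i + 1)) :
    ComputesFld D m (.seq q (.seq (setFstk m y)
      (forLoop D m (.seq p (setFstk m x))))) s (A b) := by
  obtain ⟨t, h1, h2, h3⟩ := hb
  obtain ⟨r, h4, h5, h6, h7⟩ := runs_forLoop (D := D) (m := m) (b := b)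
    (p := .seq p (setFstk m x))
    (fun i r => r.nat 3 m = b ∧ r.fld 2 m = A i ∧ Frame D m s r)
    (fun i r h => h.1) (fun i v r h => ⟨by simpa using h.1, by simpa using h.2.1,
      h.2.2.trans (Frame.setEnv _ le_rfl _)⟩)
    (by
      rintro i r hi hD ⟨h4, h5, h6⟩
      obtain ⟨r', h7, h8, h9⟩ := hp i r h6 hD
      refine ⟨_, .seq h7 (runs_setFstk r' m x), ?_, ?_, ?_, ?_⟩
      · simpa using (h9.env D (by omega)).trans hD
      · simpa using (h9.stack m (by omega)).trans h4
      · simpa using hx i r' ((h9.fstack m (by omega)).trans h5) h8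
      · exact (h6.trans (h9.mono (by omega) (by omega))).trans (Frame.setFStack _ (by omega) _))
    (s := t.setFld 2 m (A 0))
    ⟨by simpa using h2, by simp, h3.trans (Frame.setFStack _ (by omega) _)⟩
  have h0 := runs_setFstk t m y
  rw [hy] at h0
  exact ⟨_, .seq h1 (.seq h0 h4), h6, h7⟩

/-- Induction on the term. The frame condition in `ComputesNat` carries it: a subprogram touches
neither the inputs nor the outer variables nor the pending intermediate results. -/
theorem NT.computes_compile (t : NT) {D : ℕ} (m : ℕ) {I : ℕ → ℕ → ℕ} {ρ : ℕ → ℕ → k}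
    {e : ℕ → ℕ} {s : Store k} (h : Holds D I ρ e s) :
    ComputesNat D m (t.compile D m) s (t.eval I e) := by
  induction t generalizing D m e s with
  | lit n => exact ⟨_, runs_setStk s m _, by simp [NatExpr.eval], Frame.setStack _ le_rfl _⟩
  | var i =>
    refine ⟨_, runs_setStk s m _, ?_, Frame.setStack _ le_rfl _⟩
    by_cases hi : i < D
    · simp [hi, h.env i hi]
    · simp [hi, h.env_zero i (by omega), NatExpr.eval]
  | inp a i ih =>
    obtain ⟨t, h1, h2, h3⟩ := ih m h
    refine ⟨_, .seq h1 (runs_setStk t m _), ?_, h3.trans (Frame.setStack _ le_rfl _)⟩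
    by_cases ha : a < 2
    · simp [ha, NatExpr.eval, h2, (h.of_frame h3).nat a ha]
    · simp [ha, NatExpr.eval, h.nat_zero a (by omega)]
  | add x y ihx ihy =>
    exact (ihx m h).binop (fun t ht => ihy _ (h.of_frame ht)) _
      fun t h1 h2 => by simp [NatExpr.eval, h1, h2]
  | sub x y ihx ihy =>
    exact (ihx m h).binop (fun t ht => ihy _ (h.of_frame ht)) _
      fun t h1 h2 => by simp [NatExpr.eval, h1, h2]
  | mul x y ihx ihy =>
    exact (ihx m h).binop (fun t ht => ihy _ (h.of_frame ht)) _
      fun t h1 h2 => by simp [NatExpr.eval, h1, h2]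
  | div x y ihx ihy =>
    exact (ihx m h).binop (fun t ht => ihy _ (h.of_frame ht)) _
      fun t h1 h2 => by simp [NatExpr.eval, h1, h2]
  | sum b t ihb iht =>
    exact ComputesNat.accumulate (fun n => ∑ i ∈ Finset.range n, t.eval I (cons i e))
      (fun i => t.eval I (cons i e)) (ihb m h)
      (fun i r hr hi => iht _ ((h.of_frame hr).cons hi)) _
      (fun i r h1 h2 => by simp [NatExpr.eval, h1, h2, Finset.sum_range_succ])
  | prod b t ihb iht =>
    exact ComputesNat.accumulate (fun n => ∏ i ∈ Finset.range n, t.eval I (cons i e))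
      (fun i => t.eval I (cons i e)) (ihb m h)
      (fun i r hr hi => iht _ ((h.of_frame hr).cons hi)) _
      (fun i r h1 h2 => by simp [NatExpr.eval, h1, h2, Finset.prod_range_succ])
  | bind a t iha iht =>
    obtain ⟨r, h1, h2, h3⟩ := iha m h
    have hf := h3.trans (Frame.setEnv r (le_refl D) (r.nat 3 m))
    obtain ⟨r', h4, h5, h6⟩ := iht m ((h.of_frame hf).cons (i := a.eval I e) (by simp [h2]))
    exact ⟨r', .seq h1 (.seq (runs_setReg r D (stk m)) h4), h5,
      hf.trans (h6.mono (by omega) le_rfl)⟩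

theorem FT.computes_compile (t : FT Unit) {D : ℕ} (m : ℕ) {I : ℕ → ℕ → ℕ} {ρ : ℕ → ℕ → k}
    {e : ℕ → ℕ} {s : Store k} (h : Holds D I ρ e s) :
    ComputesFld D m (t.compile D m) s (t.eval (fun _ x y => x / y) I ρ e) := by
  induction t generalizing D m e s with
  | one => exact ⟨_, runs_setFstk s m _, by simp [FldExpr.eval], Frame.setFStack _ le_rfl _⟩
  | get a i =>
    obtain ⟨t, h1, h2, h3⟩ := i.computes_compile m h
    refine ⟨_, .seq h1 (runs_setFstk t m _), ?_, h3.trans (Frame.setFStack _ le_rfl _)⟩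
    by_cases ha : a < 2
    · simp [ha, FldExpr.eval, h2, (h.of_frame h3).fld a ha]
    · simp [ha, FldExpr.eval, h.fld_zero a (by omega)]
  | add x y ihx ihy =>
    exact (ihx m h).binop (fun t ht => ihy _ (h.of_frame ht)) _
      fun t h1 h2 => by simp [FldExpr.eval, h1, h2]
  | sub x y ihx ihy =>
    exact (ihx m h).binop (fun t ht => ihy _ (h.of_frame ht)) _
      fun t h1 h2 => by simp [FldExpr.eval, h1, h2]
  | mul x y ihx ihy =>
    exact (ihx m h).binop (fun t ht => ihy _ (h.of_frame ht)) _
      fun t h1 h2 => by simp [FldExpr.eval, h1, h2]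
  | div d x y ihx ihy =>
    exact (ihx m h).binop (fun t ht => ihy _ (h.of_frame ht)) _
      fun t h1 h2 => by simp [FldExpr.eval, h1, h2]
  | sum b t iht =>
    exact ComputesFld.accumulate
      (fun n => ∑ i ∈ Finset.range n, t.eval (fun _ x y => x / y) I ρ (OrbEq.cons i e))
      (fun i => t.eval (fun _ x y => x / y) I ρ (OrbEq.cons i e)) (b.computes_compile m h)
      (fun i r hr hi => iht _ ((h.of_frame hr).cons hi)) _ _ (fun _ => by simp [FldExpr.eval])
      (fun i r h1 h2 => by simp [FldExpr.eval, h1, h2, Finset.sum_range_succ])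
  | prod b t iht =>
    exact ComputesFld.accumulate
      (fun n => ∏ i ∈ Finset.range n, t.eval (fun _ x y => x / y) I ρ (OrbEq.cons i e))
      (fun i => t.eval (fun _ x y => x / y) I ρ (OrbEq.cons i e)) (b.computes_compile m h)
      (fun i r hr hi => iht _ ((h.of_frame hr).cons hi)) _ _ (fun _ => by simp [FldExpr.eval])
      (fun i r h1 h2 => by simp [FldExpr.eval, h1, h2, Finset.prod_range_succ])
  | bind a t iht =>
    obtain ⟨r, h1, h2, h3⟩ := a.computes_compile m h
    have hf := h3.trans (Frame.setEnv r (le_refl D) (r.nat 3 m))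
    obtain ⟨r', h4, h5, h6⟩ := iht m ((h.of_frame hf).cons (i := a.eval I e) (by simp [h2]))
    exact ⟨r', .seq h1 (.seq (runs_setReg r D (stk m)) h4), h5,
      hf.trans (h6.mono (by omega) le_rfl)⟩

end

end Compile

/-! ### Unbounded search for a parameter at which finitely many values vanish -/

section Search

variable {k : Type u} [Field k]

/-- Identifies an arbitrary terminating run of the search with the runs constructed explicitly. -/
theorem Runs.det {p : Program} {s t t' : Store k} (h : Runs p s t) (h' : Runs p s t') :
    t = t' := by
  induction h generalizing t' with
  | skip | setNat | setFld => cases h'; rfl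
  | seq _ _ ih1 ih2 =>
    cases h' with
    | seq h1 h2 => cases ih1 h1; exact ih2 h2
  | cond_true hb _ ih =>
    cases h' with
    | cond_true _ h => exact ih h
    | cond_false hb' => exact absurd hb hb'
  | cond_false hb _ ih =>
    cases h' with
    | cond_true hb' => exact absurd hb' hb
    | cond_false _ h => exact ih h
  | loop_stop hb =>
    cases h' with
    | loop_stop => rfl
    | loop_step hb' => exact absurd hb' hb
  | loop_step hb _ _ ih1 ih2 =>
    cases h' with
    | loop_stop hb' => exact absurd hb hb'
    | loop_step _ h1 h2 => cases ih1 h1; exact ih2 h2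

theorem Runs.loop_inv {b : BoolExpr} {p : Program} {s t : Store k} (h : Runs (.loop b p) s t)
    (P : Store k → Prop) (hP : ∀ s s', P s → b.Holds s → Runs p s s' → P s') (hs : P s) :
    P t ∧ ¬ b.Holds t := by
  generalize hq : Program.loop b p = q at h
  induction h with
  | loop_stop hb => cases hq; exact ⟨hs, hb⟩
  | loop_step hb h1 _ _ ih => cases hq; exact ih (hP _ _ hs hb h1) rfl
  | _ => cases hq

/-- Test whether all values of `t` below the bound `B` vanish, for the parameter in cell `0` of the
environment; set the flag in cell `0` of the stack accordingly and increment the parameter. -/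
def searchBody (B : NT) (t : FT Unit) : Program :=
  .seq (setStk 0 (.lit 0)) (.seq (B.compile 1 1) (.seq
    (forLoop 1 1 (.seq (t.compile 2 2) (.cond (.fldEq (fstk 2) .zero) .skip (setStk 0 (.lit 1)))))
    (setReg 0 (.add (reg 0) (.lit 1)))))

/-- Search for a parameter for which all values of `t` below the bound `B` vanish. -/
def searchProgram (B : NT) (t : FT Unit) : Program :=
  .seq (setReg 0 (.lit 0)) (.seq (setStk 0 (.lit 1))
    (.loop (.not (.natLe (stk 0) (.lit 0))) (searchBody B t)))

/-- The frame at depth `0` leaves cell `0` of the environment unprotected: this is the parameter,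
which the search increments. -/
theorem holds_one_of_frame {I : ℕ → ℕ → ℕ} {ρ : ℕ → ℕ → k} {N N' : ℕ} {s t : Store k}
    (h : Holds 1 I ρ (cons N 0) s) (hf : Frame 0 0 s t) (hN : t.nat 2 0 = N') :
    Holds 1 I ρ (cons N' 0) t := by
  have h0 : Holds 0 I ρ (0 : ℕ → ℕ) s :=
    ⟨h.nat, h.nat_zero, h.fld, h.fld_zero, by simp, by simp⟩
  exact (h0.of_frame hf).cons hN

theorem runs_searchBody (B : NT) (t : FT Unit) {I : ℕ → ℕ → ℕ} {ρ : ℕ → ℕ → k} {N : ℕ}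
    {s : Store k} (h : Holds 1 I ρ (cons N 0) s) :
    ∃ s', Runs (searchBody B t) s s' ∧ Holds 1 I ρ (cons (N + 1) 0) s' ∧
      (s'.nat 3 0 = 0 ↔ ∀ r < B.eval I (cons N 0),
        t.eval (fun _ x y => x / y) I ρ (cons r (cons N 0)) = 0) := by
  have hf0 : Frame 1 0 s (s.setNat 3 0 0) := Frame.setStack _ le_rfl _
  obtain ⟨s1, h1, h2, h3⟩ := B.computes_compile 1 (h.of_frame hf0)
  obtain ⟨s2, h4, h5, h6, h7⟩ := runs_forLoop (D := 1) (m := 1) (b := B.eval I (cons N 0))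
    (p := .seq (t.compile 2 2) (.cond (.fldEq (fstk 2) .zero) .skip (setStk 0 (.lit 1))))
    (fun i r => r.nat 3 1 = B.eval I (cons N 0) ∧ (r.nat 3 0 = 0 ↔ ∀ j < i,
        t.eval (fun _ x y => x / y) I ρ (cons j (cons N 0)) = 0) ∧ Frame 1 0 s r)
    (fun i r h => h.1) (fun i v r h => ⟨by simpa using h.1, by simpa using h.2.1,
      h.2.2.trans (Frame.setEnv _ le_rfl _)⟩)
    (by
      rintro i r hi hD ⟨h4, h5, h6⟩
      obtain ⟨r', h7, h8, h9⟩ := t.computes_compile 2 ((h.of_frame h6).cons hD)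
      have h10 : r'.nat 2 1 = i := (h9.env 1 (by omega)).trans hD
      have h11 : r'.nat 3 1 = B.eval I (cons N 0) := (h9.stack 1 (by omega)).trans h4
      have h12 : Frame 1 0 s r' := h6.trans (h9.mono (by omega) (by omega))
      have h13 : r'.nat 3 0 = r.nat 3 0 := h9.stack 0 (by omega)
      by_cases hz : t.eval (fun _ x y => x / y) I ρ (cons i (cons N 0)) = 0
      · refine ⟨r', .seq h7 (.cond_true ?_ (.skip _)), h10, h11, ?_, h12⟩
        · simp [BoolExpr.Holds, h8, hz, FldExpr.eval]
        · rw [h13, h5]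
          refine ⟨fun H j hj => ?_, fun H j hj => H j (by omega)⟩
          rcases Nat.lt_succ_iff_lt_or_eq.1 hj with hj | rfl
          exacts [H j hj, hz]
      · refine ⟨_, .seq h7 (.cond_false ?_ (runs_setStk _ _ _)), by simpa using h10,
          by simpa using h11, ?_, h12.trans (Frame.setStack _ (by omega) _)⟩
        · simp [BoolExpr.Holds, h8, hz, FldExpr.eval]
        · simp only [Store.nat_setNat, and_self, if_true, NatExpr.eval, one_ne_zero, false_iff]
          exact fun H => hz (H i (by omega)))
    (s := s1) ⟨h2, by simpa using h3.stack 0 (by omega),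
      hf0.trans (h3.mono le_rfl (by omega))⟩
  have h8 : s2.nat 2 0 = N := (h7.env 0 (by omega)).trans (h.env 0 (by omega))
  refine ⟨_, .seq (runs_setStk s 0 _) (.seq h1 (.seq h4 (runs_setReg s2 0 _))), ?_, ?_⟩
  · exact holds_one_of_frame h ((h7.mono (by omega) le_rfl).trans (Frame.setEnv _ le_rfl _))
      ((Store.nat_setNat ..).trans (by simp [NatExpr.eval, h8]))
  · simpa using h6

/-- If the loop stops, its invariant supplies the parameter that set the flag to `0`. If a good
parameter exists, induction on the distance to it shows that the loop stops there at the latest. -/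
theorem terminates_searchProgram (B : NT) (t : FT Unit) (s : Store k)
    (hn : ∀ a, 2 ≤ a → s.nat a = 0) (hf : ∀ a, 2 ≤ a → s.fld a = 0) :
    Terminates (searchProgram B t) s ↔ ∃ N, ∀ r < B.eval s.nat (cons N 0),
      t.eval (fun _ x y => x / y) s.nat s.fld (cons r (cons N 0)) = 0 := by
  set s0 := (s.setNat 2 0 0).setNat 3 0 1 with hs0
  have hs : Holds 1 s.nat s.fld (cons 0 0) s0 := by
    have h0 : Holds 0 s.nat s.fld (0 : ℕ → ℕ) s :=
      ⟨fun _ _ => rfl, hn, fun _ _ => rfl, hf, by simp, by simp⟩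
    refine (h0.of_frame (m := 0) ((Frame.setEnv s le_rfl 0).trans
      (Frame.setStack _ le_rfl 1))).cons (by simp)
  have h1 : s0.nat 3 0 = 1 := by simp [hs0]
  constructor
  · rintro ⟨t', h⟩
    rcases h with _ | _ | _ | ⟨ha, _ | _ | _ | ⟨hb, hc⟩⟩
    cases ha.det (runs_setReg s 0 (.lit 0))
    cases hb.det (runs_setStk _ 0 (.lit 1))
    obtain ⟨⟨N, h2, h3⟩, h4⟩ := hc.loop_inv (fun r => ∃ N, Holds 1 s.nat s.fld (cons N 0) r ∧
        (r.nat 3 0 = 0 → ∃ N, ∀ r < B.eval s.nat (cons N 0),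
          t.eval (fun _ x y => x / y) s.nat s.fld (cons r (cons N 0)) = 0))
      (by
        rintro r r' ⟨N, h2, -⟩ - h4
        obtain ⟨r'', h5, h6, h7⟩ := runs_searchBody B t h2
        cases h4.det h5
        exact ⟨_, h6, fun h => ⟨N, h7.1 h⟩⟩)
      -- The flag is initially `1`, so the second half of the invariant is vacuous at the start.
      ⟨0, hs, fun h => absurd (h1.symm.trans h) one_ne_zero⟩
    exact h3 (by simpa [BoolExpr.Holds, NatExpr.eval] using h4)
  · rintro ⟨N, hN⟩
    suffices key : ∀ n M r, M + n = N → Holds 1 s.nat s.fld (cons M 0) r → r.nat 3 0 ≠ 0 →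
        ∃ r', Runs (.loop (.not (.natLe (stk 0) (.lit 0))) (searchBody B t)) r r' by
      obtain ⟨r', h⟩ := key N 0 s0 (by omega) hs (by rw [h1]; exact one_ne_zero)
      exact ⟨r', .seq (runs_setReg s 0 (.lit 0)) (.seq (runs_setStk _ 0 (.lit 1)) h)⟩
    intro n
    induction n with
    | zero =>
      rintro M r rfl h2 h3
      obtain ⟨r', h4, h5, h6⟩ := runs_searchBody B t h2
      refine ⟨r', .loop_step ?_ h4 (runs_loop_of_not_holds ?_)⟩
      · simpa [BoolExpr.Holds, NatExpr.eval] using h3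
      · simpa [BoolExpr.Holds, NatExpr.eval] using h6.2 hN
    | succ n ih =>
      rintro M r hM h2 h3
      obtain ⟨r', h4, h5, h6⟩ := runs_searchBody B t h2
      have hb : (BoolExpr.not (.natLe (stk 0) (.lit 0))).Holds r := by
        simpa [BoolExpr.Holds, NatExpr.eval] using h3
      by_cases hz : r'.nat 3 0 = 0
      · exact ⟨r', .loop_step hb h4 (runs_loop_of_not_holds
          (by simpa [BoolExpr.Holds, NatExpr.eval] using hz))⟩
      · obtain ⟨r'', h⟩ := ih (M + 1) r' (by omega) h5 hz
        exact ⟨r'', .loop_step hb h4 h⟩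

end Search

/-! ## Derived terms -/

namespace NT

variable (I : ℕ → ℕ → ℕ) (e : ℕ → ℕ) (c x y : NT)

/-- The indicator of `x ≤ y`. -/
def indLe : NT := sub (lit 1) (sub x y)

@[simp] theorem eval_indLe : (indLe x y).eval I e = if x.eval I e ≤ y.eval I e then 1 else 0 := by
  simp only [indLe, eval]
  split_ifs <;> omega

/-- The indicator of `x < y`. -/
def indLt : NT := indLe (add x (lit 1)) y

@[simp] theorem eval_indLt : (indLt x y).eval I e = if x.eval I e < y.eval I e then 1 else 0 := by
  simp only [indLt, eval_indLe, eval]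
  rfl

/-- The indicator of `x = y`. -/
def indEq : NT := mul (indLe x y) (indLe y x)

@[simp] theorem eval_indEq : (indEq x y).eval I e = if x.eval I e = y.eval I e then 1 else 0 := by
  simp only [indEq, eval, eval_indLe]
  split_ifs <;> omega

/-- `x` if `c` is `0`, and `y` otherwise. -/
def ite0 : NT := add (mul (indEq c (lit 0)) x) (mul (indLt (lit 0) c) y)

@[simp] theorem eval_ite0 :
    (ite0 c x y).eval I e = if c.eval I e = 0 then x.eval I e else y.eval I e := by
  by_cases h : c.eval I e = 0 <;> simp [ite0, h, Nat.pos_iff_ne_zero]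

def mod : NT := sub x (mul y (div x y))

@[simp] theorem eval_mod : (mod x y).eval I e = x.eval I e % y.eval I e := by
  simp [mod, Nat.mod_eq_sub]

def pow : NT := prod y x.up

@[simp] theorem eval_pow : (pow x y).eval I e = x.eval I e ^ y.eval I e := by
  simp [pow]

end NT

/-- Digit `i` of `n` in base `b`. -/
def digit (b n i : ℕ) : ℕ := n / b ^ i % b

namespace NT

variable (I : ℕ → ℕ → ℕ) (e : ℕ → ℕ) (x y z : NT)

/-- Digit `z` of `y` in base `x`. -/
def digit : NT := mod (div y (pow x z)) x

@[simp] theorem eval_digit :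
    (digit x y z).eval I e = OrbEq.digit (x.eval I e) (y.eval I e) (z.eval I e) := by
  simp [digit, OrbEq.digit]

def sqrt : NT := sum x (indLe (mul (add (var 0) (lit 1)) (add (var 0) (lit 1))) x.up)

theorem _root_.OrbEq.sum_range_ite_lt (n m : ℕ) (h : m ≤ n) :
    (∑ i ∈ Finset.range n, if i < m then 1 else 0) = m := by
  rw [← Finset.sum_filter, Finset.sum_const, smul_eq_mul, mul_one]
  have : (Finset.range n).filter (· < m) = Finset.range m := by ext; simp; omega
  rw [this, Finset.card_range]

@[simp] theorem eval_sqrt : (sqrt x).eval I e = Nat.sqrt (x.eval I e) := by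
  simp only [sqrt, eval, eval_indLe, eval_up, cons_zero]
  rw [← sum_range_ite_lt _ _ (Nat.sqrt_le_self (x.eval I e))]
  refine Finset.sum_congr rfl fun i _ => ?_
  simp only [← Nat.le_sqrt, Nat.succ_le_iff]

def unpairFst : NT :=
  ite0 (indLt (sub x (mul (sqrt x) (sqrt x))) (sqrt x)) (sqrt x) (sub x (mul (sqrt x) (sqrt x)))

@[simp] theorem eval_unpairFst : (unpairFst x).eval I e = (x.eval I e).unpair.1 := by
  simp only [unpairFst, eval_ite0, eval_indLt, eval, eval_sqrt, Nat.unpair]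
  split_ifs <;> simp_all

def unpairSnd : NT :=
  ite0 (indLt (sub x (mul (sqrt x) (sqrt x))) (sqrt x))
    (sub (sub x (mul (sqrt x) (sqrt x))) (sqrt x)) (sqrt x)

@[simp] theorem eval_unpairSnd : (unpairSnd x).eval I e = (x.eval I e).unpair.2 := by
  simp only [unpairSnd, eval_ite0, eval_indLt, eval, eval_sqrt, Nat.unpair]
  split_ifs <;> simp_all

def pair : NT := ite0 (indLt x y) (add (add (mul x x) x) y) (add (mul y y) x)

@[simp] theorem eval_pair : (pair x y).eval I e = Nat.pair (x.eval I e) (y.eval I e) := by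
  simp only [pair, eval_ite0, eval_indLt, eval, Nat.pair]
  split_ifs <;> simp_all

/-- Entry `y` of the sequence with code `x`. -/
def beta : NT := mod (unpairFst x) (add (mul (add y (lit 1)) (unpairSnd x)) (lit 1))

@[simp] theorem eval_beta : (beta x y).eval I e = Nat.beta (x.eval I e) (y.eval I e) := by
  simp [beta, Nat.beta]

end NT

/-! ### Gödel's beta function: coding finite families of arrays by one number -/

theorem exists_beta_eq (f : ℕ → ℕ) (n : ℕ) : ∃ N, ∀ i < n, Nat.beta N i = f i := by
  refine ⟨Nat.unbeta ((List.range n).map f), fun i hi => ?_⟩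
  simpa using Nat.beta_unbeta_coe ((List.range n).map f) ⟨i, by simpa using hi⟩

/-- Entry `i` of array `a` of the family of arrays with code `N`. -/
def arr (N a i : ℕ) : ℕ := Nat.beta (Nat.beta N a) i

theorem exists_arr_eq (f : ℕ → ℕ → ℕ) (m n : ℕ) : ∃ N, ∀ a < m, ∀ i < n, arr N a i = f a i := by
  choose g hg using fun a => exists_beta_eq (f a) n
  obtain ⟨N, hN⟩ := exists_beta_eq g m
  exact ⟨N, fun a ha i hi => by rw [arr, hN a ha, hg a i hi]⟩

/-- Entry `y` of array `a` of the family of arrays with code `x`. -/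
def NT.arr (x : NT) (a : ℕ) (y : NT) : NT := beta (beta x (lit a)) y

@[simp] theorem NT.eval_arr (I : ℕ → ℕ → ℕ) (e : ℕ → ℕ) (x y : NT) (a : ℕ) :
    (arr x a y).eval I e = OrbEq.arr (x.eval I e) a (y.eval I e) := by
  simp [NT.arr, OrbEq.arr]

namespace FT

variable {D : Type} {R : Type*} [CommRing R] (dv : D → R → R → R) (I : ℕ → ℕ → ℕ)
  (ρ : ℕ → ℕ → R) (e : ℕ → ℕ)

def pow (x : FT D) (n : NT) : FT D := prod n x.up

@[simp] theorem eval_pow (x : FT D) (n : NT) :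
    (pow x n).eval dv I ρ e = x.eval dv I ρ e ^ n.eval I e := by
  simp [pow]

/-! ### Naturality, substitution of arrays, degrees -/

/-- Without divisions a term is an integral polynomial in the entries of its arrays. Inserting
indeterminates and then evaluating therefore gives the value of the term at a point, which is how
terms are turned into polynomials below. -/
theorem map_eval {S : Type*} [CommRing S] (φ : R →+* S) (t : FT Empty)
    (dv : Empty → R → R → R) (dv' : Empty → S → S → S) :
    φ (t.eval dv I ρ e) = t.eval dv' I (fun a i => φ (ρ a i)) e := by
  induction t generalizing e with
  | div d => exact d.elim
  | _ => simp [*]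

/-- The substitution of terms (in which variable `0` is the index) for the arrays. -/
def subst : (ℕ → FT D) → FT Empty → FT D
  | _, one => one
  | σ, get a i => bind i (σ a)
  | σ, add x y => add (subst σ x) (subst σ y)
  | σ, sub x y => sub (subst σ x) (subst σ y)
  | σ, mul x y => mul (subst σ x) (subst σ y)
  -- Variable `0` of `σ a` is the index of the array, so only the variables from `1` on are shifted.
  | σ, sum b t => sum b (subst (fun a => (σ a).ren (liftRen Nat.succ)) t)
  | σ, prod b t => prod b (subst (fun a => (σ a).ren (liftRen Nat.succ)) t)
  | σ, bind b t => bind b (subst (fun a => (σ a).ren (liftRen Nat.succ)) t)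

theorem eval_subst (dv' : Empty → R → R → R) (t : FT Empty) (σ : ℕ → FT D) :
    (t.subst σ).eval dv I ρ e =
      t.eval dv' I (fun a i => (σ a).eval dv I ρ (OrbEq.cons i e)) e := by
  have h : ∀ (i j : ℕ) (e : ℕ → ℕ),
      OrbEq.cons i (OrbEq.cons j e) ∘ liftRen Nat.succ = OrbEq.cons i e := by
    intro i j e; rw [cons_comp_liftRen]; rfl
  induction t generalizing e σ with
  | div d => exact d.elim
  | _ => simp [subst, eval_ren, *]

/-- A bound for the degree of `t` in the entries of the arrays in `S`. -/
def deg (S : ℕ → Bool) : FT Empty → NT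
  | one => .lit 0
  | get a _ => .lit (if S a then 1 else 0)
  | add x y => .add (deg S x) (deg S y)
  | sub x y => .add (deg S x) (deg S y)
  | mul x y => .add (deg S x) (deg S y)
  | sum b t => .sum b (deg S t)
  | prod b t => .sum b (deg S t)
  | bind b t => .bind b (deg S t)

/-- `P n x` says that `x` has degree at most `n`. -/
structure IsDegree (P : ℕ → R → Prop) : Prop where
  zero : P 0 0
  one : P 0 1
  mono : ∀ {m n x}, m ≤ n → P m x → P n x
  add : ∀ {n x y}, P n x → P n y → P n (x + y)
  sub : ∀ {n x y}, P n x → P n y → P n (x - y)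
  mul : ∀ {m n x y}, P m x → P n y → P (m + n) (x * y)

-- Sums and products both add up the bounds of their terms. For sums this is wasteful, but it keeps
-- the bound a term that a program can compute.
variable {ρ} in
theorem IsDegree.eval_deg {P : ℕ → R → Prop} (hP : IsDegree P) (S : ℕ → Bool)
    (hρ : ∀ a i, P (if S a then 1 else 0) (ρ a i)) (t : FT Empty) (dv : Empty → R → R → R) :
    P ((t.deg S).eval I e) (t.eval dv I ρ e) := by
  induction t generalizing e with
  | one => exact hP.one
  | get a i => exact hρ a _
  | add x y hx hy =>
    exact hP.add (hP.mono (Nat.le_add_right _ _) (hx e)) (hP.mono (Nat.le_add_left _ _) (hy e))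
  | sub x y hx hy =>
    exact hP.sub (hP.mono (Nat.le_add_right _ _) (hx e)) (hP.mono (Nat.le_add_left _ _) (hy e))
  | mul x y hx hy => exact hP.mul (hx e) (hy e)
  | div d => exact d.elim
  | sum b t ih =>
    simp only [deg, NT.eval, eval]
    induction b.eval I e with
    | zero => simpa using hP.zero
    | succ n ihn =>
      rw [Finset.sum_range_succ, Finset.sum_range_succ]
      exact hP.add (hP.mono (Nat.le_add_right _ _) ihn)
        (hP.mono (Nat.le_add_left _ _) (ih _))
  | prod b t ih =>
    simp only [deg, NT.eval, eval]
    induction b.eval I e with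
    | zero => simpa using hP.one
    | succ n ihn =>
      rw [Finset.sum_range_succ, Finset.prod_range_succ]
      exact hP.mul ihn (ih _)
  | bind b t ih => exact ih _

/-- The value of a term depends on finitely many entries of the arrays. -/
theorem exists_eval_eq (t : FT Empty) :
    ∃ S, ∀ ρ ρ' : ℕ → ℕ → R, (∀ a < S, ∀ i < S, ρ a i = ρ' a i) →
      ∀ dv dv' : Empty → R → R → R, t.eval dv I ρ e = t.eval dv' I ρ' e := by
  have hsup : ∀ (n : ℕ) (f : ℕ → ℕ), ∃ S, ∀ i < n, f i ≤ S := fun n f =>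
    ⟨∑ i ∈ Finset.range n, f i, fun i hi =>
      Finset.single_le_sum (f := f) (fun _ _ => Nat.zero_le _) (Finset.mem_range.2 hi)⟩
  induction t generalizing e with
  | one => exact ⟨0, fun _ _ _ _ _ => rfl⟩
  | get a i => exact ⟨a + i.eval I e + 1, fun ρ ρ' h _ _ => h _ (by omega) _ (by omega)⟩
  | div d => exact d.elim
  | add x y hx hy | sub x y hx hy | mul x y hx hy =>
    obtain ⟨S, hS⟩ := hx e
    obtain ⟨S', hS'⟩ := hy e
    refine ⟨S + S', fun ρ ρ' h dv dv' => ?_⟩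
    simp only [eval]
    rw [hS ρ ρ' (fun a ha i hi => h a (by omega) i (by omega)) dv dv',
      hS' ρ ρ' (fun a ha i hi => h a (by omega) i (by omega)) dv dv']
  | sum b t ih | prod b t ih =>
    choose S hS using fun i => ih (OrbEq.cons i e)
    obtain ⟨S', hS'⟩ := hsup (b.eval I e) S
    refine ⟨S', fun ρ ρ' h dv dv' => ?_⟩
    simp only [eval]
    first
    | refine Finset.sum_congr rfl fun i hi => ?_
    | refine Finset.prod_congr rfl fun i hi => ?_
    have := hS' i (Finset.mem_range.1 hi)
    exact hS i ρ ρ' (fun a ha j hj => h a (by omega) j (by omega)) dv dv'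
  | bind b t ih => exact ih _

end FT

/-! ## Digits -/

theorem exists_digit_eq {b v : ℕ} (f : ℕ → ℕ) (hf : ∀ i < v, f i < b) :
    ∃ c < b ^ v, ∀ i < v, digit b c i = f i := by
  let g : Fin v → Fin b := fun i => ⟨f i, hf i i.2⟩
  refine ⟨finFunctionFinEquiv g, (finFunctionFinEquiv g).2, fun i hi => ?_⟩
  have := finFunctionFinEquiv_symm_apply_val (finFunctionFinEquiv g) ⟨i, hi⟩
  rw [Equiv.symm_apply_apply] at this
  exact this.symm

theorem digit_eq_zero {b v c i : ℕ} (hb : 0 < b) (hc : c < b ^ v) (hi : v ≤ i) :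
    digit b c i = 0 := by
  rw [digit, Nat.div_eq_of_lt (hc.trans_le (Nat.pow_le_pow_right hb hi)), Nat.zero_mod]

/-! ## Enumeration of the elements of a finitely generated field -/

/-- The arrays `a` with `a < 2` from `c`, the array `2` from `x`, and the others from `z`. -/
def oracle {R : Type*} (c : ℕ → ℕ → R) (x : ℕ → R) (z : ℕ → ℕ → R) (a : ℕ) : ℕ → R :=
  if a < 2 then c a else if a = 2 then x else z a

section Enumeration

variable {k : Type*} [Field k]

/-- The elements `-1`, `c 0 i` and `c 1 i`, numbered. -/
def atom (c : ℕ → ℕ → k) (n : ℕ) : k :=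
  if n = 0 then -1 else if n % 2 = 0 then c 0 (n / 2 - 1) else c 1 (n / 2)

/-- Entry `0` of the code `n` is the number of summands and entry `u + 1` codes summand `u`, again
with its length in entry `0`. As `-1` is an atom, these sums of products exhaust the subring
generated by the inputs. -/
def ringElt (c : ℕ → ℕ → k) (n : ℕ) : k :=
  ∑ u ∈ Finset.range (Nat.beta n 0), ∏ w ∈ Finset.range (Nat.beta (Nat.beta n (u + 1)) 0),
    atom c (Nat.beta (Nat.beta n (u + 1)) (w + 1))

/-- Entry `i` of the sequence of field elements with code `n`. -/
def fieldElt (c : ℕ → ℕ → k) (n i : ℕ) : k :=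
  ringElt c (arr n 0 i) / ringElt c (arr n 1 i)

/-- The subfield generated by the entries of the two arrays of inputs. -/
def inputField (c : ℕ → ℕ → k) : Subfield k :=
  Subfield.closure {y | ∃ a < 2, ∃ i, c a i = y}

theorem exists_list_beta {α : Type*} (P : ℕ → α → Prop) (l : List α)
    (hl : ∀ x ∈ l, ∃ n, P n x) : ∃ N, Nat.beta N 0 = l.length ∧
      ∀ i : Fin l.length, P (Nat.beta N (i + 1)) l[i] := by
  classical
  choose! h hh using hl
  obtain ⟨N, hN⟩ := exists_beta_eq
    (cons l.length fun i => if hi : i < l.length then h l[i] else 0) (l.length + 1)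
  refine ⟨N, hN 0 (by omega), fun i => ?_⟩
  rw [hN (i + 1) (by omega), cons_succ, dif_pos i.2]
  exact hh _ (List.getElem_mem i.2)

theorem exists_ringElt_eq (c : ℕ → ℕ → k) {y : k}
    (hy : y ∈ Subring.closure {y | ∃ a < 2, ∃ i, c a i = y}) : ∃ n, ringElt c n = y := by
  obtain ⟨L, hL, rfl⟩ := Subring.exists_list_of_mem_closure hy
  have hprod : ∀ l ∈ L, ∃ n, ∏ w ∈ Finset.range (Nat.beta n 0), atom c (Nat.beta n (w + 1)) =
      l.prod := by
    intro l hl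
    have hatom : ∀ y ∈ l, ∃ n, atom c n = y := by
      intro y hy
      rcases hL l hl y hy with ⟨a, ha, i, rfl⟩ | rfl
      · obtain rfl | rfl : a = 0 ∨ a = 1 := by omega
        · exact ⟨2 * (i + 1), by simp [atom]⟩
        · refine ⟨2 * i + 1, ?_⟩
          have h1 : (2 * i + 1) % 2 = 1 := by omega
          have h2 : (2 * i + 1) / 2 = i := by omega
          simp [atom, h1, h2]
      · exact ⟨0, by simp [atom]⟩
    obtain ⟨N, hN, hN'⟩ := exists_list_beta (fun n y => atom c n = y) l hatom
    refine ⟨N, ?_⟩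
    rw [hN, Finset.prod_range, ← Fin.prod_univ_getElem]
    exact Finset.prod_congr rfl fun i _ => hN' i
  obtain ⟨N, hN, hN'⟩ := exists_list_beta
    (fun n (l : List k) => ∏ w ∈ Finset.range (Nat.beta n 0), atom c (Nat.beta n (w + 1)) = l.prod)
    L hprod
  refine ⟨N, ?_⟩
  rw [ringElt, hN, Finset.sum_range, ← Fin.sum_univ_fun_getElem]
  exact Finset.sum_congr rfl fun i _ => hN' i

theorem exists_fieldElt_eq (c : ℕ → ℕ → k) (y : ℕ → k) (hy : ∀ i, y i ∈ inputField c) (n : ℕ) :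
    ∃ N, ∀ i < n, fieldElt c N i = y i := by
  have h : ∀ i, ∃ a b, ringElt c a / ringElt c b = y i := by
    intro i
    obtain ⟨y1, h1, y2, h2, h3⟩ := Subfield.mem_closure_iff.1 (hy i)
    obtain ⟨a, rfl⟩ := exists_ringElt_eq c h1
    obtain ⟨b, rfl⟩ := exists_ringElt_eq c h2
    exact ⟨a, b, h3⟩
  choose a b hab using h
  obtain ⟨N, hN⟩ := exists_arr_eq (fun j => if j = 0 then a else b) 2 n
  refine ⟨N, fun i hi => ?_⟩
  rw [fieldElt, hN 0 (by omega) i hi, hN 1 (by omega) i hi]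
  simpa using hab i

end Enumeration

namespace FT

variable {k : Type*} [Field k] (I : ℕ → ℕ → ℕ) (ρ : ℕ → ℕ → k) (e : ℕ → ℕ)

/-- The value of terms over a field. -/
abbrev evalDiv (t : FT Unit) : k := t.eval (fun _ x y => x / y) I ρ e

def atom (n : NT) : FT Unit :=
  sub (add (mul (cast (.mul (.indLt (.lit 0) n) (.indEq (.mod n (.lit 2)) (.lit 0))))
        (get 0 (.sub (.div n (.lit 2)) (.lit 1))))
      (mul (cast (.indEq (.mod n (.lit 2)) (.lit 1))) (get 1 (.div n (.lit 2)))))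
    (cast (.indEq n (.lit 0)))

theorem eval_atom (n : NT) : (atom n).evalDiv I ρ e = OrbEq.atom ρ (n.eval I e) := by
  rcases Nat.eq_zero_or_pos (n.eval I e) with h | h
  · simp [atom, OrbEq.atom, h]
  · rcases Nat.mod_two_eq_zero_or_one (n.eval I e) with h' | h' <;>
      simp [atom, OrbEq.atom, h', h.ne', h]

def ringElt (n : NT) : FT Unit :=
  sum (.beta n (.lit 0)) (prod (.beta (.beta n.up (.add (.var 0) (.lit 1))) (.lit 0))
    (atom (.beta (.beta n.up.up (.add (.var 1) (.lit 1))) (.add (.var 0) (.lit 1)))))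

theorem eval_ringElt (n : NT) : (ringElt n).evalDiv I ρ e = OrbEq.ringElt ρ (n.eval I e) := by
  simp only [ringElt, evalDiv, eval]
  simp [eval_atom, OrbEq.ringElt, OrbEq.cons]

def fieldElt (n i : NT) : FT Unit :=
  div () (ringElt (.arr n 0 i)) (ringElt (.arr n 1 i))

theorem eval_fieldElt (n i : NT) :
    (fieldElt n i).evalDiv I ρ e = OrbEq.fieldElt ρ (n.eval I e) (i.eval I e) := by
  simp only [fieldElt, evalDiv, eval]
  simp [eval_ringElt, OrbEq.fieldElt]

end FT

/-! ## Descent of solutions -/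

/-- The polynomials over `K` vanishing at `z` form a proper ideal. The quotient by a maximal ideal
above it is finite over `K` by Zariski's lemma, hence generated by one element `α` in characteristic
zero. Here `m` is the minimal polynomial of `α`, and `p i` expresses the class of `X i` in `α`. The
entries of `z` themselves may be transcendental over `K`. -/
theorem exists_polynomial_solution {K k ι : Type*} [Field K] [CharZero K] [Field k] [Algebra K k]
    [Finite ι] (z : ι → k) : ∃ (m : Polynomial K) (p : ι → Polynomial K), m.Monic ∧
      0 < m.natDegree ∧ ∀ F : MvPolynomial ι K, aeval z F = 0 → m ∣ aeval p F := by
  have hne : RingHom.ker (aeval z : MvPolynomial ι K →ₐ[K] k) ≠ ⊤ := RingHom.ker_ne_top _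
  obtain ⟨M, hM, hle⟩ := Ideal.exists_le_maximal _ hne
  let _ : Field (MvPolynomial ι K ⧸ M) := Ideal.Quotient.field M
  have : Algebra.FiniteType K (MvPolynomial ι K ⧸ M) :=
    Algebra.FiniteType.of_surjective (Ideal.Quotient.mkₐ K M) (Ideal.Quotient.mkₐ_surjective K M)
  have : Module.Finite K (MvPolynomial ι K ⧸ M) := finite_of_finite_type_of_isJacobsonRing K _
  obtain ⟨α, hα⟩ := Field.exists_primitive_element K (MvPolynomial ι K ⧸ M)
  have hint : IsIntegral K α := Algebra.IsIntegral.isIntegral α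
  have hsurj : ∀ y : MvPolynomial ι K ⧸ M, ∃ p : Polynomial K, Polynomial.aeval α p = y := by
    intro y
    have h1 := IntermediateField.adjoin_simple_toSubalgebra_of_isAlgebraic hint.isAlgebraic
    rw [hα, Algebra.adjoin_singleton_eq_range_aeval] at h1
    have : y ∈ (⊤ : IntermediateField K (MvPolynomial ι K ⧸ M)).toSubalgebra := by simp
    rw [h1] at this
    exact this
  choose p hp using fun i => hsurj (Ideal.Quotient.mkₐ K M (X i))
  refine ⟨minpoly K α, p, minpoly.monic hint, minpoly.natDegree_pos hint, fun F hF => ?_⟩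
  refine minpoly.dvd K α ?_
  have h1 : Polynomial.aeval α (aeval p F) = Ideal.Quotient.mkₐ K M F := by
    have : ((Polynomial.aeval α).comp (aeval p) : MvPolynomial ι K →ₐ[K] _) =
        Ideal.Quotient.mkₐ K M := by
      refine MvPolynomial.algHom_ext fun i => ?_
      simpa using hp i
    exact DFunLike.congr_fun this F
  rw [h1]
  exact Ideal.Quotient.eq_zero_iff_mem.2 (hle hF)

/-! ## Elimination of a polynomial variable: evaluation on a grid -/

theorem oracle_map {R S : Type*} (φ : R → S) (c : ℕ → ℕ → R) (x : ℕ → R) (z : ℕ → ℕ → R) :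
    (fun a i => φ (oracle c x z a i)) =
      oracle (fun a i => φ (c a i)) (fun i => φ (x i)) (fun a i => φ (z a i)) := by
  funext a i
  simp only [oracle]
  split_ifs <;> rfl

/-- A number larger than the degrees in array `2` of the values of `t` below the bound `B`. -/
def gridBase (B : NT) (t : FT Empty) : NT := .add (.sum B (t.deg (· == 2))) (.lit 1)

def gridSize (B v : NT) (t : FT Empty) : NT := .pow (gridBase B t) v

/-- The value of `t` at a point of the grid. The index is `r * gridSize + g`, where `r` is the index
of the value and `g` the number of the point. -/
def gridTerm (B v : NT) (t : FT Empty) : FT Empty :=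
  .bind (.div (.var 0) (gridSize B v t).up) (.bind (.mod (.var 1) (gridSize B v t).up.up)
    -- Variables `0`, `1`, `2` are now the grid point, the index `r` and the combined index; the
    -- surrounding context starts at `3`.
    ((t.ren fun n => if n = 0 then 1 else n + 2).subst fun a =>
      if a = 2 then .cast (.digit (gridBase B t).up.up.up.up (.var 1) (.var 0))
      else .get a (.var 0)))

theorem eval_gridTerm {R : Type*} [CommRing R] (dv : Empty → R → R → R) (B v : NT) (t : FT Empty)
    (I : ℕ → ℕ → ℕ) (c : ℕ → ℕ → R) (x : ℕ → R) (z : ℕ → ℕ → R) (e : ℕ → ℕ) (r : ℕ) :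
    (gridTerm B v t).eval dv I (oracle c x z) (cons r e) =
      t.eval dv I (oracle c (fun i => (digit ((gridBase B t).eval I e)
        (r % (gridSize B v t).eval I e) i : R)) z) (cons (r / (gridSize B v t).eval I e) e) := by
  simp only [gridTerm, FT.eval]
  rw [FT.eval_subst (dv' := dv), FT.eval_ren]
  congr 1
  · funext a i
    by_cases h : a = 2
    · subst h
      simp [oracle]
    · simp [oracle, h]
  · funext n
    rcases n with _ | n <;> simp

theorem isDegree_degreeOf {R σ : Type*} [CommRing R] (s : σ) :
    FT.IsDegree (fun n (P : MvPolynomial σ R) => P.degreeOf s ≤ n) where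
  zero := by simp
  one := by simp
  mono h h' := h'.trans h
  add h h' := (degreeOf_add_le ..).trans (max_le h h')
  sub h h' := (degreeOf_sub_le ..).trans (max_le h h')
  mul h h' := (degreeOf_mul_le ..).trans (add_le_add h h')

/-- The points of the grid are the vectors of base-`b` digits of the numbers below `b ^ v`. In
characteristic zero the integers `0, …, b - 1` are distinct in `k`, and `b` exceeds the degree in
each variable, so vanishing on the grid forces vanishing everywhere. -/
theorem forall_gridTerm_iff {k : Type*} [Field k] [CharZero k] (dv : Empty → k → k → k) (B v : NT)
    (t : FT Empty) (I : ℕ → ℕ → ℕ) (c z : ℕ → ℕ → k) (x₀ : ℕ → k) (e : ℕ → ℕ) :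
    (∀ r < (NT.mul B (gridSize B v t)).eval I e,
      (gridTerm B v t).eval dv I (oracle c x₀ z) (cons r e) = 0) ↔
    ∀ r < B.eval I e, ∀ x : ℕ → k, (∀ i, v.eval I e ≤ i → x i = 0) →
      t.eval dv I (oracle c x z) (cons r e) = 0 := by
  set b := (gridBase B t).eval I e with hb
  have hb0 : 0 < b := by simp [hb, gridBase]
  have hG : (gridSize B v t).eval I e = b ^ v.eval I e := by simp [gridSize, hb]
  have hG0 : 0 < b ^ v.eval I e := Nat.pow_pos hb0
  simp only [eval_gridTerm, NT.eval, hG, ← hb]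
  constructor
  · intro H r hr x hx
    -- Indeterminates in array `2`, followed by zeros, turn the value of `t` into a polynomial `P`
    -- in `v` variables.
    let ξ : ℕ → MvPolynomial (Fin (v.eval I e)) k := fun i =>
      if h : i < v.eval I e then X ⟨i, h⟩ else 0
    let P := t.eval (fun d => d.elim) I (oracle (fun a i => C (c a i)) ξ (fun a i => C (z a i)))
      (cons r e)
    have hP : ∀ y : ℕ → k, (∀ i, v.eval I e ≤ i → y i = 0) →
        eval (fun i : Fin _ => y i) P = t.eval dv I (oracle c y z) (cons r e) := by
      intro y hy
      rw [FT.map_eval _ _ _ _ _ _ dv, oracle_map]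
      congr 2
      · simp
      · funext i
        by_cases h : i < v.eval I e
        · simp [ξ, h]
        · simp [ξ, h, hy i (by omega)]
      · simp
    suffices hP0 : P = 0 by rw [← hP x hx, hP0, map_zero]
    refine eq_zero_of_eval_zero_at_prod_finset P
      (fun _ => (Finset.range b).map ⟨Nat.cast, Nat.cast_injective⟩) (fun s => ?_) fun y hy => ?_
    · rw [Finset.card_map, Finset.card_range, hb]
      simp only [gridBase, NT.eval, Nat.lt_add_one_iff]
      refine ((isDegree_degreeOf s).eval_deg I _ (· == 2) (fun a i => ?_) t _).trans
        (Finset.single_le_sum (f := fun r => (t.deg (· == 2)).eval I (cons r e))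
          (fun _ _ => Nat.zero_le _) (Finset.mem_range.2 hr))
      simp only [oracle, beq_iff_eq]
      split_ifs
      · omega
      · simp
      · simp only [ξ]
        split_ifs
        · classical
          rw [degreeOf_X]
          split_ifs <;> simp
        · simp
      · simp
    · simp only [Finset.mem_map, Finset.mem_range, Function.Embedding.coeFn_mk] at hy
      choose d hd hd' using hy
      obtain ⟨g, hg, hg'⟩ := exists_digit_eq (b := b) (v := v.eval I e)
        (fun i => if h : i < v.eval I e then d ⟨i, h⟩ else 0)
        (fun i hi => by simpa [hi] using hd ⟨i, hi⟩)
      have h1 := H (r * b ^ v.eval I e + g) (by nlinarith)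
      have h2 : (r * b ^ v.eval I e + g) / b ^ v.eval I e = r := by
        rw [add_comm, Nat.add_mul_div_right _ _ hG0, Nat.div_eq_of_lt hg, zero_add]
      have h3 : (r * b ^ v.eval I e + g) % b ^ v.eval I e = g := by
        rw [Nat.mul_add_mod', Nat.mod_eq_of_lt hg]
      rw [h2, h3, ← hP _ (fun i hi => by rw [digit_eq_zero hb0 hg hi, Nat.cast_zero])] at h1
      rw [← h1]
      congr 2
      funext i
      rw [hg' i i.2, dif_pos i.2, hd']
  · intro H r hr
    refine H _ (Nat.div_lt_of_lt_mul (by rwa [mul_comm])) _ fun i hi => ?_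
    rw [digit_eq_zero hb0 (Nat.mod_lt _ hG0) hi, Nat.cast_zero]

/-! ## Elimination of the solution: solutions modulo a univariate polynomial -/

open Polynomial in
/-- The polynomial with coefficients `f j` for `j < b`. -/
noncomputable def univ {k : Type*} [Field k] (b : ℕ) (f : ℕ → k) : k[X] :=
  ∑ j ∈ Finset.range b, Polynomial.C (f j) * Polynomial.X ^ j

section Univ

variable {k : Type*} [Field k]

theorem eval_univ (b : ℕ) (f : ℕ → k) (x : k) :
    (univ b f).eval x = ∑ j ∈ Finset.range b, f j * x ^ j := by
  simp [univ, Polynomial.eval_finsetSum]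

theorem natDegree_univ_le (b : ℕ) (f : ℕ → k) : (univ b f).natDegree ≤ b - 1 := by
  refine Polynomial.natDegree_sum_le_of_forall_le _ _ fun j hj => ?_
  have := Finset.mem_range.1 hj
  exact (Polynomial.natDegree_C_mul_X_pow_le _ _).trans (by omega)

theorem univ_coeff {b : ℕ} (p : Polynomial k) (hp : p.natDegree < b) (f : ℕ → k)
    (hf : ∀ j < b, f j = p.coeff j) : univ b f = p := by
  rw [univ, p.as_sum_range' b hp]
  refine Finset.sum_congr rfl fun j hj => ?_
  rw [hf j (Finset.mem_range.1 hj), Polynomial.C_mul_X_pow_eq_monomial]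

theorem univ_add_X_pow_monic (b : ℕ) (f : ℕ → k) :
    (univ (b + 1) f + Polynomial.X ^ (b + 1)).Monic := by
  rw [add_comm]
  refine Polynomial.monic_X_pow_add ?_
  refine (Polynomial.degree_le_of_natDegree_le (natDegree_univ_le _ _)).trans_lt ?_
  exact_mod_cast (by omega : b + 1 - 1 < b + 1)

theorem natDegree_univ_add_X_pow (b : ℕ) (f : ℕ → k) :
    (univ (b + 1) f + Polynomial.X ^ (b + 1)).natDegree = b + 1 := by
  rw [add_comm]
  refine Polynomial.natDegree_eq_of_degree_eq_some ?_
  rw [Polynomial.degree_add_eq_left_of_degree_lt, Polynomial.degree_X_pow]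
  rw [Polynomial.degree_X_pow]
  refine (Polynomial.degree_le_of_natDegree_le (natDegree_univ_le _ _)).trans_lt ?_
  exact_mod_cast (by omega : b + 1 - 1 < b + 1)

end Univ

/-- The certified parameter. -/
def certParam (n : NT) : NT := .arr n 0 (.lit 0)

/-- The certified bound for the number of coefficients. -/
def certLen (n : NT) : NT := .arr n 0 (.lit 1)

/-- The certified degree of the modulus, minus one. -/
def certDeg (n : NT) : NT := .arr n 0 (.lit 2)

/-- A number larger than the degrees of the values of `t` below the bound `B`, for the certificate
in variable `0`. -/
def certPoints (B : NT) (t : FT Empty) : NT :=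
  .add (.add (.mul (.bind (certParam (.var 0)) ((NT.sum B (t.deg (3 ≤ ·))).ren (liftRen Nat.succ)))
    (certLen (.var 0))) (certLen (.var 0))) (.add (certDeg (.var 0)) (.lit 2))

def certBound (B : NT) (t : FT Empty) : NT :=
  .mul (.bind (certParam (.var 0)) (B.ren (liftRen Nat.succ))) (certPoints B t)

/-- Coefficient `j` of the certified solution with index `(a, i)`. -/
def certSol (n a i j : NT) : FT Unit := .fieldElt (.beta n (.lit 1)) (.pair (.pair a i) j)

/-- The equation with index `r` for the certified solution, minus the product of the certified
modulus and the certified quotient, at the integer `τ`; the index is `r * certPoints + τ`. -/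
def certTerm (B : NT) (t : FT Empty) : FT Unit :=
  .bind (.div (.var 0) (certPoints B t).up) (.bind (.mod (.var 1) (certPoints B t).up.up)
    (.sub
      (.bind (certParam (.var 3)) (.bind (.var 2)
        -- The environment is now `r`, the parameter, then `τ`, `r`, the combined index and `N`,
        -- which the shift by `4` skips. Array `2` is set to `0`, which is harmless for a grid term
        -- because it does not read that array.
        ((t.ren (liftRen (liftRen (· + 4)))).subst fun a =>
          if a < 2 then .get a (.var 0) else if a = 2 then .cast (.lit 0) else
            .sum (certLen (.var 6)) (.mul (certSol (.var 7) (.lit a) (.var 1) (.var 0))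
              (.pow (.cast (.var 4)) (.var 0))))))
      (.mul
        (.add (.sum (.add (certDeg (.var 3)) (.lit 1))
          (.mul (.fieldElt (.beta (.var 4) (.lit 2)) (.var 0)) (.pow (.cast (.var 1)) (.var 0))))
          (.pow (.cast (.var 0)) (.add (certDeg (.var 3)) (.lit 1))))
        (.sum (certLen (.var 3)) (.mul
          (.fieldElt (.beta (.var 4) (.lit 3)) (.pair (.var 2) (.var 0)))
          (.pow (.cast (.var 1)) (.var 0)))))))

section Certificate

variable {k : Type*} [Field k] (c : ℕ → ℕ → k) (N : ℕ)

/-- Entry `0` of a certificate `N` is an array of scalars: the parameter, the number of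
coefficients, and the degree of the modulus minus one. Entries `1`, `2`, `3` code the coefficients
of the solution, the modulus and the quotients as elements of the field of inputs. -/
noncomputable def solPoly (a i : ℕ) : Polynomial k :=
  univ (arr N 0 1) fun j => fieldElt c (Nat.beta N 1) (Nat.pair (Nat.pair a i) j)

/-- Monic of positive degree for every `N`, so no test of the modulus is needed. -/
noncomputable def modPoly : Polynomial k :=
  univ (arr N 0 2 + 1) (fieldElt c (Nat.beta N 2)) + Polynomial.X ^ (arr N 0 2 + 1)

noncomputable def quotPoly (r : ℕ) : Polynomial k :=
  univ (arr N 0 1) fun j => fieldElt c (Nat.beta N 3) (Nat.pair r j)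

theorem eval_certTerm (B : NT) (t : FT Empty) (I : ℕ → ℕ → ℕ) (e : ℕ → ℕ) (r : ℕ)
    (dv : Empty → k → k → k) :
    (certTerm B t).evalDiv I c (cons r (cons N e)) =
      t.eval dv I (oracle c 0 fun a i => (solPoly c N a i).eval
        ((r % (certPoints B t).eval I (cons N e) : ℕ) : k))
        (cons (r / (certPoints B t).eval I (cons N e)) (cons (arr N 0 0) e)) -
      (modPoly c N).eval ((r % (certPoints B t).eval I (cons N e) : ℕ) : k) *
        (quotPoly c N (r / (certPoints B t).eval I (cons N e))).eval
          ((r % (certPoints B t).eval I (cons N e) : ℕ) : k) := by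
  simp only [certTerm, FT.eval, FT.evalDiv]
  rw [FT.eval_subst (dv' := dv), FT.eval_ren, cons_comp_liftRen, cons_comp_liftRen]
  congr 1
  · congr 1
    · funext a i
      simp only [oracle]
      split_ifs with h1 h2
      · simp
      · simp
      · simp only [solPoly, eval_univ]
        have h := FT.eval_fieldElt (k := k) I c
        simp only [FT.evalDiv] at h
        simp [certLen, certSol, h, cons]
    · simp [certParam, cons]; rfl
  · have h := FT.eval_fieldElt (k := k) I c
    simp only [FT.evalDiv] at h
    simp [certLen, certDeg, h, cons, modPoly, quotPoly, eval_univ]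

end Certificate

/-- Each array entry may itself be a polynomial of degree up to `b`, so degree `n` in the entries
becomes degree `n * b`. -/
theorem isDegree_natDegree {R : Type*} [CommRing R] (b : ℕ) :
    FT.IsDegree (fun n (P : Polynomial R) => P.natDegree ≤ n * b) where
  zero := by simp
  one := by simp
  mono h h' := h'.trans (Nat.mul_le_mul_right _ h)
  add h h' := Polynomial.natDegree_add_le_of_degree_le h h'
  sub h h' := (Polynomial.natDegree_sub_le_of_le h h').trans (max_self _).le
  mul h h' := Polynomial.natDegree_mul_le.trans (by rw [add_mul]; exact add_le_add h h')

section

variable {k : Type*} [Field k] (c : ℕ → ℕ → k)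

theorem eval_certBound (B : NT) (t : FT Empty) (I : ℕ → ℕ → ℕ) (e : ℕ → ℕ) (N : ℕ) :
    (certBound B t).eval I (cons N e) =
      B.eval I (cons (arr N 0 0) e) * (certPoints B t).eval I (cons N e) := by
  simp only [certBound, NT.eval, NT.eval_ren, cons_comp_liftRen, certParam, NT.eval_arr, cons_zero]
  rfl

theorem eval_certPoints (B : NT) (t : FT Empty) (I : ℕ → ℕ → ℕ) (e : ℕ → ℕ) (N : ℕ) :
    (certPoints B t).eval I (cons N e) =
      (∑ r ∈ Finset.range (B.eval I (cons (arr N 0 0) e)),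
        (t.deg (3 ≤ ·)).eval I (cons r (cons (arr N 0 0) e))) * arr N 0 1 + arr N 0 1 +
        (arr N 0 2 + 2) := by
  simp only [certPoints, NT.eval, NT.eval_ren, cons_comp_liftRen, certParam, certLen, certDeg,
    NT.eval_arr, cons_zero]
  rfl

/-- The tests at integers prove the polynomial identity `F(p) = m h`, whose right side vanishes at
any root `θ` of the modulus. So the values of the certified polynomials at `θ` are a solution. -/
theorem exists_solution_of_certTerm [IsAlgClosed k] [CharZero k] (B : NT) (t : FT Empty)
    (I : ℕ → ℕ → ℕ) (e : ℕ → ℕ) (dv : Empty → k → k → k) (N : ℕ)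
    (H : ∀ r < (certBound B t).eval I (cons N e),
      (certTerm B t).evalDiv I c (cons r (cons N e)) = 0) :
    ∃ z : ℕ → ℕ → k, ∀ r < B.eval I (cons (arr N 0 0) e),
      t.eval dv I (oracle c 0 z) (cons r (cons (arr N 0 0) e)) = 0 := by
  obtain ⟨θ, hθ⟩ := IsAlgClosed.exists_root (modPoly c N) (by
    rw [modPoly, Polynomial.degree_eq_natDegree (univ_add_X_pow_monic _ _).ne_zero,
      natDegree_univ_add_X_pow]
    exact_mod_cast Nat.succ_ne_zero (arr N 0 2))
  refine ⟨fun a i => (solPoly c N a i).eval θ, fun r hr => ?_⟩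
  set D := (certPoints B t).eval I (cons N e) with hD
  have hD' := eval_certPoints B t I e N
  rw [← hD] at hD'
  let Q := t.eval (fun d => d.elim) I
    (oracle (fun a i => Polynomial.C (c a i)) 0 (solPoly c N)) (cons r (cons (arr N 0 0) e))
  have hQ : ∀ x, Q.eval x =
      t.eval dv I (oracle c 0 fun a i => (solPoly c N a i).eval x)
        (cons r (cons (arr N 0 0) e)) := by
    intro x
    rw [← Polynomial.coe_evalRingHom, FT.map_eval _ _ _ _ _ _ dv, oracle_map]
    simp
    rfl
  have hdeg : Q.natDegree ≤
      (∑ r ∈ Finset.range (B.eval I (cons (arr N 0 0) e)),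
        (t.deg (3 ≤ ·)).eval I (cons r (cons (arr N 0 0) e))) * arr N 0 1 := by
    refine ((isDegree_natDegree (arr N 0 1)).eval_deg I _ (3 ≤ ·) (fun a i => ?_) t _).trans
      (Nat.mul_le_mul_right _ (Finset.single_le_sum
        (f := fun r => (t.deg (3 ≤ ·)).eval I (cons r (cons (arr N 0 0) e)))
        (fun _ _ => Nat.zero_le _) (Finset.mem_range.2 hr)))
    simp only [oracle]
    split_ifs <;> first | simp; done | skip
    · exact (natDegree_univ_le _ _).trans (by omega)
    · simp at *; omega
  suffices h : Q - modPoly c N * quotPoly c N r = 0 by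
    rw [← hQ, sub_eq_zero.1 h, Polynomial.eval_mul, hθ, zero_mul]
  refine Polynomial.eq_zero_of_natDegree_lt_card_of_eval_eq_zero' _
    ((Finset.range D).map ⟨Nat.cast, Nat.cast_injective⟩) (fun y hy => ?_) ?_
  · simp only [Finset.mem_map, Finset.mem_range, Function.Embedding.coeFn_mk] at hy
    obtain ⟨τ, hτ, rfl⟩ := hy
    have h1 := H (r * D + τ) (by rw [eval_certBound, ← hD]; nlinarith)
    have h2 : (r * D + τ) / D = r := by
      rw [add_comm, Nat.add_mul_div_right _ _ (by omega), Nat.div_eq_of_lt hτ, zero_add]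
    have h3 : (r * D + τ) % D = τ := by rw [Nat.mul_add_mod', Nat.mod_eq_of_lt hτ]
    rw [eval_certTerm (dv := dv), ← hD, h2, h3] at h1
    rw [Polynomial.eval_sub, Polynomial.eval_mul, hQ, h1]
  · rw [Finset.card_map, Finset.card_range]
    refine (Polynomial.natDegree_sub_le_of_le hdeg
      (Polynomial.natDegree_mul_le_of_le (natDegree_univ_add_X_pow _ _).le
        (natDegree_univ_le _ _))).trans_lt ?_
    -- With `L` coefficients, modulus of degree `δ + 1` and `d` the degree bound for the equations,
    -- the two degrees are at most `d L` and `(δ + 1) + (L - 1)`. The `2` in `certPoints` is needed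
    -- for `L = 0`, where `L - 1` is truncated to `0`.
    rw [hD']
    refine max_lt ?_ ?_ <;> omega

theorem pair_lt_pair {a a' b b' : ℕ} (h : a < a') (h' : b < b') :
    Nat.pair a b < Nat.pair a' b' :=
  (Nat.pair_lt_pair_left b h).trans (Nat.pair_lt_pair_right a' h')

theorem exists_forall_lt_le (n : ℕ) (f : ℕ → ℕ) : ∃ S, ∀ i < n, f i ≤ S :=
  ⟨∑ i ∈ Finset.range n, f i, fun _ hi =>
    Finset.single_le_sum (f := f) (fun _ _ => Nat.zero_le _) (Finset.mem_range.2 hi)⟩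

/-- A solution yields polynomials over the field of inputs that solve the equations modulo a monic
polynomial. -/
theorem exists_polynomials_of_solution [CharZero k] (B : ℕ) (t : FT Empty)
    (I : ℕ → ℕ → ℕ) (e : ℕ → ℕ → ℕ) (dv : Empty → k → k → k) (hc : ∀ a, 2 ≤ a → c a = 0)
    (z : ℕ → ℕ → k) (H : ∀ r < B, t.eval dv I (oracle c 0 z) (e r) = 0) :
    ∃ (S : ℕ) (m : Polynomial (inputField c)) (p : ℕ → ℕ → Polynomial (inputField c))
      (h : ℕ → Polynomial (inputField c)), m.Monic ∧ 0 < m.natDegree ∧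
      ∀ r < B, ∀ (x : k) (y : ℕ → ℕ → k),
        (∀ a < S, ∀ i < S, y a i = ((p a i).map (inputField c).subtype).eval x) →
        t.eval dv I (oracle c 0 y) (e r) =
          (m.map (inputField c).subtype).eval x * ((h r).map (inputField c).subtype).eval x := by
  classical
  -- The equations read only finitely many entries of the arrays, so `z` may be cut down to the
  -- finitely many variables that the descent requires.
  choose S' hS' using fun r => t.exists_eval_eq (R := k) I (e r)
  obtain ⟨S, hS⟩ := exists_forall_lt_le B S'
  have hcK : ∀ a i, c a i ∈ inputField c := by
    intro a i
    by_cases ha : a < 2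
    · exact Subfield.subset_closure ⟨a, ha, i, rfl⟩
    · rw [hc a (by omega)]; exact zero_mem _
  obtain ⟨m, p, hm, hm', hp⟩ := exists_polynomial_solution (K := inputField c)
    (fun ai : Fin S × Fin S => z ai.1 ai.2)
  let F : ℕ → MvPolynomial (Fin S × Fin S) (inputField c) := fun r =>
    t.eval (fun d => d.elim) I (oracle (fun a i => C ⟨c a i, hcK a i⟩) 0 fun a i =>
      if h : a < S ∧ i < S then X (⟨a, h.1⟩, ⟨i, h.2⟩) else 0) (e r)
  have hF : ∀ r < B, aeval (fun ai : Fin S × Fin S => z ai.1 ai.2) (F r) = 0 := by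
    intro r hr
    rw [← H r hr, ← AlgHom.coe_toRingHom, FT.map_eval _ _ _ _ _ _ dv, oracle_map]
    refine hS' r _ _ (fun a ha i hi => ?_) _ _
    have := hS r hr
    have hai : a < S ∧ i < S := by omega
    simp only [oracle]
    split_ifs
    · simp; rfl
    · simp
    · simp [hai]
  have hdvd : ∀ r, ∃ h, r < B → aeval p (F r) = m * h := by
    intro r
    by_cases hr : r < B
    · obtain ⟨h, hh⟩ := hp (F r) (hF r hr)
      exact ⟨h, fun _ => hh⟩
    · exact ⟨0, fun h => absurd h hr⟩
  choose h hh using hdvd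
  refine ⟨S, m, fun a i => if h : a < S ∧ i < S then p (⟨a, h.1⟩, ⟨i, h.2⟩) else 0, h, hm, hm',
    fun r hr x y hy => ?_⟩
  rw [← Polynomial.eval_mul, ← Polynomial.map_mul, ← hh r hr, Polynomial.eval_map,
    ← Polynomial.coe_eval₂RingHom, ← AlgHom.coe_toRingHom, ← RingHom.comp_apply,
    FT.map_eval _ _ _ _ _ _ dv, oracle_map]
  refine hS' r _ _ (fun a ha i hi => ?_) _ _
  have := hS r hr
  have hai : a < S ∧ i < S := by omega
  simp only [oracle]
  split_ifs
  · simp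
  · simp
  · simp [hy a hai.1 i hai.2, hai, Polynomial.eval_map]

/-- The coefficients of the solution modulo `m`, of `m` and of the quotients lie in the field of
inputs, hence can be coded in `N`. What the code says about array indices from `S` on is arbitrary,
since the equations do not read them. -/
theorem exists_certTerm_of_solution [CharZero k] (B : NT) (t : FT Empty)
    (I : ℕ → ℕ → ℕ) (e : ℕ → ℕ) (dv : Empty → k → k → k) (hc : ∀ a, 2 ≤ a → c a = 0) (M : ℕ)
    (z : ℕ → ℕ → k)
    (H : ∀ r < B.eval I (cons M e), t.eval dv I (oracle c 0 z) (cons r (cons M e)) = 0) :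
    ∃ N, ∀ r < (certBound B t).eval I (cons N e),
      (certTerm B t).evalDiv I c (cons r (cons N e)) = 0 := by
  obtain ⟨S, m, p, h, hm, hm', hp⟩ := exists_polynomials_of_solution c _ t I
    (fun r => cons r (cons M e)) dv hc z H
  set φ := (inputField c).subtype with hφ
  obtain ⟨b₁, hb₁⟩ := exists_forall_lt_le S fun a => ∑ i ∈ Finset.range S, (p a i).natDegree
  obtain ⟨b₂, hb₂⟩ := exists_forall_lt_le (B.eval I (cons M e)) fun r => (h r).natDegree
  set b := b₁ + b₂ + 1 with hb
  obtain ⟨δ, hδ⟩ : ∃ δ, m.natDegree = δ + 1 := ⟨_, (Nat.succ_pred_eq_of_pos hm').symm⟩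
  obtain ⟨κ, hκ⟩ := exists_fieldElt_eq c
    (fun w => ((p w.unpair.1.unpair.1 w.unpair.1.unpair.2).coeff w.unpair.2 : k))
    (fun w => SetLike.coe_mem _) (Nat.pair (Nat.pair S S) b)
  obtain ⟨μ, hμ⟩ := exists_fieldElt_eq c (fun j => (m.coeff j : k)) (fun w => SetLike.coe_mem _)
    (δ + 1)
  obtain ⟨η, hη⟩ := exists_fieldElt_eq c (fun w => ((h w.unpair.1).coeff w.unpair.2 : k))
    (fun w => SetLike.coe_mem _) (Nat.pair (B.eval I (cons M e)) b)
  obtain ⟨n₀, hn₀⟩ := exists_beta_eq (cons M (cons b (cons δ 0))) 3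
  obtain ⟨N, hN⟩ := exists_beta_eq (cons n₀ (cons κ (cons μ (cons η 0)))) 4
  have h0 : Nat.beta N 0 = n₀ := hN 0 (by omega)
  have h1 : Nat.beta N 1 = κ := hN 1 (by omega)
  have h2 : Nat.beta N 2 = μ := hN 2 (by omega)
  have h3 : Nat.beta N 3 = η := hN 3 (by omega)
  have h00 : arr N 0 0 = M := by rw [arr, h0]; exact hn₀ 0 (by omega)
  have h01 : arr N 0 1 = b := by rw [arr, h0]; exact hn₀ 1 (by omega)
  have h02 : arr N 0 2 = δ := by rw [arr, h0]; exact hn₀ 2 (by omega)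
  have hsol : ∀ a < S, ∀ i < S, solPoly c N a i = (p a i).map φ := by
    intro a ha i hi
    rw [solPoly, h01, h1]
    refine univ_coeff _ ?_ _ fun j hj => ?_
    · rw [Polynomial.natDegree_map]
      have := Finset.single_le_sum (f := fun i => (p a i).natDegree) (fun _ _ => Nat.zero_le _)
        (Finset.mem_range.2 hi)
      have := hb₁ a ha
      omega
    · rw [hκ _ (pair_lt_pair (pair_lt_pair ha hi) hj), Polynomial.coeff_map]
      simp [hφ]
  have hmod : modPoly c N = m.map φ := by
    have hd : (m.map φ).natDegree = δ + 1 := by rw [Polynomial.natDegree_map, hδ]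
    rw [modPoly, h02, h2, (m.map φ).as_sum_range' (δ + 2) (by omega), Finset.sum_range_succ]
    congr 1
    · rw [univ]
      refine Finset.sum_congr rfl fun j hj => ?_
      rw [hμ j (Finset.mem_range.1 hj), Polynomial.C_mul_X_pow_eq_monomial, Polynomial.coeff_map]
      rfl
    · rw [← hd, (hm.map φ).coeff_natDegree, Polynomial.monomial_one_right_eq_X_pow]
  have hquot : ∀ r < B.eval I (cons M e), quotPoly c N r = (h r).map φ := by
    intro r hr
    rw [quotPoly, h01, h3]
    refine univ_coeff _ ?_ _ fun j hj => ?_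
    · rw [Polynomial.natDegree_map]
      have := hb₂ r hr
      omega
    · rw [hη _ (pair_lt_pair hr hj), Polynomial.coeff_map]
      simp [hφ]
  refine ⟨N, fun r hr => ?_⟩
  rw [eval_certBound, h00] at hr
  have hr' := Nat.div_lt_of_lt_mul (by rwa [mul_comm] at hr)
  rw [eval_certTerm (dv := dv), h00, hmod, hquot _ hr',
    hp _ hr' _ _ fun a ha i hi => by rw [hsol a ha i hi], sub_self]

end

/-- There is a program that, for terms `B`, `v` and `t`, searches for a parameter `N` such that
for some array `z` the values of `t` below the bound `B` vanish for all `x` with `v` entries. -/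
theorem exists_program_exists_zero (B v : NT) (t : FT Empty) :
    ∃ P : Program, ∀ (k : Type u) [Field k] [IsAlgClosed k] [CharZero k] (s : Store k)
      (dv : Empty → k → k → k),
      (∀ a, 2 ≤ a → s.nat a = 0) → (∀ a, 2 ≤ a → s.fld a = 0) →
      (Terminates P s ↔ ∃ (N : ℕ) (z : ℕ → ℕ → k), ∀ r < B.eval s.nat (cons N 0), ∀ x : ℕ → k,
        (∀ i, v.eval s.nat (cons N 0) ≤ i → x i = 0) →
        t.eval dv s.nat (oracle s.fld x z) (cons r (cons N 0)) = 0) := by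
  -- The grid removes `x` first, then certificates remove `z`. The parameter of the statement is the
  -- scalar `arr N 0 0` of the certificate `N` that is searched for.
  let B₁ := NT.mul B (gridSize B v t)
  let t₁ := gridTerm B v t
  refine ⟨searchProgram (certBound B₁ t₁) (certTerm B₁ t₁), fun k _ _ _ s dv hn hf => ?_⟩
  rw [terminates_searchProgram _ _ _ hn hf]
  simp only [← forall_gridTerm_iff dv B v t s.nat s.fld _ 0]
  constructor
  · rintro ⟨N, hN⟩
    exact ⟨_, exists_solution_of_certTerm s.fld B₁ t₁ s.nat 0 dv N hN⟩
  · rintro ⟨M, z, hz⟩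
    exact exists_certTerm_of_solution s.fld B₁ t₁ s.nat 0 dv hf M z hz

/-! ## Nonvanishing of residues -/

section Residue

theorem coeff_coeff_sumAlgEquiv {R σ τ : Type*} [CommSemiring R] (P : MvPolynomial (σ ⊕ τ) R)
    (a : σ →₀ ℕ) (b : τ →₀ ℕ) :
    coeff b (coeff a (sumAlgEquiv R σ τ P)) = coeff (Finsupp.sumElim a b) P := by
  classical
  induction P using MvPolynomial.induction_on' with
  | add p q hp hq => simp [hp, hq]
  | monomial d r =>
    have : sumAlgEquiv R σ τ (monomial d r) = monomial (Finsupp.sumFinsuppAddEquivProdFinsupp d).1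
        (monomial (Finsupp.sumFinsuppAddEquivProdFinsupp d).2 r) := by
      simp [sumAlgEquiv, monomial]
    have h : d = Finsupp.sumElim a b ↔ (Finsupp.sumFinsuppAddEquivProdFinsupp d).1 = a ∧
        (Finsupp.sumFinsuppAddEquivProdFinsupp d).2 = b := by
      rw [← Prod.mk_inj, ← Equiv.apply_eq_iff_eq Finsupp.sumFinsuppAddEquivProdFinsupp.toEquiv]
      simp [Prod.ext_iff, DFunLike.ext_iff]
    simp only [this, coeff_monomial, h]
    split_ifs <;> simp_all [coeff_monomial]

variable {k : Type u} [Field k] {p m : ℕ} {σ : Type}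

/-- All monomial reductions give the same value, so one reduction with one nonzero coefficient is
enough; and without a reduction the residue is `0` by convention. On the residue variables `ε` is `d
- 1`, on the others it is the exponent of the nonzero coefficient. The bijection `e` lets the lemma
serve both quantum dimensions. -/
theorem residue_ne_zero_iff (F : Fin p → MvPolynomial (Fin p) k) (e : Fin p ⊕ Fin m ≃ σ)
    (h : MvPolynomial σ k) :
    residue (fun i => map (C : k →+* MvPolynomial (Fin m) k) (F i))
      (sumAlgEquiv k (Fin p) (Fin m) (rename e.symm h)) ≠ 0 ↔
    ∃ (M : Matrix (Fin p) (Fin p) (MvPolynomial σ k)) (ε : σ →₀ ℕ),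
      (∀ i, ∑ j, M i j * rename (e ∘ Sum.inl) (F j) = X (e (.inl i)) ^ (ε (e (.inl i)) + 1)) ∧
      coeff ε (h * M.det) ≠ 0 := by
  let Φ : MvPolynomial σ k ≃ₐ[k] MvPolynomial (Fin p) (MvPolynomial (Fin m) k) :=
    (renameEquiv k e.symm).trans (sumAlgEquiv k (Fin p) (Fin m))
  have hΦh : sumAlgEquiv k (Fin p) (Fin m) (rename e.symm h) = Φ h := rfl
  have hΦF : ∀ j, Φ (rename (e ∘ Sum.inl) (F j)) = map C (F j) := by
    intro j
    have := DFunLike.congr_fun (sumAlgEquiv_comp_rename_inl (R := k) (S₁ := Fin p)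
      (S₂ := Fin m)) (F j)
    simp only [Φ, AlgEquiv.trans_apply, renameEquiv_apply, rename_rename]
    have he : (e.symm ∘ e ∘ Sum.inl : Fin p → Fin p ⊕ Fin m) = Sum.inl := by funext; simp
    rw [he]
    exact this
  have hΦX : ∀ i, Φ (X (e (.inl i))) = X i := by
    intro i
    simp [Φ]
  have hco : ∀ P (a : Fin p →₀ ℕ) (b : Fin m →₀ ℕ), coeff b (coeff a (Φ P)) =
      coeff ((Finsupp.sumElim a b).equivMapDomain e) P := by
    intro P a b
    simp only [Φ, AlgEquiv.trans_apply, renameEquiv_apply, coeff_coeff_sumAlgEquiv]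
    conv_rhs => rw [← coeff_rename_mapDomain _ e.symm.injective]
    congr 1
    rw [← Finsupp.equivMapDomain_eq_mapDomain, ← Finsupp.equivMapDomain_trans]
    simp
  rw [hΦh]
  constructor
  · intro hne
    have H : Nonempty (MonomialReduction fun i =>
        map (C : k →+* MvPolynomial (Fin m) k) (F i)) := by
      by_contra H
      exact hne (dif_neg H)
    obtain ⟨r⟩ := H
    rw [residue_eq_value r] at hne
    obtain ⟨b, hb⟩ := ne_zero_iff.1 hne
    rw [MonomialReduction.value] at hb
    refine ⟨r.M.map Φ.symm, (Finsupp.sumElim (Finsupp.equivFunOnFinite.symm fun i => r.d i - 1)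
      b).equivMapDomain e, fun i => ?_, ?_⟩
    · apply Φ.injective
      have := r.mulVec_eq i
      simp only [Matrix.mulVec, dotProduct] at this
      have hd := r.d_pos i
      simp [map_sum, hΦF, hΦX, this, Finsupp.equivMapDomain_apply, Nat.sub_add_cancel hd]
    · rw [← hco, map_mul]
      have : Φ ((r.M.map Φ.symm).det) = r.M.det := by
        rw [← AlgEquiv.coe_ringEquiv, RingEquiv.map_det]
        congr 1
        ext i j
        simp
      rwa [this]
  · rintro ⟨M, ε, hM, hε⟩
    let r : MonomialReduction fun i => map (C : k →+* MvPolynomial (Fin m) k) (F i) :=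
      { M := M.map Φ
        d := fun i => ε (e (.inl i)) + 1
        d_pos := fun i => by omega
        mulVec_eq := fun i => by
          have := congrArg Φ (hM i)
          simpa [map_sum, hΦF, hΦX, Matrix.mulVec, dotProduct] using this }
    rw [residue_eq_value r, ne_zero_iff]
    refine ⟨Finsupp.equivFunOnFinite.symm fun j => ε (e (.inr j)), ?_⟩
    have hdet : r.M.det = Φ M.det := (RingEquiv.map_det Φ.toRingEquiv M).symm
    rw [MonomialReduction.value, hdet, ← map_mul, hco]
    convert hε
    ext s
    obtain ⟨s, rfl⟩ := e.surjective s
    cases s <;> simp [Finsupp.equivMapDomain_apply, r]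

end Residue

/-! ## Products of matrices and determinants as sums over numbers -/

section Codes

theorem sum_range_digit {S : Type*} [AddCommMonoid S] (b v : ℕ) (F : (Fin v → ℕ) → S) :
    ∑ c ∈ Finset.range (b ^ v), F (fun i => digit b c i) =
      ∑ p : Fin v → Fin b, F fun i => p i := by
  rw [Finset.sum_range, ← finFunctionFinEquiv.symm.sum_comp]
  refine Finset.sum_congr rfl fun c _ => ?_
  congr 1

/-- Expansion of the product over walks `p` from `i` to `j`: factor `s` contributes the entry for
step `s`. -/
theorem listProd_apply {S ι : Type*} [CommRing S] [Fintype ι] [DecidableEq ι] (v : ℕ)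
    (A : Fin v → Matrix ι ι S) (i j : ι) :
    (List.ofFn A).prod i j = ∑ p : Fin (v + 1) → ι,
      if p 0 = i ∧ p (Fin.last v) = j then ∏ s : Fin v, A s (p s.castSucc) (p s.succ) else 0 := by
  induction v generalizing i with
  | zero =>
    rw [← (Equiv.funUnique (Fin 1) ι).symm.sum_comp]
    have : ∀ x : ι, (x = i ∧ x = j) ↔ x = i ∧ i = j := by aesop
    simp [Matrix.one_apply, Equiv.funUnique, this, ite_and]
  | succ v ih =>
    rw [List.ofFn_succ, List.prod_cons, Matrix.mul_apply, ← (Fin.consEquiv fun _ => ι).sum_comp,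
      Fintype.sum_prod_type, Finset.sum_comm]
    simp only [ih, Fin.consEquiv, Equiv.coe_fn_mk, Finset.mul_sum]
    rw [Finset.sum_comm]
    refine Finset.sum_congr rfl fun p _ => ?_
    simp only [← Fin.succ_last, Fin.cons_succ, Fin.cons_zero, Fin.prod_univ_succ, Fin.castSucc_zero,
      ← Fin.succ_castSucc, ite_and, mul_ite, mul_zero, Finset.sum_ite_eq, Finset.sum_ite_eq',
      Finset.mem_univ, if_true]

/-- The product of the signs of `p i - p j` over `j < i`. -/
def signProd (S : Type*) [CommRing S] (m : ℕ) (p : ℕ → ℕ) : S :=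
  ∏ i ∈ Finset.range m, ∏ j ∈ Finset.range i,
    ((if p j < p i then 1 else 0) - (if p i < p j then 1 else 0))

/-- A pair contributes `-1` exactly when it is an inversion of `τ`. -/
theorem signProd_perm (S : Type*) [CommRing S] {m : ℕ} (p : ℕ → ℕ) (τ : Equiv.Perm (Fin m))
    (hp : ∀ i : Fin m, p i = τ i) : signProd S m p = ((Equiv.Perm.sign τ : ℤ) : S) := by
  rw [Equiv.Perm.sign_eq_prod_prod_Iio, signProd, Finset.prod_range]
  push_cast
  refine Finset.prod_congr rfl fun i _ => ?_
  refine (Finset.prod_bij (fun (j : Fin m) _ => (j : ℕ)) ?_ ?_ ?_ ?_).symm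
  · intro j hj; simpa using hj
  · intro j _ j' _ h; exact Fin.ext h
  · intro j hj
    exact ⟨⟨j, (Finset.mem_range.1 hj).trans i.2⟩,
      Finset.mem_Iio.2 (Fin.lt_def.2 (Finset.mem_range.1 hj)), rfl⟩
  · intro j hj
    have hne : τ j ≠ τ i := fun h => (Finset.mem_Iio.1 hj).ne (τ.injective h)
    rw [hp i, hp j]
    rcases lt_or_gt_of_ne hne with h | h
    · simp [h, not_lt_of_gt h]
    · simp [h, not_lt_of_gt h]

/-- A repeated value gives a factor `0`. Thus the Leibniz sum may run over all maps, which are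
easily numbered, instead of permutations. -/
theorem signProd_eq_zero (S : Type*) [CommRing S] {m : ℕ} (p : ℕ → ℕ) {i j : ℕ} (hi : i < m)
    (hj : j < m) (hij : i ≠ j) (h : p i = p j) : signProd S m p = 0 := by
  wlog hlt : j < i generalizing i j
  · exact this hj hi hij.symm h.symm (by omega)
  exact Finset.prod_eq_zero (Finset.mem_range.2 hi)
    (Finset.prod_eq_zero (Finset.mem_range.2 hlt) (by simp [h]))

/-- The Leibniz formula, as a sum over numbers. -/
def detCode {S : Type*} [CommRing S] (m : ℕ) (M : ℕ → ℕ → S) : S :=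
  ∑ c ∈ Finset.range (m ^ m), signProd S m (digit m c) *
    ∏ i ∈ Finset.range m, M i (digit m c i)

theorem detCode_eq {S : Type*} [CommRing S] (m : ℕ) (M : ℕ → ℕ → S) :
    detCode m M = Matrix.det (Matrix.of fun i j : Fin m => M i j) := by
  have h1 : detCode m M = ∑ p : Fin m → Fin m,
      signProd S m (fun i => if h : i < m then p ⟨i, h⟩ else 0) * ∏ i : Fin m, M i (p i) := by
    rw [← sum_range_digit m m fun p : Fin m → ℕ =>
      signProd S m (fun i => if h : i < m then p ⟨i, h⟩ else 0) * ∏ i : Fin m, M i (p i)]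
    refine Finset.sum_congr rfl fun c _ => ?_
    rw [Finset.prod_range]
    congr 1
    refine Finset.prod_congr rfl fun i hi => Finset.prod_congr rfl fun j hj => ?_
    have hi' := Finset.mem_range.1 hi
    have hj' := (Finset.mem_range.1 hj).trans hi'
    simp only [hi', hj', dif_pos]
  -- `Matrix.det_apply'` multiplies the entries `M (τ i) i`, hence the transposition. Maps that are
  -- not permutations contribute `0`.
  rw [h1, ← Matrix.det_transpose, Matrix.det_apply']
  symm
  refine Finset.sum_of_injOn (fun τ : Equiv.Perm (Fin m) => (τ : Fin m → Fin m))
    (fun τ _ τ' _ h => Equiv.coe_fn_injective h) (fun _ _ => Finset.mem_coe.2 (Finset.mem_univ _))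
    (fun p _ hp => ?_) fun τ _ => ?_
  · have hinj : ¬ Function.Injective p := fun h =>
      hp ⟨Equiv.ofBijective p (Finite.injective_iff_bijective.1 h), by simp, rfl⟩
    simp only [Function.Injective, not_forall] at hinj
    obtain ⟨i, j, hij, hne⟩ := hinj
    rw [signProd_eq_zero S _ i.2 j.2 (fun h => hne (Fin.ext h)) (by simp [hij]), zero_mul]
  · rw [signProd_perm S _ τ (by simp)]
    rfl

/-- The supertrace of the product of the matrices `D 0, …, D (v - 1)`, whose indices run up to `R`
and are even below `r`, as a sum over numbers. -/
def strCode {S : Type*} [CommRing S] (v r R : ℕ) (D : ℕ → ℕ → ℕ → S) : S :=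
  ∑ c ∈ Finset.range (R ^ (v + 1)), (if digit R c 0 = digit R c v then 1 else 0) *
    ((if digit R c 0 < r then 1 else 0) - (if digit R c 0 < r then 0 else 1)) *
    ∏ s ∈ Finset.range v, D s (digit R c s) (digit R c (s + 1))

/-- A sum over closed walks, signed by the parity of the starting point. As `finSumFinEquiv` numbers
the even indices first, parity is comparison with `r`. -/
theorem supertrace_listProd {S : Type*} [CommRing S] (v r s : ℕ)
    (A : Fin v → Matrix (Fin r ⊕ Fin s) (Fin r ⊕ Fin s) S) (D : ℕ → ℕ → ℕ → S)
    (hD : ∀ (t : Fin v) i j, D t (finSumFinEquiv i) (finSumFinEquiv j) = A t i j) :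
    supertrace (List.ofFn A).prod = strCode v r (r + s) D := by
  have h1 : ∀ B : Matrix (Fin r ⊕ Fin s) (Fin r ⊕ Fin s) S, supertrace B =
      ∑ i, ((if (finSumFinEquiv i : ℕ) < r then 1 else 0) -
        (if (finSumFinEquiv i : ℕ) < r then 0 else 1)) * B i i := by
    intro B
    simp [supertrace, Matrix.trace, Matrix.toBlocks₁₁, Matrix.toBlocks₂₂, sub_eq_add_neg]
  have h2 : strCode v r (r + s) D = ∑ p : Fin (v + 1) → Fin (r + s),
      (if p 0 = p (Fin.last v) then 1 else 0) *
      ((if (p 0 : ℕ) < r then 1 else 0) - (if (p 0 : ℕ) < r then 0 else 1)) *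
      ∏ t : Fin v, D t (p t.castSucc) (p t.succ) := by
    simp only [Fin.ext_iff]
    rw [← sum_range_digit (r + s) (v + 1) fun p : Fin (v + 1) → ℕ =>
      (if p 0 = p (Fin.last v) then 1 else 0) *
      ((if (p 0 : ℕ) < r then 1 else 0) - (if (p 0 : ℕ) < r then 0 else 1)) *
      ∏ t : Fin v, D t (p t.castSucc) (p t.succ)]
    refine Finset.sum_congr rfl fun c _ => ?_
    rw [Finset.prod_range]
    rfl
  rw [h1, h2, ← (Equiv.arrowCongr (Equiv.refl (Fin (v + 1))) finSumFinEquiv).sum_comp]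
  simp only [listProd_apply, Finset.mul_sum]
  rw [Finset.sum_comm]
  refine Finset.sum_congr rfl fun p _ => ?_
  simp only [Equiv.arrowCongr_apply, Function.comp_apply, Equiv.refl_symm, Equiv.refl_apply, hD,
    EmbeddingLike.apply_eq_iff_eq, mul_ite, mul_zero, ite_and, Finset.sum_ite_eq, Finset.mem_univ,
    if_true]
  by_cases h : p 0 = p (Fin.last v)
  · simp [h]
  · simp [h, Ne.symm h]

end Codes

/-- Lets the supertrace be evaluated at a point from the values of the entries, so that no term has
to multiply polynomials. -/
theorem map_strCode {S T : Type*} [CommRing S] [CommRing T] (φ : S →+* T) (v r R : ℕ)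
    (D : ℕ → ℕ → ℕ → S) :
    φ (strCode v r R D) = strCode v r R fun s i j => φ (D s i j) := by
  simp only [strCode, map_sum, map_mul, map_prod, map_sub, apply_ite φ, map_one, map_zero]

theorem map_detCode {S T : Type*} [CommRing S] [CommRing T] (φ : S →+* T) (m : ℕ)
    (M : ℕ → ℕ → S) : φ (detCode m M) = detCode m fun i j => φ (M i j) := by
  simp only [detCode, signProd, map_sum, map_mul, map_prod, map_sub, apply_ite φ, map_one, map_zero]

/-! ### Matrix factorizations with integral degrees -/

theorem exists_common_denominator {κ : Type*} [Finite κ] (a : κ → ℚ) :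
    ∃ D : ℕ, ∀ i, ∃ z : ℤ, a i * (D + 1) = z := by
  have := Fintype.ofFinite κ
  -- The denominator is written `D + 1`, so that every natural number `D` in a certificate gives a
  -- positive one.
  refine ⟨(∏ i, (a i).den) - 1, fun i => ?_⟩
  have h1 : ((∏ i, (a i).den) - 1 : ℕ) + (1 : ℚ) = ((∏ i, (a i).den : ℕ) : ℚ) := by
    have : 0 < ∏ i, (a i).den := Finset.prod_pos fun i _ => (a i).den_pos
    exact_mod_cast Nat.sub_add_cancel this
  obtain ⟨m, hm⟩ := Finset.dvd_prod_of_mem (fun i => (a i).den) (Finset.mem_univ i)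
  refine ⟨(a i).num * m, ?_⟩
  rw [h1, hm]
  push_cast
  rw [← mul_assoc, Rat.mul_den_eq_num]

section

variable {k : Type u} [Field k] {q n : ℕ}

/-- The partial derivative for the variable with number `s`. -/
noncomputable def pd (s : ℕ) (P : MvPolynomial (Fin q ⊕ Fin n) k) :
    MvPolynomial (Fin q ⊕ Fin n) k :=
  if h : s < q + n then pderiv (finSumFinEquiv.symm ⟨s, h⟩) P else 0

/-- A matrix factorization with rows and columns numbered, and degrees given by natural numbers. -/
structure NumberedFactorization (f : Potential k q) (g : Potential k n) where
  r : ℕ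
  s : ℕ
  den : ℕ
  degPos : ℕ
  degNeg : ℕ
  W : ℕ → ℕ
  shiftPos : ℕ → ℕ
  shiftNeg : ℕ → ℕ
  d : ℕ → ℕ → MvPolynomial (Fin q ⊕ Fin n) k
  weight : ∀ x, Sum.elim f.weight g.weight x * (den + 1) = W (finSumFinEquiv x)
  homogeneous : ∀ i < r + s, ∀ j < r + s, ∀ m ∈ (d i j).support, ¬ (i < r ↔ j < r) ∧
    (∑ x, m x * W (finSumFinEquiv x)) + shiftNeg i + shiftPos j + degNeg =
      shiftPos i + shiftNeg j + degPos
  sq : ∀ i < r + s, ∀ l < r + s, ∑ j ∈ Finset.range (r + s), d i j * d j l =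
    if i = l then rename Sum.inl f.poly - rename Sum.inr g.poly else 0

variable {f : Potential k q} {g : Potential k n}

/-- The supertrace of the product of the partial derivatives. -/
noncomputable def NumberedFactorization.str (Q : NumberedFactorization f g) :
    MvPolynomial (Fin q ⊕ Fin n) k :=
  strCode (q + n) Q.r (Q.r + Q.s) fun s i j => pd s (Q.d i j)

/-- A certificate that the residue of `h` with respect to `F` does not vanish. -/
def ResidueCert {σ : Type} {p : ℕ} (F : Fin p → MvPolynomial σ k) (ι : Fin p → σ)
    (h : MvPolynomial σ k) : Prop :=
  ∃ (M : Matrix (Fin p) (Fin p) (MvPolynomial σ k)) (ε : σ →₀ ℕ),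
    (∀ i, ∑ j, M i j * F j = X (ι i) ^ (ε (ι i) + 1)) ∧ coeff ε (h * M.det) ≠ 0

theorem leftQdim_ne_zero_iff (Q : MFDiff f g) : leftQdim Q ≠ 0 ↔
    ResidueCert (fun j => rename Sum.inl (pderiv j f.poly)) Sum.inl (strDeriv Q) := by
  have := residue_ne_zero_iff (fun i => pderiv i f.poly) (Equiv.refl (Fin q ⊕ Fin n)) (strDeriv Q)
  rw [Equiv.refl_symm, Equiv.coe_refl, rename_id_apply] at this
  exact this

theorem rightQdim_ne_zero_iff (Q : MFDiff f g) : rightQdim Q ≠ 0 ↔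
    ResidueCert (fun j => rename Sum.inr (pderiv j g.poly)) Sum.inr (strDeriv Q) :=
  residue_ne_zero_iff (fun i => pderiv i g.poly) (Equiv.sumComm (Fin n) (Fin q)) (strDeriv Q)

theorem strDeriv_eq_strCode (Q : MFDiff f g) (d : ℕ → ℕ → MvPolynomial (Fin q ⊕ Fin n) k)
    (hd : ∀ i j, d (finSumFinEquiv i) (finSumFinEquiv j) = Q.d i j) :
    strDeriv Q = strCode (q + n) Q.evenRank (Q.evenRank + Q.oddRank) fun s i j => pd s (d i j) := by
  have h : (List.ofFn fun t : Fin (q + n) => Q.d.map (pderiv (finSumFinEquiv.symm t))) =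
      (List.ofFn fun i : Fin q => Q.d.map (pderiv (Sum.inl i))) ++
        List.ofFn fun j : Fin n => Q.d.map (pderiv (Sum.inr j)) := by
    rw [List.ofFn_add]
    congr 2
    · funext i
      rw [← finSumFinEquiv_symm_apply_castAdd (n := n) i]
      rfl
    · funext i
      rw [finSumFinEquiv_symm_apply_natAdd]
  rw [strDeriv, ← List.prod_append, ← h]
  exact supertrace_listProd (q + n) Q.evenRank Q.oddRank _ _ fun t i j => by simp [pd, hd]

theorem weight_mul_eq {σ : Type} [Fintype σ] (w : σ → ℚ) (D : ℚ) (W : σ → ℕ)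
    (hW : ∀ x, w x * D = W x) (m : σ →₀ ℕ) :
    Finsupp.weight w m * D = ((∑ x, m x * W x : ℕ) : ℚ) := by
  rw [Finsupp.weight_apply, Finsupp.sum_fintype _ _ (by simp), Finset.sum_mul]
  push_cast
  exact Finset.sum_congr rfl fun x _ => by rw [nsmul_eq_mul, mul_assoc, hW]

/-- Multiplication by a common denominator makes weights, shifts and the degree of `d` integral. The
last two are split into positive and negative parts, so that all discrete data are natural numbers;
the differences divided by `den + 1` recover the rational degrees. -/
theorem orbifoldEquivalent_iff : OrbifoldEquivalent f g ↔ ∃ Q : NumberedFactorization f g,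
    ResidueCert (fun j => rename Sum.inl (pderiv j f.poly)) Sum.inl Q.str ∧
    ResidueCert (fun j => rename Sum.inr (pderiv j g.poly)) Sum.inr Q.str := by
  constructor
  · rintro ⟨Q, hl, hr⟩
    obtain ⟨D, hD⟩ := exists_common_denominator
      (Sum.elim (Sum.elim f.weight g.weight) (Sum.elim Q.shift fun _ : Unit => Q.degree))
    choose z hz using hD
    have hD0 : (0 : ℚ) < D + 1 := by positivity
    let Z : ℕ → ℤ := fun i => if h : i < Q.evenRank + Q.oddRank then
      z (.inr (.inl (finSumFinEquiv.symm ⟨i, h⟩))) else 0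
    let d : ℕ → ℕ → MvPolynomial (Fin q ⊕ Fin n) k := fun i j =>
      if h : i < Q.evenRank + Q.oddRank ∧ j < Q.evenRank + Q.oddRank then
        Q.d (finSumFinEquiv.symm ⟨i, h.1⟩) (finSumFinEquiv.symm ⟨j, h.2⟩) else 0
    have hd : ∀ i j, d (finSumFinEquiv i) (finSumFinEquiv j) = Q.d i j := by
      intro i j
      simp [d]
    let W : ℕ → ℕ := fun i =>
      if h : i < q + n then (z (.inl (finSumFinEquiv.symm ⟨i, h⟩))).toNat else 0
    have hW : ∀ x, Sum.elim f.weight g.weight x * (D + 1) = W (finSumFinEquiv x) := by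
      intro x
      have h1 := hz (.inl x)
      rw [Sum.elim_inl] at h1
      have h2 : (0 : ℚ) < Sum.elim f.weight g.weight x := by
        rcases x with x | x
        exacts [f.weight_pos x, g.weight_pos x]
      have h3 : (0 : ℚ) < z (.inl x) := by rw [← h1]; positivity
      have h4 : W (finSumFinEquiv x) = (z (.inl x)).toNat := by simp [W]
      rw [h1, h4]
      have h5 : (0 : ℤ) < z (.inl x) := by exact_mod_cast h3
      exact_mod_cast (Int.toNat_of_nonneg h5.le).symm
    have hfin : ∀ i < Q.evenRank + Q.oddRank, ∃ x : Fin Q.evenRank ⊕ Fin Q.oddRank,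
        (finSumFinEquiv x : ℕ) = i := fun i hi => ⟨finSumFinEquiv.symm ⟨i, hi⟩, by simp⟩
    refine ⟨⟨Q.evenRank, Q.oddRank, D, (z (.inr (.inr ()))).toNat, (-z (.inr (.inr ()))).toNat,
      W, fun i => (Z i).toNat, fun i => (-Z i).toNat, d, fun x => ?_, ?_, ?_⟩, ?_⟩
    · exact hW x
    · intro i hi j hj m hm
      obtain ⟨x, rfl⟩ := hfin i hi
      obtain ⟨y, rfl⟩ := hfin j hj
      rw [hd, mem_support_iff] at hm
      constructor
      · rcases x with x | x <;> rcases y with y | y <;> simp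
        · exact hm (by rw [show Q.d (.inl x) (.inl y) = Q.d.toBlocks₁₁ x y from rfl,
            Q.even_even]; rfl)
        · exact hm (by rw [show Q.d (.inr x) (.inr y) = Q.d.toBlocks₂₂ x y from rfl,
            Q.odd_odd]; rfl)
      · have h1 := weight_mul_eq _ _ _ hW m
        rw [Q.homogeneous x y hm, add_mul, sub_mul] at h1
        have hx := hz (.inr (.inl x))
        have hy := hz (.inr (.inl y))
        have hdeg := hz (.inr (.inr ()))
        simp only [Sum.elim_inr, Sum.elim_inl] at hx hy hdeg
        rw [hx, hy, hdeg] at h1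
        have h2 : ∀ x, Z (finSumFinEquiv x) = z (.inr (.inl x)) := fun x => by simp [Z]
        rw [h2, h2]
        have h3 : z (.inr (.inl x)) - z (.inr (.inl y)) + z (.inr (.inr ())) =
          ((∑ x, m x * W (finSumFinEquiv x) : ℕ) : ℤ) := by exact_mod_cast h1
        omega
    · intro i hi l hl
      obtain ⟨x, rfl⟩ := hfin i hi
      obtain ⟨y, rfl⟩ := hfin l hl
      have h1 := congrFun (congrFun Q.d_mul_d x) y
      rw [Matrix.mul_apply, Matrix.smul_apply, Matrix.one_apply] at h1
      rw [Finset.sum_range, ← finSumFinEquiv.sum_comp]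
      simp only [hd, h1, Fin.val_inj, EmbeddingLike.apply_eq_iff_eq, smul_eq_mul, mul_ite, mul_one,
        mul_zero]
    · rw [leftQdim_ne_zero_iff, strDeriv_eq_strCode Q d hd] at hl
      rw [rightQdim_ne_zero_iff, strDeriv_eq_strCode Q d hd] at hr
      exact ⟨hl, hr⟩
  · rintro ⟨Q, hl, hr⟩
    have hD0 : (0 : ℚ) < Q.den + 1 := by positivity
    let Q' : MFDiff f g :=
      { evenRank := Q.r
        oddRank := Q.s
        shift := fun i => ((Q.shiftPos (finSumFinEquiv i) : ℚ) - Q.shiftNeg (finSumFinEquiv i)) /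
          (Q.den + 1)
        degree := ((Q.degPos : ℚ) - Q.degNeg) / (Q.den + 1)
        d := Matrix.of fun i j => Q.d (finSumFinEquiv i) (finSumFinEquiv j)
        even_even := ?_
        odd_odd := ?_
        homogeneous := ?_
        d_mul_d := ?_ }
    · refine ⟨Q', ?_, ?_⟩
      · rw [leftQdim_ne_zero_iff, strDeriv_eq_strCode Q' Q.d (fun _ _ => rfl)]
        exact hl
      · rw [rightQdim_ne_zero_iff, strDeriv_eq_strCode Q' Q.d (fun _ _ => rfl)]
        exact hr
    · ext1 i j
      refine support_eq_empty.1 (Finset.eq_empty_of_forall_notMem fun m hm => ?_)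
      exact (Q.homogeneous _ (finSumFinEquiv (.inl i)).2 _ (finSumFinEquiv (.inl j)).2 m hm).1
        (by simp)
    · ext1 i j
      refine support_eq_empty.1 (Finset.eq_empty_of_forall_notMem fun m hm => ?_)
      exact (Q.homogeneous _ (finSumFinEquiv (.inr i)).2 _ (finSumFinEquiv (.inr j)).2 m hm).1
        (by simp)
    · intro i j m hm
      have h1 := weight_mul_eq _ _ _ Q.weight m
      have h2 := (Q.homogeneous _ (finSumFinEquiv i).2 _ (finSumFinEquiv j).2 m
        (mem_support_iff.2 hm)).2
      have h3 : ((∑ x, m x * Q.W (finSumFinEquiv x) : ℕ) : ℚ) =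
          Q.shiftPos (finSumFinEquiv i) - Q.shiftNeg (finSumFinEquiv i) -
          (Q.shiftPos (finSumFinEquiv j) - Q.shiftNeg (finSumFinEquiv j)) +
          (Q.degPos - Q.degNeg) := by
        have := congrArg (Nat.cast : ℕ → ℚ) h2
        push_cast at this ⊢
        linarith
      rw [h3] at h1
      field_simp
      linarith
    · ext1 i j
      have h1 := Q.sq _ (finSumFinEquiv i).2 _ (finSumFinEquiv j).2
      rw [Finset.sum_range, ← finSumFinEquiv.sum_comp] at h1
      rw [Matrix.mul_apply, Matrix.smul_apply, Matrix.one_apply]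
      simpa only [Matrix.of_apply, Fin.val_inj, EmbeddingLike.apply_eq_iff_eq, smul_eq_mul, mul_ite,
        mul_one, mul_zero] using h1

end

/-! ## Polynomials given by arrays -/

section Sparse

variable {R : Type*} [CommRing R]

/-- The polynomial with `m` terms, with coefficients `coef` and exponents `E`, where variable `i`
has the number `idx i`. -/
noncomputable def sparse {ι : Type*} [Finite ι] (idx : ι → ℕ) (m : ℕ) (coef : ℕ → R)
    (E : ℕ → ℕ → ℕ) : MvPolynomial ι R :=
  ∑ τ ∈ Finset.range m, monomial (Finsupp.equivFunOnFinite.symm fun i => E τ (idx i)) (coef τ)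

/-- The value of a polynomial in `p` variables at `x off, x (off + 1), …`. -/
def evalSparse (p off : ℕ) (x : ℕ → R) (m : ℕ) (coef : ℕ → R) (E : ℕ → ℕ → ℕ) : R :=
  ∑ τ ∈ Finset.range m, coef τ * ∏ i ∈ Finset.range p, x (off + i) ^ E τ i

/-- The value of the partial derivative for variable `s` of a polynomial in `p` variables at
`x off, x (off + 1), …`. -/
def evalSparseDeriv (p off : ℕ) (x : ℕ → R) (m : ℕ) (coef : ℕ → R) (E : ℕ → ℕ → ℕ) (s : ℕ) : R :=
  ∑ τ ∈ Finset.range m, coef τ * (E τ s : R) *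
    ∏ i ∈ Finset.range p, x (off + i) ^ (E τ i - if i = s then 1 else 0)

variable {ι : Type*} [Finite ι] {p : ℕ} (e : ι ≃ Fin p)

theorem eval_sparse (off : ℕ) (x : ℕ → R) (m : ℕ) (coef : ℕ → R) (E : ℕ → ℕ → ℕ) :
    eval (fun i => x (off + e i)) (sparse (fun i => (e i : ℕ)) m coef E) =
      evalSparse p off x m coef E := by
  have := Fintype.ofFinite ι
  rw [sparse, evalSparse, map_sum]
  refine Finset.sum_congr rfl fun τ _ => ?_
  rw [eval_monomial, Finsupp.prod_fintype _ _ (by simp), Finset.prod_range, ← e.prod_comp]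
  simp

/-- Truncation of the exponent at `0` does no harm, since the factor `E τ s` vanishes there;
`pderiv_monomial` has the same convention. -/
theorem eval_pderiv_sparse (off : ℕ) (x : ℕ → R) (m : ℕ) (coef : ℕ → R) (E : ℕ → ℕ → ℕ) (s : ι) :
    eval (fun i => x (off + e i)) (pderiv s (sparse (fun i => (e i : ℕ)) m coef E)) =
      evalSparseDeriv p off x m coef E (e s) := by
  classical
  have := Fintype.ofFinite ι
  rw [sparse, evalSparseDeriv, map_sum, map_sum]
  refine Finset.sum_congr rfl fun τ _ => ?_
  rw [pderiv_monomial, eval_monomial, Finsupp.prod_fintype _ _ (by simp), Finset.prod_range,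
    ← e.prod_comp]
  congr 1
  refine Finset.prod_congr rfl fun i _ => ?_
  simp [Finsupp.single_apply, Fin.val_inj, eq_comm]

end Sparse

/-! ## Terms for polynomials, supertraces and determinants -/

/-- Entry `i` of array `a` of scalars of the certificate `N`. -/
def sca (N : NT) (i : ℕ) : NT := .arr N 0 (.lit i)

/-- The number of variables of the potential in array `a`. -/
def varT (a : ℕ) : NT := .inp a (.lit 0)

def allT : NT := .add (varT 0) (varT 1)

def baseT (N : NT) : NT := .add (sca N 2) (.lit 1)

def sizeT (N : NT) : NT := .add (sca N 0) (sca N 1)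

/-- The number of all variables. -/
def nvar (I : ℕ → ℕ → ℕ) : ℕ := I 0 0 + I 1 0

/-- The bound for the exponents in certificate `N`. -/
def cbase (N : ℕ) : ℕ := arr N 0 2 + 1

@[simp] theorem eval_sca (I : ℕ → ℕ → ℕ) (e : ℕ → ℕ) (N : NT) (i : ℕ) :
    (sca N i).eval I e = arr (N.eval I e) 0 i := by simp [sca]

@[simp] theorem eval_varT (I : ℕ → ℕ → ℕ) (e : ℕ → ℕ) (a : ℕ) : (varT a).eval I e = I a 0 := rfl

@[simp] theorem eval_allT (I : ℕ → ℕ → ℕ) (e : ℕ → ℕ) : allT.eval I e = nvar I := rfl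

@[simp] theorem eval_baseT (I : ℕ → ℕ → ℕ) (e : ℕ → ℕ) (N : NT) :
    (baseT N).eval I e = cbase (N.eval I e) := by simp [baseT, cbase]

@[simp] theorem eval_sizeT (I : ℕ → ℕ → ℕ) (e : ℕ → ℕ) (N : NT) :
    (sizeT N).eval I e = arr (N.eval I e) 0 0 + arr (N.eval I e) 0 1 := by simp [sizeT]

namespace FT

variable {D : Type}

def sparse (p off m : NT) (coef : FT D) (E : NT) : FT D :=
  sum m (mul coef (prod p.up (pow (get 2 (.add off.up.up (.var 0))) E)))

def sparseDeriv (p off m : NT) (coef : FT D) (E s : NT) : FT D :=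
  sum m (mul (mul coef (cast (.bind s.up E)))
    (prod p.up (pow (get 2 (.add off.up.up (.var 0))) (.sub E (.indEq (.var 0) s.up.up)))))

def dense (N : NT) (coef : FT D) : FT D :=
  sparse allT (.lit 0) (.pow (baseT N) allT) coef (.digit (baseT N.up.up) (.var 1) (.var 0))

def denseDeriv (N : NT) (coef : FT D) (s : NT) : FT D :=
  sparseDeriv allT (.lit 0) (.pow (baseT N) allT) coef (.digit (baseT N.up.up) (.var 1) (.var 0)) s

/-- The entry with indices `i` and `j` of the matrix of polynomials in array `a`. -/
def entry (a : ℕ) (N i j : NT) : FT D := dense N (get a (.pair (NT.pair i j).up (.var 0)))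

def entryDeriv (a : ℕ) (N i j s : NT) : FT D :=
  denseDeriv N (get a (.pair (NT.pair i j).up (.var 0))) s

def exponent (a : ℕ) : NT :=
  .inp a (.add (.add (.add (.lit 2) (.mul (.lit 2) (varT a))) (.mul (.var 1) (varT a))) (.var 0))

def numTerms (a : ℕ) : NT := .inp a (.add (.lit 1) (.mul (.lit 2) (varT a)))

/-- The potential in array `a`, in the variables from `off` on. -/
def potential (a : ℕ) (off : NT) : FT D :=
  sparse (varT a) off (numTerms a) (get a (.var 0)) (exponent a)

def potentialDeriv (a : ℕ) (off s : NT) : FT D :=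
  sparseDeriv (varT a) off (numTerms a) (get a (.var 0)) (exponent a) s

def strT (N : NT) : FT D :=
  sum (.pow (sizeT N) (.add allT (.lit 1)))
    (mul (mul
      (cast (.indEq (.digit (sizeT N.up) (.var 0) (.lit 0)) (.digit (sizeT N.up) (.var 0) allT)))
      (sub (cast (.indLt (.digit (sizeT N.up) (.var 0) (.lit 0)) (sca N.up 0)))
        (cast (.sub (.lit 1) (.indLt (.digit (sizeT N.up) (.var 0) (.lit 0)) (sca N.up 0))))))
      (prod allT (entryDeriv 3 N.up.up (.digit (sizeT N.up.up) (.var 1) (.var 0))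
        (.digit (sizeT N.up.up) (.var 1) (.add (.var 0) (.lit 1))) (.var 0))))

/-- The determinant of the matrix of polynomials in array `a`, with `p` rows. -/
def detT (a : ℕ) (N p : NT) : FT D :=
  sum (.pow p p) (mul
    (prod p.up (prod (.var 0)
      (sub (cast (.indLt (.digit p.up.up.up (.var 2) (.var 0))
          (.digit p.up.up.up (.var 2) (.var 1))))
        (cast (.indLt (.digit p.up.up.up (.var 2) (.var 1))
          (.digit p.up.up.up (.var 2) (.var 0)))))))
    (prod p.up (entry a N.up.up (.var 0) (.digit p.up.up (.var 1) (.var 0)))))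

end FT

section Values

variable {R : Type*} [CommRing R] (I : ℕ → ℕ → ℕ) (ρ : ℕ → ℕ → R)

/-- The value of the polynomial with coefficients `coef`. -/
def evalDense (x : ℕ → R) (N : ℕ) (coef : ℕ → R) : R :=
  evalSparse (nvar I) 0 x (cbase N ^ nvar I) coef (digit (cbase N))

def evalEntry (a N i j : ℕ) : R := evalDense I (ρ 2) N fun τ => ρ a (Nat.pair (Nat.pair i j) τ)

def evalEntryDeriv (a N s i j : ℕ) : R :=
  evalSparseDeriv (nvar I) 0 (ρ 2) (cbase N ^ nvar I) (fun τ => ρ a (Nat.pair (Nat.pair i j) τ))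
    (digit (cbase N)) s

def exponents (a : ℕ) (τ i : ℕ) : ℕ := I a (2 + 2 * I a 0 + τ * I a 0 + i)

def evalPotential (a off : ℕ) : R :=
  evalSparse (I a 0) off (ρ 2) (I a (1 + 2 * I a 0)) (ρ a) (exponents I a)

def evalPotentialDeriv (a off s : ℕ) : R :=
  evalSparseDeriv (I a 0) off (ρ 2) (I a (1 + 2 * I a 0)) (ρ a) (exponents I a) s

namespace FT

variable {D : Type} (dv : D → R → R → R) (e : ℕ → ℕ) (N i j s off p : NT) (a : ℕ)

theorem eval_entry : (entry a N i j : FT D).eval dv I ρ e =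
    evalEntry I ρ a (N.eval I e) (i.eval I e) (j.eval I e) := by
  simp [entry, dense, sparse, evalEntry, evalDense, evalSparse, OrbEq.cons]

theorem eval_entryDeriv : (entryDeriv a N i j s : FT D).eval dv I ρ e =
    evalEntryDeriv I ρ a (N.eval I e) (s.eval I e) (i.eval I e) (j.eval I e) := by
  simp [entryDeriv, denseDeriv, sparseDeriv, evalEntryDeriv, evalSparseDeriv, OrbEq.cons]

theorem eval_dense_get : (dense N (get a (.var 0)) : FT D).eval dv I ρ e =
    evalDense I (ρ 2) (N.eval I e) (ρ a) := by
  simp [dense, sparse, evalDense, evalSparse, OrbEq.cons]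

theorem eval_potential : (potential a off : FT D).eval dv I ρ e =
    evalPotential I ρ a (off.eval I e) := by
  simp [potential, sparse, evalPotential, evalSparse, OrbEq.cons, exponent, exponents, numTerms]

theorem eval_potentialDeriv : (potentialDeriv a off s : FT D).eval dv I ρ e =
    evalPotentialDeriv I ρ a (off.eval I e) (s.eval I e) := by
  simp [potentialDeriv, sparseDeriv, evalPotentialDeriv, evalSparseDeriv, OrbEq.cons, exponent,
    exponents, numTerms]

theorem eval_strT : (strT N : FT D).eval dv I ρ e =
    strCode (nvar I) (arr (N.eval I e) 0 0) (arr (N.eval I e) 0 0 + arr (N.eval I e) 0 1)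
      (evalEntryDeriv I ρ 3 (N.eval I e)) := by
  have h : ∀ p : Prop, [Decidable p] → (1 - if p then 1 else 0 : ℕ) = if p then 0 else 1 := by
    intro p _; split_ifs <;> rfl
  simp [strT, strCode, eval_entryDeriv, h, OrbEq.cons]

theorem eval_detT : (detT a N p : FT D).eval dv I ρ e =
    detCode (p.eval I e) (evalEntry I ρ a (N.eval I e)) := by
  simp [detT, detCode, signProd, eval_entry, OrbEq.cons]

end FT

end Values

/-! ## The equations for a matrix factorization with certificates -/

/-- Merges two bounded quantifiers into the single index of a family of equations. -/
theorem forall_lt_mul (A B : ℕ) (P : ℕ → ℕ → Prop) :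
    (∀ r < A * B, P (r / B) (r % B)) ↔ ∀ i < A, ∀ j < B, P i j := by
  constructor
  · intro h i hi j hj
    have hB : 0 < B := by omega
    have h1 : B * i + j < A * B := by
      calc B * i + j < B * i + B := by omega
        _ = (i + 1) * B := by ring
        _ ≤ A * B := Nat.mul_le_mul_right B hi
    have := h (B * i + j) h1
    rwa [Nat.mul_add_div hB, Nat.div_eq_of_lt hj, add_zero, Nat.mul_add_mod, Nat.mod_eq_of_lt hj]
      at this
  · intro h r hr
    have hB : 0 < B := Nat.pos_of_ne_zero (by rintro rfl; simp at hr)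
    exact h _ (Nat.div_lt_of_lt_mul (by rwa [mul_comm] at hr)) _ (Nat.mod_lt _ hB)

/-- A finite family of equations: `bound` may use the parameter `N` as variable `0`, and `term` may
use the index as variable `0` and `N` as variable `1`. -/
structure Eqns where
  bound : NT
  term : FT Empty

namespace Eqns

variable {R : Type*} [CommRing R] (dv : Empty → R → R → R) (I : ℕ → ℕ → ℕ)
  (ρ : ℕ → ℕ → R) (N : ℕ)

def Holds (E : Eqns) : Prop :=
  ∀ r < E.bound.eval I (cons N 0), E.term.eval dv I ρ (cons r (cons N 0)) = 0

/-- The indices of `F` follow those of `E`, and the indicators switch off the term that is not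
meant. -/
def and (E F : Eqns) : Eqns where
  bound := .add E.bound F.bound
  term := .add (.mul (.cast (.indLt (.var 0) E.bound.up)) E.term)
    (.mul (.cast (.indLe E.bound.up (.var 0)))
      (.bind (.sub (.var 0) E.bound.up) (F.term.ren (liftRen Nat.succ))))

theorem holds_and (E F : Eqns) :
    (E.and F).Holds dv I ρ N ↔ E.Holds dv I ρ N ∧ F.Holds dv I ρ N := by
  have hren : ∀ r s, (F.term.ren (liftRen Nat.succ)).eval dv I ρ (cons s (cons r (cons N 0))) =
      F.term.eval dv I ρ (cons s (cons N 0)) := by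
    intro r s
    rw [FT.eval_ren, cons_comp_liftRen]
    rfl
  have hup : ∀ r, E.bound.up.eval I (cons r (cons N 0)) = E.bound.eval I (cons N 0) := fun r =>
    NT.eval_up ..
  simp only [Holds, and, NT.eval, FT.eval, FT.eval_cast, NT.eval_indLt, NT.eval_indLe, hren,
    cons_zero, hup]
  constructor
  · intro h
    constructor
    · intro r hr
      simpa [hr, not_le.2 hr] using h r (by omega)
    · intro r hr
      simpa using h (E.bound.eval I (cons N 0) + r) (by omega)
  · rintro ⟨h1, h2⟩ r hr
    by_cases h : r < E.bound.eval I (cons N 0)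
    · simp [h, not_le.2 h, h1 r h]
    · simp [h, not_lt.1 h, h2 (r - E.bound.eval I (cons N 0)) (by omega)]

/-- The number of rows of the matrix factorization in certificate `N`. -/
def rank (N : ℕ) : ℕ := arr N 0 0 + arr N 0 1

def square : Eqns where
  bound := .mul (sizeT (.var 0)) (sizeT (.var 0))
  term := .sub
    (.sum (sizeT (.var 1)) (.mul
      (.entry 3 (.var 2) (.div (.var 1) (sizeT (.var 2))) (.var 0))
      (.entry 3 (.var 2) (.var 0) (.mod (.var 1) (sizeT (.var 2))))))
    (.mul (.cast (.indEq (.div (.var 0) (sizeT (.var 1))) (.mod (.var 0) (sizeT (.var 1)))))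
      (.sub (.potential 0 (.lit 0)) (.potential 1 (varT 0))))

theorem holds_square : square.Holds dv I ρ N ↔ ∀ i < rank N, ∀ l < rank N,
    ∑ j ∈ Finset.range (rank N), evalEntry I ρ 3 N i j * evalEntry I ρ 3 N j l =
      if i = l then evalPotential I ρ 0 0 - evalPotential I ρ 1 (I 0 0) else 0 := by
  rw [← forall_lt_mul (rank N) (rank N) fun i l =>
    ∑ j ∈ Finset.range (rank N), evalEntry I ρ 3 N i j * evalEntry I ρ 3 N j l =
      if i = l then evalPotential I ρ 0 0 - evalPotential I ρ 1 (I 0 0) else 0]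
  simp [Holds, square, FT.eval_entry, FT.eval_potential, rank, cons, sub_eq_zero]
  rfl

/-- The degree condition for the term with number `τ` of entry `(i, j)`. -/
def Admissible (i j τ : ℕ) : Prop :=
  ¬ (i < arr N 0 0 ↔ j < arr N 0 0) ∧
    (∑ s ∈ Finset.range (nvar I), digit (cbase N) τ s * arr N 1 s) + arr N 3 i + arr N 2 j +
      arr N 0 5 = arr N 2 i + arr N 3 j + arr N 0 4

def degrees : Eqns where
  bound := .mul (.mul (sizeT (.var 0)) (sizeT (.var 0))) (.pow (baseT (.var 0)) allT)
  term := .bind (.div (.var 0) (.pow (baseT (.var 1)) allT))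
    (.bind (.mod (.var 1) (.pow (baseT (.var 2)) allT))
      (.bind (.mod (.var 1) (sizeT (.var 3)))
        (.bind (.div (.var 2) (sizeT (.var 4)))
          -- Variables `0`, `1`, `2` are now `i`, `j`, `τ`, and `5` is `N`. The factor in front of
          -- the coefficient is `0` if the term is admissible and `1` otherwise.
          (.mul (.cast (.sub (.lit 1) (.mul
            (.sub (.lit 1) (.indEq (.indLt (.var 0) (sca (.var 5) 0))
              (.indLt (.var 1) (sca (.var 5) 0))))
            (.indEq
              (.add (.add (.add (.sum allT (.mul (.digit (baseT (.var 6)) (.var 3) (.var 0))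
                (.arr (.var 6) 1 (.var 0)))) (.arr (.var 5) 3 (.var 0))) (.arr (.var 5) 2 (.var 1)))
                (sca (.var 5) 5))
              (.add (.add (.arr (.var 5) 2 (.var 0)) (.arr (.var 5) 3 (.var 1)))
                (sca (.var 5) 4))))))
            (.get 3 (.pair (.pair (.var 0) (.var 1)) (.var 2)))))))

theorem holds_degrees [CharZero R] : degrees.Holds dv I ρ N ↔ ∀ i < rank N, ∀ j < rank N,
    ∀ τ < cbase N ^ nvar I, ρ 3 (Nat.pair (Nat.pair i j) τ) ≠ 0 → Admissible I N i j τ := by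
  rw [← forall_lt_mul (rank N) (rank N) fun i j =>
    ∀ τ < cbase N ^ nvar I, ρ 3 (Nat.pair (Nat.pair i j) τ) ≠ 0 → Admissible I N i j τ,
    ← forall_lt_mul (rank N * rank N) (cbase N ^ nvar I) fun r τ =>
      ρ 3 (Nat.pair (Nat.pair (r / rank N) (r % rank N)) τ) ≠ 0 →
        Admissible I N (r / rank N) (r % rank N) τ]
  have key : ∀ i j τ (y : R), ((1 - (1 - if ((if i < arr N 0 0 then 1 else 0) =
      if j < arr N 0 0 then 1 else 0) then 1 else 0) * (if
    (∑ s ∈ Finset.range (nvar I), digit (cbase N) τ s * arr N 1 s) + arr N 3 i + arr N 2 j +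
      arr N 0 5 = arr N 2 i + arr N 3 j + arr N 0 4 then 1 else 0) : ℕ) : R) * y = 0 ↔
      (y ≠ 0 → Admissible I N i j τ) := by
    intro i j τ y
    rw [Admissible]
    by_cases h : (∑ s ∈ Finset.range (nvar I), digit (cbase N) τ s * arr N 1 s) + arr N 3 i +
      arr N 2 j + arr N 0 5 = arr N 2 i + arr N 3 j + arr N 0 4 <;>
    by_cases hi : i < arr N 0 0 <;> by_cases hj : j < arr N 0 0 <;> simp [hi, hj, h]
  simp only [← key]
  simp [Holds, degrees, rank, cons, -mul_ite]
  rfl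

/-- The weights of the variables of the potential in array `a` are those in the certificate. -/
def weights (a : ℕ) (off : NT) : Eqns where
  bound := varT a
  term := .sub
    (.cast (.mul (.inp a (.add (.lit 1) (.var 0))) (.add (sca (.var 1) 3) (.lit 1))))
    (.cast (.mul (.arr (.var 1) 1 (.add off.up (.var 0)))
      (.inp a (.add (.add (.lit 1) (varT a)) (.var 0)))))

theorem holds_weights [CharZero R] (a : ℕ) (off : NT) :
    (weights a off).Holds dv I ρ N ↔ ∀ i < I a 0,
    I a (1 + i) * (arr N 0 3 + 1) =
      arr N 1 (off.eval I (cons N 0) + i) * I a (1 + I a 0 + i) := by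
  simp only [Holds, weights, sub_eq_zero, FT.eval, FT.eval_cast, Nat.cast_inj]
  simp [cons]

/-- The rows of the matrix in array `A` combine the derivatives of the potential in array `a` to
powers of the variables. -/
def reduction (a A code : ℕ) (off : NT) : Eqns where
  bound := varT a
  term := .sub
    (.sum (varT a) (.mul (.entry A (.var 2) (.var 1) (.var 0))
      (.potentialDeriv a off.up.up (.var 0))))
    -- The exponent is one more than a digit of the scalar with number `code`. The same scalar
    -- numbers the monomial whose coefficient `unit` tests, as the definition of the residue
    -- demands.
    (.pow (.get 2 (.add off.up (.var 0)))
      (.add (.digit (baseT (.var 1)) (sca (.var 1) code) (.add off.up (.var 0))) (.lit 1)))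

theorem holds_reduction (a A code : ℕ) (off : NT) : (reduction a A code off).Holds dv I ρ N ↔
    ∀ i < I a 0, ∑ j ∈ Finset.range (I a 0), evalEntry I ρ A N i j *
        evalPotentialDeriv I ρ a (off.eval I (cons N 0)) j =
      ρ 2 (off.eval I (cons N 0) + i) ^
        (digit (cbase N) (arr N 0 code) (off.eval I (cons N 0) + i) + 1) := by
  simp only [Holds, reduction, sub_eq_zero, FT.eval, FT.eval_entry, FT.eval_potentialDeriv]
  simp [cons]

/-- The polynomial in array `G` is the supertrace times the determinant of the matrix in array
`A`. -/
def product (a A G : ℕ) : Eqns where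
  bound := .lit 1
  term := .sub (.dense (.var 1) (.get G (.var 0)))
    (.mul (.strT (.var 1)) (.detT A (.var 1) (varT a)))

theorem holds_product (a A G : ℕ) : (product a A G).Holds dv I ρ N ↔
    evalDense I (ρ 2) N (ρ G) =
      strCode (nvar I) (arr N 0 0) (rank N) (evalEntryDeriv I ρ 3 N) *
        detCode (I a 0) (evalEntry I ρ A N) := by
  simp only [Holds, product, sub_eq_zero, FT.eval, FT.eval_dense_get, FT.eval_strT, FT.eval_detT]
  simp [cons, rank]

/-- The coefficient with number `code` of the polynomial in array `G` is invertible. -/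
def unit (G U code : ℕ) : Eqns where
  bound := .lit 1
  term := .sub (.mul (.mul
    -- Out of range the left side is `0` and the equation fails: only in range is the entry of `G` a
    -- coefficient of the polynomial.
    (.cast (.indLt (sca (.var 1) code) (.pow (baseT (.var 1)) allT))) (.get U (.lit 0)))
      (.get G (sca (.var 1) code))) .one

theorem holds_unit [Nontrivial R] (G U code : ℕ) : (unit G U code).Holds dv I ρ N ↔
    arr N 0 code < cbase N ^ nvar I ∧ ρ U 0 * ρ G (arr N 0 code) = 1 := by
  by_cases h : arr N 0 code < cbase N ^ nvar I <;> simp [Holds, unit, cons, h, sub_eq_zero]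

/-- The equations for one of the two quantum dimensions. -/
def residue (a A G U code : ℕ) (off : NT) : Eqns :=
  ((reduction a A code off).and (product a A G)).and (unit G U code)

/-- Array `3` holds the matrix factorization, `4` and `5` the reduction matrices, `6` and `7` the
supertrace times their determinants, `8` and `9` the inverses of the tested coefficients. Scalars
`6` and `7` number the tested monomials. -/
def all : Eqns :=
  ((square.and degrees).and ((weights 0 (.lit 0)).and (weights 1 (varT 0)))).and
    ((residue 0 4 6 8 6 (.lit 0)).and (residue 1 5 7 9 7 (varT 0)))

end Eqns

/-! ## Polynomials with bounded exponents -/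

section Dense

variable {R : Type*} [CommRing R] {ι : Type*} [Finite ι] {p : ℕ} (e : ι ≃ Fin p) (b : ℕ)

/-- The monomial with number `τ`. -/
noncomputable def digitExponent (τ : ℕ) : ι →₀ ℕ :=
  Finsupp.equivFunOnFinite.symm fun i => digit b τ (e i)

@[simp] theorem digitExponent_apply (τ : ℕ) (i : ι) : digitExponent e b τ i = digit b τ (e i) := rfl

/-- The polynomial with exponents less than `b` and the given coefficients. -/
noncomputable def dense (coef : ℕ → R) : MvPolynomial ι R :=
  sparse (fun i => (e i : ℕ)) (b ^ p) coef (digit b)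

variable {e b}

theorem digitExponent_injOn {τ τ' : ℕ} (h : τ < b ^ p) (h' : τ' < b ^ p)
    (heq : digitExponent e b τ = digitExponent e b τ') : τ = τ' := by
  have : finFunctionFinEquiv.symm (⟨τ, h⟩ : Fin (b ^ p)) =
      finFunctionFinEquiv.symm (⟨τ', h'⟩ : Fin (b ^ p)) := by
    funext i
    apply Fin.ext
    rw [finFunctionFinEquiv_symm_apply_val, finFunctionFinEquiv_symm_apply_val]
    have := DFunLike.congr_fun heq (e.symm i)
    simpa [digit] using this
  simpa using finFunctionFinEquiv.symm.injective this

theorem exists_digitExponent_eq {m : ι →₀ ℕ} (hm : ∀ i, m i < b) :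
    ∃ τ < b ^ p, digitExponent e b τ = m := by
  obtain ⟨τ, hτ, h⟩ := exists_digit_eq (v := p)
    (fun i => if h : i < p then m (e.symm ⟨i, h⟩) else 0) (b := b)
    (fun i hi => by simpa [hi] using hm _)
  refine ⟨τ, hτ, Finsupp.ext fun i => ?_⟩
  rw [digitExponent_apply, h _ (e i).2]
  simp

theorem coeff_dense [DecidableEq ι] (coef : ℕ → R) (m : ι →₀ ℕ) : coeff m (dense e b coef) =
    ∑ τ ∈ Finset.range (b ^ p), if digitExponent e b τ = m then coef τ else 0 := by
  rw [dense, sparse, coeff_sum]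
  exact Finset.sum_congr rfl fun τ _ => coeff_monomial ..

theorem coeff_digitExponent_dense (coef : ℕ → R) {τ : ℕ} (hτ : τ < b ^ p) :
    coeff (digitExponent e b τ) (dense e b coef) = coef τ := by
  classical
  rw [coeff_dense, Finset.sum_eq_single τ, if_pos rfl]
  · exact fun τ' h' hne => if_neg fun h => hne (digitExponent_injOn (Finset.mem_range.1 h') hτ h)
  · exact fun h => absurd (Finset.mem_range.2 hτ) h

theorem exists_of_mem_support_dense {coef : ℕ → R} {m : ι →₀ ℕ}
    (hm : m ∈ (dense e b coef).support) : ∃ τ < b ^ p, digitExponent e b τ = m ∧ coef τ ≠ 0 := by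
  classical
  rw [mem_support_iff, coeff_dense] at hm
  obtain ⟨τ, hτ, h⟩ := Finset.exists_ne_zero_of_sum_ne_zero hm
  rw [ite_ne_right_iff] at h
  exact ⟨τ, Finset.mem_range.1 hτ, h⟩

/-- Each exponent is at most the total degree, hence a digit in base `b`, so every monomial of `P`
has a number. -/
theorem dense_coeff {P : MvPolynomial ι R} (hP : P.totalDegree < b) :
    dense e b (fun τ => coeff (digitExponent e b τ) P) = P := by
  have := Fintype.ofFinite ι
  ext m
  by_cases hm : ∀ i, m i < b
  · obtain ⟨τ, hτ, rfl⟩ := exists_digitExponent_eq (e := e) hm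
    exact coeff_digitExponent_dense _ hτ
  · have h1 : m ∉ (dense e b fun τ => coeff (digitExponent e b τ) P).support := by
      intro h
      obtain ⟨τ, hτ, rfl, -⟩ := exists_of_mem_support_dense h
      exact hm fun i => Nat.mod_lt _ (by omega)
    have h2 : m ∉ P.support := by
      intro h
      refine hm fun i => lt_of_le_of_lt ?_ hP
      refine le_trans ?_ (le_totalDegree h)
      rw [Finsupp.sum_fintype _ _ (by simp)]
      exact Finset.single_le_sum (f := fun i => m i) (fun _ _ => Nat.zero_le _) (Finset.mem_univ i)
    rw [notMem_support_iff.1 h1, notMem_support_iff.1 h2]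

end Dense

theorem eq_of_eval_eq {k ι : Type*} [Field k] [Infinite k] {p : ℕ} (e : ι ≃ Fin p)
    {P P' : MvPolynomial ι k}
    (h : ∀ x : ℕ → k, (∀ i, p ≤ i → x i = 0) →
      eval (fun i => x (e i)) P = eval (fun i => x (e i)) P') : P = P' := by
  refine MvPolynomial.funext fun y => ?_
  have := h (fun i => if h : i < p then y (e.symm ⟨i, h⟩) else 0) fun i hi => by simp [hi]
  simpa using this

/-- Digits in base `R` are less than `R`, so entries outside the matrix, about which a certificate
says nothing, do not matter. -/
theorem strCode_congr {S : Type*} [CommRing S] {v r R : ℕ} {D D' : ℕ → ℕ → ℕ → S}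
    (h : ∀ s < v, ∀ i < R, ∀ j < R, D s i j = D' s i j) : strCode v r R D = strCode v r R D' := by
  refine Finset.sum_congr rfl fun c hc => ?_
  have hR : 0 < R := Nat.pos_of_ne_zero (by rintro rfl; simp at hc)
  congr 1
  exact Finset.prod_congr rfl fun s hs =>
    h s (Finset.mem_range.1 hs) _ (Nat.mod_lt _ hR) _ (Nat.mod_lt _ hR)

/-! ## The input -/

/-- The arrays `I a` and `c a` describe the potential `f`. -/
structure IsInput {k : Type u} [Field k] {q : ℕ} (I : ℕ → ℕ → ℕ) (c : ℕ → ℕ → k) (a : ℕ)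
    (f : Potential k q) : Prop where
  vars : I a 0 = q
  den_ne_zero : ∀ i : Fin q, I a (1 + q + i) ≠ 0
  weight : ∀ i : Fin q, f.weight i * I a (1 + q + i) = I a (1 + i)
  poly : f.poly = sparse Fin.val (I a (1 + 2 * q)) (c a) (exponents I a)

theorem oracle_two {R : Type*} (c : ℕ → ℕ → R) (x : ℕ → R) (z : ℕ → ℕ → R) :
    oracle c x z 2 = x := rfl

/-! ### Values of the coded polynomials and of the potentials -/

section Evaluation

variable {k : Type u} [Field k] {q n : ℕ}

/-- Evaluation at `x`. -/
noncomputable def evalAt (x : ℕ → k) : MvPolynomial (Fin q ⊕ Fin n) k →+* k :=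
  eval fun s => x (finSumFinEquiv s)

/-- The entry of the matrix of polynomials in array `a`. -/
noncomputable def entry (q n : ℕ) (z : ℕ → ℕ → k) (a N i j : ℕ) : MvPolynomial (Fin q ⊕ Fin n) k :=
  dense finSumFinEquiv (cbase N) fun τ => z a (Nat.pair (Nat.pair i j) τ)

variable {I : ℕ → ℕ → ℕ} (c : ℕ → ℕ → k) (x : ℕ → k) (z : ℕ → ℕ → k) (N : ℕ)

theorem evalAt_dense (hI : nvar I = q + n) (coef : ℕ → k) :
    evalAt x (dense (finSumFinEquiv (m := q) (n := n)) (cbase N) coef) = evalDense I x N coef := by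
  have := eval_sparse (finSumFinEquiv (m := q) (n := n)) 0 x (cbase N ^ (q + n)) coef
    (digit (cbase N))
  rw [evalDense, hI, ← this]
  simp only [zero_add]
  rfl

theorem evalAt_entry (hI : nvar I = q + n) {a : ℕ} (ha : 3 ≤ a) (i j : ℕ) :
    evalAt x (entry q n z a N i j) = evalEntry I (oracle c x z) a N i j := by
  rw [entry, evalAt_dense _ _ hI, evalEntry]
  simp only [oracle, if_neg (show ¬ a < 2 by omega), if_neg (show ¬ a = 2 by omega)]
  rfl

theorem evalAt_pd_entry (hI : nvar I = q + n) (s i j : ℕ) :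
    evalAt x (pd s (entry q n z 3 N i j)) = evalEntryDeriv I (oracle c x z) 3 N s i j := by
  rw [evalEntryDeriv, pd, hI]
  split_ifs with h
  · have := eval_pderiv_sparse (finSumFinEquiv (m := q) (n := n)) 0 x (cbase N ^ (q + n))
      (fun τ => z 3 (Nat.pair (Nat.pair i j) τ)) (digit (cbase N)) (finSumFinEquiv.symm ⟨s, h⟩)
    rw [Equiv.apply_symm_apply] at this
    rw [oracle_two]
    refine Eq.trans ?_ this
    simp only [zero_add]
    rfl
  · rw [map_zero, evalSparseDeriv, Finset.sum_eq_zero]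
    -- Beyond the last variable the exponent digit is `0`, so the formula for the derivative gives
    -- `0`, like `pd`.
    intro τ hτ
    rw [digit_eq_zero (b := cbase N) (Nat.succ_pos _) (Finset.mem_range.1 hτ) (not_lt.1 h)]
    simp

variable {c} {a : ℕ} {p : ℕ} {f : Potential k p} {emb : Fin p → Fin q ⊕ Fin n} {off : ℕ}

theorem evalAt_rename (hoff : ∀ i, (finSumFinEquiv (emb i) : ℕ) = off + i)
    (P : MvPolynomial (Fin p) k) :
    evalAt x (rename emb P) = eval (fun i : Fin p => x (off + Equiv.refl (Fin p) i)) P := by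
  rw [evalAt, eval_rename]
  congr 2
  funext i
  simp [hoff]

theorem IsInput.evalAt_rename (hf : IsInput I c a f) (ha : a < 2)
    (hoff : ∀ i, (finSumFinEquiv (emb i) : ℕ) = off + i) :
    evalAt x (rename emb f.poly) = evalPotential I (oracle c x z) a off := by
  rw [OrbEq.evalAt_rename x hoff, hf.poly, evalPotential, hf.vars, oracle_two, oracle, if_pos ha]
  exact eval_sparse (Equiv.refl (Fin p)) off x _ _ _

theorem IsInput.evalAt_rename_pderiv (hf : IsInput I c a f) (ha : a < 2)
    (hoff : ∀ i, (finSumFinEquiv (emb i) : ℕ) = off + i) (j : Fin p) :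
    evalAt x (rename emb (pderiv j f.poly)) = evalPotentialDeriv I (oracle c x z) a off j := by
  rw [OrbEq.evalAt_rename x hoff, hf.poly, evalPotentialDeriv, hf.vars, oracle_two, oracle,
    if_pos ha]
  exact eval_pderiv_sparse (Equiv.refl (Fin p)) off x _ _ _ j

end Evaluation

/-! ### The equations, for all `x`, as identities of polynomials -/

namespace Eqns

variable {k : Type u} [Field k] {q n : ℕ} {I : ℕ → ℕ → ℕ} (dv : Empty → k → k → k)
  (c : ℕ → ℕ → k) (z : ℕ → ℕ → k) (N : ℕ)

/-- The equations hold for all `x`. -/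
def HoldsAll (E : Eqns) : Prop :=
  ∀ x : ℕ → k, (∀ i, nvar I ≤ i → x i = 0) → E.Holds dv I (oracle c x z) N

theorem holdsAll_and (E F : Eqns) : (E.and F).HoldsAll (I := I) dv c z N ↔
    E.HoldsAll (I := I) dv c z N ∧ F.HoldsAll (I := I) dv c z N := by
  simp only [HoldsAll, holds_and]
  exact ⟨fun h => ⟨fun x hx => (h x hx).1, fun x hx => (h x hx).2⟩,
    fun h x hx => ⟨h.1 x hx, h.2 x hx⟩⟩

theorem forall_const_iff {v : ℕ} (P : Prop) :
    ((∀ x : ℕ → k, (∀ i, v ≤ i → x i = 0) → P) ↔ P) :=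
  ⟨fun h => h 0 fun _ _ => rfl, fun h _ _ => h⟩

variable {c}

/-- A field of characteristic zero is infinite, so polynomials are determined by their values. This
translates the equations for all `x` back into algebra. -/
theorem eq_iff_evalAt_eq [CharZero k] (hI : nvar I = q + n)
    (P P' : MvPolynomial (Fin q ⊕ Fin n) k) :
    P = P' ↔ ∀ x : ℕ → k, (∀ i, nvar I ≤ i → x i = 0) → evalAt x P = evalAt x P' := by
  rw [hI]
  exact ⟨fun h x _ => h ▸ rfl, fun h => eq_of_eval_eq finSumFinEquiv h⟩

theorem holdsAll_square [CharZero k] {f : Potential k q} {g : Potential k n} (hf : IsInput I c 0 f)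
    (hg : IsInput I c 1 g) : square.HoldsAll (I := I) dv c z N ↔ ∀ i < rank N, ∀ l < rank N,
      ∑ j ∈ Finset.range (rank N), entry q n z 3 N i j * entry q n z 3 N j l =
        if i = l then rename Sum.inl f.poly - rename Sum.inr g.poly else 0 := by
  have hI : nvar I = q + n := by rw [nvar, hf.vars, hg.vars]
  simp only [HoldsAll, holds_square, eq_iff_evalAt_eq hI, map_sum, map_mul, apply_ite (evalAt _),
    map_sub, map_zero, evalAt_entry c _ z N hI le_rfl]
  constructor
  · intro h i hi l hl x hx
    rw [h x hx i hi l hl, hf.evalAt_rename x z (by omega) (off := 0) (by simp),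
      hg.evalAt_rename x z (by omega) (off := I 0 0) (by simp [hf.vars])]
  · intro h x hx i hi l hl
    rw [h i hi l hl x hx, hf.evalAt_rename x z (by omega) (off := 0) (by simp),
      hg.evalAt_rename x z (by omega) (off := I 0 0) (by simp [hf.vars])]

theorem holdsAll_degrees [CharZero k] :
    degrees.HoldsAll (I := I) dv c z N ↔ ∀ i < rank N, ∀ j < rank N,
    ∀ τ < cbase N ^ nvar I, z 3 (Nat.pair (Nat.pair i j) τ) ≠ 0 → Admissible I N i j τ := by
  have h : ∀ x : ℕ → k, oracle c x z 3 = z 3 := fun _ => rfl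
  simp only [HoldsAll, holds_degrees, h]
  exact forall_const_iff (k := k) _

theorem holdsAll_weights [CharZero k] {p : ℕ} {f : Potential k p} {a : ℕ}
    (hf : IsInput I c a f) (off : NT) :
    (weights a off).HoldsAll (I := I) dv c z N ↔ ∀ i : Fin p,
      f.weight i * (arr N 0 3 + 1) = arr N 1 (off.eval I (cons N 0) + i) := by
  simp only [HoldsAll, holds_weights]
  rw [forall_const_iff (k := k), hf.vars, Fin.forall_iff]
  refine forall_congr' fun i => forall_congr' fun hi => ?_
  have h1 := hf.weight ⟨i, hi⟩
  have h2 : (I a (1 + p + i) : ℚ) ≠ 0 := by exact_mod_cast hf.den_ne_zero ⟨i, hi⟩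
  rw [← Nat.cast_inj (R := ℚ)]
  push_cast
  rw [← h1]
  exact ⟨fun h => mul_right_cancel₀ h2 (by linear_combination h),
    fun h => by linear_combination (I a (1 + p + i) : ℚ) * h⟩

variable (q n) in
/-- The supertrace for certificate `N`. -/
noncomputable def strPoly : MvPolynomial (Fin q ⊕ Fin n) k :=
  strCode (q + n) (arr N 0 0) (rank N) fun s i j => pd s (entry q n z 3 N i j)

/-- Array `A`, the number with code `code` and arrays `G` and `U` are a certificate for
nonvanishing of the residue. -/
def IsResidueCert {p : ℕ} (f : Potential k p) (emb : Fin p → Fin q ⊕ Fin n) (A G U code : ℕ) :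
    Prop :=
  (∀ i : Fin p, ∑ j : Fin p, entry q n z A N i j * rename emb (pderiv j f.poly) =
    X (emb i) ^ (digitExponent finSumFinEquiv (cbase N) (arr N 0 code) (emb i) + 1)) ∧
  dense finSumFinEquiv (cbase N) (z G) =
    strPoly q n z N * Matrix.det (Matrix.of fun i j : Fin p => entry q n z A N i j) ∧
  arr N 0 code < cbase N ^ (q + n) ∧ z U 0 * z G (arr N 0 code) = 1

theorem holdsAll_residue [CharZero k] {p : ℕ} {f : Potential k p} {a A G U code : ℕ}
    (hf : IsInput I c a f)
    (hI : nvar I = q + n) (ha : a < 2) (hA : 3 ≤ A) (hG : 3 ≤ G) (hU : 3 ≤ U) (off : NT)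
    (emb : Fin p → Fin q ⊕ Fin n)
    (hoff : ∀ i : Fin p, (finSumFinEquiv (emb i) : ℕ) = off.eval I (cons N 0) + i) :
    (Eqns.residue a A G U code off).HoldsAll (I := I) dv c z N ↔
      IsResidueCert z N f emb A G U code := by
  have hor : ∀ x : ℕ → k, ∀ a, 3 ≤ a → oracle c x z a = z a := fun x a h => by
    rw [oracle, if_neg (by omega), if_neg (by omega)]
  have hev : ∀ x : ℕ → k, ∀ i : Fin p, evalAt x (X (emb i)) = x (off.eval I (cons N 0) + i) := by
    intro x i
    rw [evalAt, eval_X, hoff]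
  rw [Eqns.residue, holdsAll_and, holdsAll_and, and_assoc, IsResidueCert]
  refine and_congr ?_ (and_congr ?_ ?_)
  · simp only [HoldsAll, holds_reduction, eq_iff_evalAt_eq hI, map_sum, map_mul, map_pow,
      evalAt_entry c _ z N hI hA, hf.evalAt_rename_pderiv _ z ha hoff, hev, oracle_two, hf.vars,
      Finset.sum_range, digitExponent_apply, hoff]
    exact ⟨fun h i x hx => h x hx i i.2, fun h x hx i hi => h ⟨i, hi⟩ x hx⟩
  · rw [eq_iff_evalAt_eq hI, ← detCode_eq p fun i j => entry q n z A N i j]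
    simp only [HoldsAll, holds_product, map_mul, map_detCode, strPoly, map_strCode,
      evalAt_entry c _ z N hI hA, evalAt_pd_entry c _ z N hI, evalAt_dense _ _ hI, oracle_two,
      hor _ _ hG, hI, hf.vars]
  · simp only [HoldsAll, holds_unit, hor _ _ hG, hor _ _ hU, hI]
    exact forall_const_iff (k := k) _

/-- The equations say that certificate `N` with arrays `z` is a matrix factorization
with certificates for nonvanishing of both quantum dimensions. -/
theorem holdsAll_all_iff [CharZero k] {f : Potential k q} {g : Potential k n} (hf : IsInput I c 0 f)
    (hg : IsInput I c 1 g) : all.HoldsAll (I := I) dv c z N ↔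
      ((∀ i < rank N, ∀ l < rank N,
        ∑ j ∈ Finset.range (rank N), entry q n z 3 N i j * entry q n z 3 N j l =
          if i = l then rename Sum.inl f.poly - rename Sum.inr g.poly else 0) ∧
      (∀ i < rank N, ∀ j < rank N, ∀ τ < cbase N ^ nvar I,
        z 3 (Nat.pair (Nat.pair i j) τ) ≠ 0 → Admissible I N i j τ)) ∧
      (∀ x, Sum.elim f.weight g.weight x * (arr N 0 3 + 1) = arr N 1 (finSumFinEquiv x)) ∧
      IsResidueCert z N f (q := q) (n := n) Sum.inl 4 6 8 6 ∧
      IsResidueCert z N g (q := q) (n := n) Sum.inr 5 7 9 7 := by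
  have hI : nvar I = q + n := by rw [nvar, hf.vars, hg.vars]
  rw [all, holdsAll_and, holdsAll_and, holdsAll_and, holdsAll_and, holdsAll_and,
    holdsAll_square dv z N hf hg,
    holdsAll_degrees, holdsAll_weights dv z N hf, holdsAll_weights dv z N hg,
    holdsAll_residue dv z N hf hI (by omega) (by omega) (by omega) (by omega) _ Sum.inl (by simp),
    holdsAll_residue dv z N hg hI (by omega) (by omega) (by omega) (by omega) _ Sum.inr
      (by simp [hf.vars]), and_assoc, Sum.forall]
  simp [hf.vars]

end Eqns

/-! ### From solutions of the equations to matrix factorizations and back -/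

namespace Eqns

variable {k : Type u} [Field k] {q n : ℕ} {I : ℕ → ℕ → ℕ} {c : ℕ → ℕ → k}

theorem IsResidueCert.residueCert {z : ℕ → ℕ → k} {N p : ℕ} {f : Potential k p}
    {emb : Fin p → Fin q ⊕ Fin n} {A G U code : ℕ} (h : IsResidueCert z N f emb A G U code) :
    ResidueCert (fun j => rename emb (pderiv j f.poly)) emb (strPoly q n z N) := by
  obtain ⟨h1, h2, h3, h4⟩ := h
  refine ⟨Matrix.of fun i j : Fin p => entry q n z A N i j, _, h1, ?_⟩
  rw [← h2, coeff_digitExponent_dense _ h3]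
  exact right_ne_zero_of_mul_eq_one h4

theorem orbifoldEquivalent_of_holdsAll [CharZero k] {f : Potential k q} {g : Potential k n}
    (hf : IsInput I c 0 f) (hg : IsInput I c 1 g) (dv : Empty → k → k → k) (z : ℕ → ℕ → k) (N : ℕ)
    (h : all.HoldsAll (I := I) dv c z N) : OrbifoldEquivalent f g := by
  rw [holdsAll_all_iff dv z N hf hg] at h
  obtain ⟨⟨hsq, hdeg⟩, hw, hl, hr⟩ := h
  rw [show nvar I = q + n by rw [nvar, hf.vars, hg.vars]] at hdeg
  rw [orbifoldEquivalent_iff]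
  refine ⟨⟨arr N 0 0, arr N 0 1, arr N 0 3, arr N 0 4, arr N 0 5, arr N 1, arr N 2, arr N 3,
    entry q n z 3 N, hw, fun i hi j hj m hm => ?_, hsq⟩, hl.residueCert, hr.residueCert⟩
  obtain ⟨τ, hτ, rfl, hz⟩ := exists_of_mem_support_dense hm
  have h1 := hdeg i hi j hj τ hτ hz
  rw [Admissible, show nvar I = q + n by rw [nvar, hf.vars, hg.vars], Finset.sum_range,
    ← finSumFinEquiv.sum_comp] at h1
  exact h1

theorem entry_eq {z : ℕ → ℕ → k} {N a : ℕ} {D : ℕ → ℕ → MvPolynomial (Fin q ⊕ Fin n) k}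
    (hz : ∀ m, z a m = coeff (digitExponent finSumFinEquiv (cbase N) m.unpair.2)
      (D m.unpair.1.unpair.1 m.unpair.1.unpair.2)) {i j : ℕ}
    (hD : (D i j).totalDegree < cbase N) : entry q n z a N i j = D i j := by
  rw [entry]
  simp only [hz, Nat.unpair_pair]
  exact dense_coeff hD

theorem isResidueCert_of {z : ℕ → ℕ → k} {N p : ℕ} {f : Potential k p}
    {emb : Fin p → Fin q ⊕ Fin n} {A G U code : ℕ}
    {M : Matrix (Fin p) (Fin p) (MvPolynomial (Fin q ⊕ Fin n) k)} {ε : Fin q ⊕ Fin n →₀ ℕ}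
    (h1 : ∀ i, ∑ j, M i j * rename emb (pderiv j f.poly) = X (emb i) ^ (ε (emb i) + 1))
    (h2 : coeff ε (strPoly q n z N * M.det) ≠ 0)
    (hA : ∀ i j : Fin p, entry q n z A N i j = M i j)
    (hG : ∀ τ, z G τ = coeff (digitExponent finSumFinEquiv (cbase N) τ) (strPoly q n z N * M.det))
    (hdeg : (strPoly q n z N * M.det).totalDegree < cbase N)
    (hcode : arr N 0 code < cbase N ^ (q + n))
    (hε : digitExponent finSumFinEquiv (cbase N) (arr N 0 code) = ε)
    (hU : z U 0 = (coeff ε (strPoly q n z N * M.det))⁻¹) :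
    IsResidueCert z N f emb A G U code := by
  have hM : (Matrix.of fun i j : Fin p => entry q n z A N i j) = M := by ext1 i j; exact hA i j
  refine ⟨fun i => ?_, ?_, hcode, ?_⟩
  · rw [hε, ← h1]
    simp only [hA]
  · rw [hM, ← dense_coeff hdeg]
    congr 1
    exact _root_.funext hG
  · rw [hU, hG, hε, inv_mul_cancel₀ h2]

/-- The entries of a matrix, with entries `0` outside. -/
def extend {R : Type*} [Zero R] {p : ℕ} (M : Matrix (Fin p) (Fin p) R) (i j : ℕ) : R :=
  if h : i < p ∧ j < p then M ⟨i, h.1⟩ ⟨j, h.2⟩ else 0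

@[simp] theorem extend_apply {R : Type*} [Zero R] {p : ℕ} (M : Matrix (Fin p) (Fin p) R)
    (i j : Fin p) : extend M i j = M i j := by simp [extend]

/-- The discrete data of the factorization and of both residue certificates are coded in `N`, and
the coefficients of all polynomials, listed by digits of exponents, form `z`. -/
theorem exists_holdsAll [CharZero k] {f : Potential k q} {g : Potential k n}
    (hf : IsInput I c 0 f) (hg : IsInput I c 1 g) (dv : Empty → k → k → k)
    (h : OrbifoldEquivalent f g) : ∃ N z, all.HoldsAll (I := I) dv c z N := by
  rw [orbifoldEquivalent_iff] at h
  obtain ⟨Q, ⟨ML, εL, hL, hL'⟩, ⟨MR, εR, hR, hR'⟩⟩ := h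
  let R := Q.r + Q.s
  -- A common bound for the total degrees of all coded polynomials and for the exponents `εL` and
  -- `εR`, so that base `B + 1` suffices for every monomial.
  let B : ℕ := (∑ i ∈ Finset.range R, ∑ j ∈ Finset.range R, (Q.d i j).totalDegree) +
    (∑ i, ∑ j, (ML i j).totalDegree) + (∑ i, ∑ j, (MR i j).totalDegree) +
    (Q.str * ML.det).totalDegree + (Q.str * MR.det).totalDegree + (∑ i, εL i) + (∑ i, εR i)
  have hsum : ∀ {p : ℕ} (F : Fin p → Fin p → ℕ) (i j), F i j ≤ ∑ i, ∑ j, F i j := fun F i j =>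
    (Finset.single_le_sum (f := fun j => F i j) (fun _ _ => Nat.zero_le _)
      (Finset.mem_univ j)).trans
      (Finset.single_le_sum (f := fun i => ∑ j, F i j) (fun _ _ => Nat.zero_le _)
        (Finset.mem_univ i))
  have hd : ∀ i < R, ∀ j < R, (Q.d i j).totalDegree < B + 1 := by
    intro i hi j hj
    have h1 := Finset.single_le_sum (f := fun j => (Q.d i j).totalDegree)
      (fun _ _ => Nat.zero_le _) (Finset.mem_range.2 hj)
    have h2 := Finset.single_le_sum (f := fun i => ∑ j ∈ Finset.range R, (Q.d i j).totalDegree)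
      (fun _ _ => Nat.zero_le _) (Finset.mem_range.2 hi)
    omega
  have hML : ∀ i j, (ML i j).totalDegree < B + 1 := by
    intro i j
    have := hsum (fun i j => (ML i j).totalDegree) i j
    omega
  have hMR : ∀ i j, (MR i j).totalDegree < B + 1 := by
    intro i j
    have := hsum (fun i j => (MR i j).totalDegree) i j
    omega
  have hεL : ∀ i, εL i < B + 1 := by
    intro i
    have := Finset.single_le_sum (f := fun i => εL i) (fun _ _ => Nat.zero_le _)
      (Finset.mem_univ i)
    omega
  have hεR : ∀ i, εR i < B + 1 := by
    intro i
    have := Finset.single_le_sum (f := fun i => εR i) (fun _ _ => Nat.zero_le _)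
      (Finset.mem_univ i)
    omega
  obtain ⟨cL, hcL, hcL'⟩ := exists_digitExponent_eq (e := finSumFinEquiv (m := q) (n := n)) hεL
  obtain ⟨cR, hcR, hcR'⟩ := exists_digitExponent_eq (e := finSumFinEquiv (m := q) (n := n)) hεR
  let scalars : ℕ → ℕ
    | 0 => Q.r
    | 1 => Q.s
    | 2 => B
    | 3 => Q.den
    | 4 => Q.degPos
    | 5 => Q.degNeg
    | 6 => cL
    | _ => cR
  let arrays : ℕ → ℕ → ℕ
    | 0 => scalars
    | 1 => Q.W
    | 2 => Q.shiftPos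
    | _ => Q.shiftNeg
  -- Four arrays, long enough for the eight scalars, the `q + n` weights and the `R` shifts.
  obtain ⟨N, hN⟩ := exists_arr_eq arrays 4 (8 + (q + n) + R)
  have h0 : ∀ i < 8, arr N 0 i = scalars i := fun i hi => hN 0 (by omega) i (by omega)
  have hB : cbase N = B + 1 := by rw [cbase, h0 2 (by omega)]; rfl
  have hrank : rank N = R := by rw [rank, h0 0 (by omega), h0 1 (by omega)]; rfl
  let E : ℕ → (Fin q ⊕ Fin n →₀ ℕ) := digitExponent finSumFinEquiv (B + 1)
  let entries (D : ℕ → ℕ → MvPolynomial (Fin q ⊕ Fin n) k) (m : ℕ) : k :=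
    coeff (E m.unpair.2) (D m.unpair.1.unpair.1 m.unpair.1.unpair.2)
  let z : ℕ → ℕ → k
    | 3 => entries Q.d
    | 4 => entries (extend ML)
    | 5 => entries (extend MR)
    | 6 => fun τ => coeff (E τ) (Q.str * ML.det)
    | 7 => fun τ => coeff (E τ) (Q.str * MR.det)
    | 8 => fun _ => (coeff εL (Q.str * ML.det))⁻¹
    | _ => fun _ => (coeff εR (Q.str * MR.det))⁻¹
  have h3 : ∀ i < R, ∀ j < R, entry q n z 3 N i j = Q.d i j := fun i hi j hj =>
    entry_eq (D := Q.d) (by rw [hB]; exact fun _ => rfl) (by rw [hB]; exact hd i hi j hj)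
  have h4 : ∀ i j : Fin q, entry q n z 4 N i j = ML i j := fun i j =>
    (entry_eq (D := extend ML) (by rw [hB]; exact fun _ => rfl)
      (by rw [hB, extend_apply]; exact hML i j)).trans (extend_apply ..)
  have h5 : ∀ i j : Fin n, entry q n z 5 N i j = MR i j := fun i j =>
    (entry_eq (D := extend MR) (by rw [hB]; exact fun _ => rfl)
      (by rw [hB, extend_apply]; exact hMR i j)).trans (extend_apply ..)
  have hstr : strPoly q n z N = Q.str := by
    rw [strPoly, hrank, h0 0 (by omega)]
    exact strCode_congr fun s _ i hi j hj => by rw [h3 i hi j hj]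
  have hI : nvar I = q + n := by rw [nvar, hf.vars, hg.vars]
  refine ⟨N, z, (holdsAll_all_iff dv z N hf hg).2 ⟨⟨?_, ?_⟩, fun x => ?_, ?_, ?_⟩⟩
  · rw [hrank]
    intro i hi l hl
    rw [← Q.sq i hi l hl]
    refine Finset.sum_congr rfl fun j hj => ?_
    rw [h3 i hi j (Finset.mem_range.1 hj), h3 j (Finset.mem_range.1 hj) l hl]
  · rw [hrank, hB, hI]
    intro i hi j hj τ hτ hz
    have hz' : coeff (E τ) (Q.d i j) ≠ 0 := by
      have : z 3 (Nat.pair (Nat.pair i j) τ) = coeff (E τ) (Q.d i j) := by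
        simp only [z, entries, Nat.unpair_pair]
      rwa [this] at hz
    have h1 := Q.homogeneous i hi j hj _ (mem_support_iff.2 hz')
    rw [Admissible, hI, Finset.sum_range, ← finSumFinEquiv.sum_comp, h0 0 (by omega),
      h0 4 (by omega), h0 5 (by omega), hN 2 (by omega) i (by omega), hN 2 (by omega) j (by omega),
      hN 3 (by omega) i (by omega), hN 3 (by omega) j (by omega), hB]
    simp only [fun x : Fin q ⊕ Fin n => hN 1 (by omega) (finSumFinEquiv x)
      (by have := (finSumFinEquiv x).2; omega)]
    exact h1
  · rw [h0 3 (by omega), hN 1 (by omega) _ (by have := (finSumFinEquiv x).2; omega)]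
    exact Q.weight x
  · refine isResidueCert_of hL (by rwa [hstr]) h4 ?_ ?_ ?_ ?_ ?_
    · rw [hstr, hB]; exact fun _ => rfl
    · rw [hstr, hB]; omega
    · rw [hB, h0 6 (by omega)]; exact hcL
    · rw [hB, h0 6 (by omega)]; exact hcL'
    · rw [hstr]; rfl
  · refine isResidueCert_of hR (by rwa [hstr]) h5 ?_ ?_ ?_ ?_ ?_
    · rw [hstr, hB]; exact fun _ => rfl
    · rw [hstr, hB]; omega
    · rw [hB, h0 7 (by omega)]; exact hcR
    · rw [hB, h0 7 (by omega)]; exact hcR'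
    · rw [hstr]; rfl

end Eqns

/-! ## The input store -/

section Input

variable {k : Type u} {q : ℕ} (w : Fin q → ℚ) (l : List ((Fin q → ℕ) × k))

theorem discreteData_zero : (discreteData w l).getD 0 0 = q := by simp [discreteData]

theorem discreteData_num (i : Fin q) : (discreteData w l).getD (1 + i) 0 = (w i).num.toNat := by
  rw [discreteData, add_comm, List.cons_append, List.cons_append, List.getD_cons_succ,
    List.append_assoc, List.getD_append _ _ _ _ (by simp), List.getD_eq_getElem _ _ (by simp)]
  simp

theorem discreteData_den (i : Fin q) : (discreteData w l).getD (1 + q + i) 0 = (w i).den := by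
  rw [discreteData, add_assoc, add_comm 1, List.cons_append, List.cons_append,
    List.getD_cons_succ, List.append_assoc, List.getD_append_right _ _ _ _ (by simp)]
  rw [List.getD_append _ _ _ _ (by simp), List.getD_eq_getElem _ _ (by simp)]
  simp

theorem discreteData_length : (discreteData w l).getD (1 + 2 * q) 0 = l.length := by
  rw [discreteData, add_comm 1, List.cons_append, List.cons_append,
    List.getD_cons_succ, List.getD_append_right _ _ _ _ (by simp; omega)]
  simp [two_mul]

theorem getD_flatMap_ofFn {α : Type*} (F : α → Fin q → ℕ) (l : List α) (τ : ℕ) (hτ : τ < l.length)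
    (i : Fin q) : (l.flatMap fun t => List.ofFn (F t)).getD (τ * q + i) 0 = F l[τ] i := by
  induction l generalizing τ with
  | nil => simp at hτ
  | cons t l ih =>
    rw [List.flatMap_cons]
    cases τ with
    | zero =>
      rw [zero_mul, zero_add, List.getD_append _ _ _ _ (by simp),
        List.getD_eq_getElem _ _ (by simp)]
      simp
    | succ τ =>
      rw [List.getD_append_right _ _ _ _ (by simp [Nat.succ_mul]; omega)]
      have := ih τ (by simpa using hτ)
      rw [List.length_ofFn, Nat.succ_mul, show τ * q + q + i - q = τ * q + i by omega, this]
      simp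

theorem discreteData_exponent (τ : ℕ) (hτ : τ < l.length) (i : Fin q) :
    (discreteData w l).getD (2 + 2 * q + τ * q + i) 0 = l[τ].1 i := by
  rw [discreteData, show 2 + 2 * q + τ * q + i = (2 * q + (τ * q + i + 1)) + 1 by omega,
    List.cons_append, List.cons_append, List.getD_cons_succ,
    List.getD_append_right _ _ _ _ (by simp; omega)]
  have : 2 * q + (τ * q + i + 1) - ((List.ofFn fun i => (w i).num.toNat) ++
      List.ofFn fun i => (w i).den).length = τ * q + i + 1 := by simp; omega
  rw [this, List.getD_cons_succ]
  exact getD_flatMap_ofFn (fun t : (Fin q → ℕ) × k => t.1) l τ hτ i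

/-- Weights are positive, so the natural number stored as numerator loses nothing. Exponent vectors
may repeat in the list, and `sparse` adds such terms just as `polyOfTerms` does. -/
theorem isInput_of_data [Field k] {I : ℕ → ℕ → ℕ} {c : ℕ → ℕ → k} {a : ℕ} {f : Potential k q}
    (hl : polyOfTerms l = f.poly) (hI : ∀ i, I a i = (discreteData f.weight l).getD i 0)
    (hc : ∀ i, c a i = (l.map Prod.snd).getD i 0) : IsInput I c a f where
  vars := by rw [hI, discreteData_zero]
  den_ne_zero i := by rw [hI, discreteData_den]; exact (f.weight i).den_nz
  weight i := by
    rw [hI, hI, discreteData_den, discreteData_num, Rat.mul_den_eq_num]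
    exact_mod_cast (Int.toNat_of_nonneg (Rat.num_pos.2 (f.weight_pos i)).le).symm
  poly := by
    rw [← hl, polyOfTerms, sparse, hI, discreteData_length, Finset.sum_range, ← List.sum_ofFn]
    congr 1
    refine List.ext_getElem (by simp) fun τ h1 h2 => ?_
    have hτ : τ < l.length := by simpa using h1
    rw [List.getElem_map, List.getElem_ofFn]
    congr 1
    · congr 1
      refine Finsupp.ext fun i => ?_
      change l[τ].1 i = exponents I a τ i
      rw [exponents, hI, hI, discreteData_zero]
      exact (discreteData_exponent _ l τ hτ i).symm
    · rw [hc, List.getD_eq_getElem _ _ (by simpa using hτ), List.getElem_map]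

end Input

end OrbEq

/-! ### The semidecision procedure -/

theorem mainTheorem1 :
    ∃ P : OrbEq.Program, ∀ (k : Type u) [Field k] [IsAlgClosed k] [CharZero k] (q n : ℕ)
      (f : OrbEq.Potential k q) (g : OrbEq.Potential k n)
      (l : List ((Fin q → ℕ) × k)) (l' : List ((Fin n → ℕ) × k)),
      OrbEq.polyOfTerms l = f.poly → OrbEq.polyOfTerms l' = g.poly →
      (OrbEq.Terminates P (OrbEq.inputStore f.weight l g.weight l') ↔
        OrbEq.OrbifoldEquivalent f g) := by
  -- The terms read the numbers of variables from the input, so one program serves all `k`, `q` and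
  -- `n`.
  obtain ⟨P, hP⟩ := OrbEq.exists_program_exists_zero OrbEq.Eqns.all.bound OrbEq.allT
    OrbEq.Eqns.all.term
  refine ⟨P, fun k _ _ _ q n f g l l' hl hl' => ?_⟩
  have hf : OrbEq.IsInput (OrbEq.inputStore f.weight l g.weight l').nat
      (OrbEq.inputStore f.weight l g.weight l').fld 0 f :=
    OrbEq.isInput_of_data l hl (fun _ => rfl) fun _ => rfl
  have hg : OrbEq.IsInput (OrbEq.inputStore f.weight l g.weight l').nat
      (OrbEq.inputStore f.weight l g.weight l').fld 1 g :=
    OrbEq.isInput_of_data l' hl' (fun _ => rfl) fun _ => rfl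
  rw [hP k _ (fun d => d.elim)]
  · constructor
    · rintro ⟨N, z, h⟩
      exact OrbEq.Eqns.orbifoldEquivalent_of_holdsAll hf hg (fun d => d.elim) z N
        fun x hx r hr => h r hr x hx
    · intro h
      obtain ⟨N, z, h⟩ := OrbEq.Eqns.exists_holdsAll hf hg (fun d => d.elim) h
      exact ⟨N, z, fun r hr x hx => h x hx r hr⟩
  · intro a ha
    funext i
    simp [OrbEq.inputStore, show a ≠ 0 by omega, show a ≠ 1 by omega]
  · intro a ha
    funext i
    simp [OrbEq.inputStore, show a ≠ 0 by omega, show a ≠ 1 by omega]
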